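/- **Setting.** Let $R$ be a commutative ring and $F(x,y)=x+_F y$ a one-dimensional commutative formal group law over $R$. Let $M$ be a free abelian group of finite rank with a reduced root datum: finitely many roots $\alpha\in M$ with coroots $\alpha^\vee\in M^\vee$. Let $s_\alpha(\lambda)=\lambda-\alpha^\vee(\lambda)\alpha$, let $W$ be the Weyl group, and fix a basis of simple roots $\alpha_1,\dots,\alpha_n$ with simple reflections $s_1,\dots,s_n$. A reduced decomposition of $w\in W$ is a sequence $I=(i_1,\dots,i_l)$ of minimal length with $w=s_{i_1}\cdots s_{i_l}$. **Formal group ring.** For a set $S$, let $R[\![x_S]\!]$ be the completion of the polynomial ring $R[x_s,\ s\in S]$ for the adic topology of the ideal generated by the variables. Put $R[\![M]\!]_F=R[\![x_M]\!]/\mathcal J_F$, where $\mathcal J_F$ is the closure of the ideal generated by $x_0$ and all $x_{\lambda+\mu}-(x_\lambda+_F x_\mu)$ with $\lambda,\mu\in M$. Let $\varepsilon:R[\![M]\!]_F\to R$ be the augmentation, $x_\lambda\mapsto 0$. Each $s_\alpha$ acts on $R[\![M]\!]_F$ by the continuous $R$-algebra automorphism with $x_\lambda\mapsto x_{s_\alpha(\lambda)}$.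 **Operators.** Let $U$ be the universal formal group law over the Lazard ring $\mathbb L$. On $\mathbb L[\![M]\!]_U$, which is a domain, every $u-s_\alpha(u)$ is uniquely divisible by $x_\alpha$; put $\Delta^U_\alpha(u)=(u-s_\alpha(u))/x_\alpha$. Let $f:\mathbb L\to R$ be the homomorphism classifying $F$ and $f_\star:\mathbb L[\![M]\!]_U\to R[\![M]\!]_F$ the induced homomorphism, $x_\lambda\mapsto x_\lambda$. Then $\Delta^F_\alpha=\mathrm{id}_R\otimes\Delta^U_\alpha$ is the unique continuous $R$-linear operator on $R[\![M]\!]_F$ with $\Delta^F_\alpha\circ f_\star=f_\star\circ\Delta^U_\alpha$. Let $g$ be the power series with $x+_Fy=x+y-xy\,g(x,y)$, and put $C^F_\alpha(u)=u\,g(x_\alpha,x_{-\alpha})-\Delta^F_\alpha(u)$. For $I=(i_1,\dots,i_l)$ put $\Delta^F_I=\Delta^F_{\alpha_{i_1}}\circ\cdots\circ\Delta^F_{\alpha_{i_l}}$ and $C^F_I=C^F_{\alpha_{i_1}}\circ\cdots\circ C^F_{\alpha_{i_l}}$. Let $D(M)_F$ be the $R$-subalgebra of $\mathrm{End}_R(R[\![M]\!]_F)$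 generated by the $\Delta^F_\alpha$, for all roots $\alpha$, and by the multiplications by elements of $R[\![M]\!]_F$; it is an $R[\![M]\!]_F$-module by $(uT)(v)=u\cdot T(v)$. **Torsion index.** Let $\mathfrak t$ be the torsion index of the root datum: for the additive formal group law $F_a$ over $\mathbb Z$ and reduced decompositions $I_0$ of the longest element of $W$, the elements $\varepsilon(\Delta^{F_a}_{I_0}(u))$ with $u\in\mathbb Z[\![M]\!]_{F_a}$ generate the ideal $\mathfrak t\,\mathbb Z$ of $\mathbb Z$. **Theorem.** For each $w\in W$ choose a reduced decomposition $I_w$ in simple reflections. 1. The operators $\Delta^F_{I_w}$, $w\in W$, generate $D(M)_F$ as an $R[\![M]\!]_F$-module, and so do the operators $C^F_{I_w}$, $w\in W$. 2. Assume that $2$ is regular in $R$ or that $\mathfrak t$ is regular in $R$ (that is, not a zero divisor). Then the operators $\Delta^F_{I_w}$, $w\in W$, form a basis of $D(M)_F$ as an $R[\![M]\!]_F$-module, and so do the operators $C^F_{I_w}$, $w\in W$. -/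

import Mathlib

open Topology Filter

noncomputable section

set_option linter.unusedSectionVars false

namespace FormalGroupRing

section PowerRing

variable (R : Type*) [CommRing R] (S : Type*)

/-- The polynomial ring `R[x_S]`; as a type of its own, so that it can carry the adic topology. -/
def PolyRing := MvPolynomial S R

instance : CommRing (PolyRing R S) := inferInstanceAs (CommRing (MvPolynomial S R))
instance : Algebra R (PolyRing R S) := inferInstanceAs (Algebra R (MvPolynomial S R))

/-- The variable `x_s` of `R[x_S]`. -/
def polyX (s : S) : PolyRing R S := MvPolynomial.X s

variable {R S} in
theorem poly_hom_ext {A : Type*} [CommRing A] [Algebra R A] {g h : PolyRing R S →ₐ[R] A}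
    (H : ∀ s, g (polyX R S s) = h (polyX R S s)) : g = h :=
  MvPolynomial.algHom_ext (R := R) (σ := S) H

/-- The augmentation `R[x_S] → R`, mapping every variable to `0`. -/
def polyAug : PolyRing R S →ₐ[R] R := MvPolynomial.aeval (fun _ : S => (0 : R))

/-- `R[x_S]` with the adic topology of the kernel of the augmentation. -/
instance : WithIdeal (PolyRing R S) := ⟨RingHom.ker (polyAug R S)⟩

theorem hasBasis_poly : (𝓝 (0 : PolyRing R S)).HasBasis (fun _ : ℕ => True)
    fun n => ((RingHom.ker (polyAug R S) ^ n : Ideal (PolyRing R S)) : Set (PolyRing R S)) :=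
  Ideal.hasBasis_nhds_zero_adic _

instance : UniformContinuousConstSMul R (PolyRing R S) where
  uniformContinuous_const_smul r := by
    have h : (fun x : PolyRing R S => r • x) = fun x => algebraMap R (PolyRing R S) r * x := by
      funext x; exact Algebra.smul_def r x
    exact h ▸ uniformContinuous_of_continuousAt_zero
      (AddMonoidHom.mulLeft (algebraMap R (PolyRing R S) r))
      (continuous_const_mul _).continuousAt

/-- The completed ring `R⟦x_S⟧`: the completion of `R[x_S]` for the adic topology of the kernel
of the augmentation. -/
abbrev PowerRing := UniformSpace.Completion (PolyRing R S)

theorem hasBasis_power : (𝓝 (0 : PowerRing R S)).HasBasis (fun _ : ℕ => True)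
    fun n => closure ((UniformSpace.Completion.coeRingHom : PolyRing R S →+* PowerRing R S) ''
      ((RingHom.ker (polyAug R S) ^ n : Ideal (PolyRing R S)) : Set (PolyRing R S))) :=
  (hasBasis_poly R S).hasBasis_of_isDenseInducing UniformSpace.Completion.isDenseInducing_coe

/-- The closure in `R⟦x_S⟧` of an ideal of `R[x_S]`. -/
def closureIdeal (I : Ideal (PolyRing R S)) : Ideal (PowerRing R S) where
  carrier := closure ((UniformSpace.Completion.coeRingHom : PolyRing R S →+* PowerRing R S) '' I)
  zero_mem' := subset_closure ⟨0, I.zero_mem, map_zero _⟩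
  add_mem' := by
    intro a b ha hb
    refine map_mem_closure₂ continuous_add ha hb ?_
    rintro _ ⟨x, hx, rfl⟩ _ ⟨y, hy, rfl⟩
    exact ⟨x + y, I.add_mem hx hy, map_add _ _ _⟩
  smul_mem' := by
    intro a b hb
    have ha : a ∈ closure (Set.range
        (UniformSpace.Completion.coeRingHom : PolyRing R S →+* PowerRing R S)) :=
      UniformSpace.Completion.denseRange_coe a
    refine map_mem_closure₂ continuous_mul ha hb ?_
    rintro _ ⟨x, rfl⟩ _ ⟨y, hy, rfl⟩
    exact ⟨x * y, I.mul_mem_left x hy, map_mul _ _ _⟩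

instance : IsLinearTopology (PowerRing R S) (PowerRing R S) :=
  IsLinearTopology.mk_of_hasBasis (PowerRing R S) (S := Ideal (PowerRing R S))
    (s := fun n : ℕ => closureIdeal R S (RingHom.ker (polyAug R S) ^ n)) (hasBasis_power R S)

instance : FirstCountableTopology (PowerRing R S) := by
  have h : (𝓝 (0 : PowerRing R S)).IsCountablyGenerated := (hasBasis_power R S).isCountablyGenerated
  have : (uniformity (PowerRing R S)).IsCountablyGenerated :=
    IsUniformAddGroup.uniformity_countably_generated
  infer_instance

/-- The variable `x_s`. -/
def powerX (s : S) : PowerRing R S :=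
  UniformSpace.Completion.coeRingHom (polyX R S s)

end PowerRing

section Evaluation

variable {R : Type*} [CommRing R] {B : Type*} [CommRing B] [Algebra R B] [UniformSpace B]

/-- The value `f(a)` of a power series `f` over `R` (with the discrete topology) at a family `a`
of elements of a complete linearly topologized `R`-algebra. -/
def evalPS {σ : Type*} (a : σ → B) (f : MvPowerSeries σ R) : B :=
  letI : UniformSpace R := ⊥
  MvPowerSeries.eval₂ (algebraMap R B) a f

/-- A closed ideal whose powers tend to `0`. -/
structure IsTopNil (N : Ideal B) : Prop where
  isClosed : IsClosed (N : Set B)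
  pow_le : ∀ U ∈ 𝓝 (0 : B), ∃ n : ℕ, ((N ^ n : Ideal B) : Set B) ⊆ U

theorem IsTopNil.hasEval {N : Ideal B} (hN : IsTopNil N) {σ : Type*} [Finite σ] {a : σ → B}
    (ha : ∀ s, a s ∈ N) : MvPowerSeries.HasEval a where
  hpow s := by
    refine tendsto_def.2 fun U hU => ?_
    obtain ⟨n, hn⟩ := hN.pow_le U hU
    filter_upwards [eventually_ge_atTop n] with m hm
    exact hn (Ideal.pow_le_pow_right hm (Ideal.pow_mem_pow (ha s) m))
  tendsto_zero := by simp [cofinite_eq_bot]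

variable [IsUniformAddGroup B] [IsTopologicalRing B] [IsLinearTopology B B] [CompleteSpace B]
  [T2Space B]

theorem evalPS_X {σ : Type*} (a : σ → B) (s : σ) :
    evalPS a (MvPowerSeries.X s : MvPowerSeries σ R) = a s := by
  let _ : UniformSpace R := ⊥
  exact MvPowerSeries.eval₂_X _ _ _

theorem continuousSMul_bot : @ContinuousSMul R B _ (⊥ : UniformSpace R).toTopologicalSpace _ := by
  let _ : UniformSpace R := ⊥
  refine ⟨?_⟩
  have h : (fun p : R × B => p.1 • p.2) = fun p => algebraMap R B p.1 * p.2 := by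
    funext p; exact Algebra.smul_def _ _
  rw [h]
  exact (continuous_of_discreteTopology.comp continuous_fst).mul continuous_snd

/-- Evaluation of power series as an algebra homomorphism. -/
def evalHom {σ : Type*} {a : σ → B} (ha : MvPowerSeries.HasEval a) : MvPowerSeries σ R →ₐ[R] B :=
  letI : UniformSpace R := ⊥
  haveI : ContinuousSMul R B := continuousSMul_bot
  MvPowerSeries.aeval ha

theorem evalHom_apply {σ : Type*} {a : σ → B} (ha : MvPowerSeries.HasEval a)
    (f : MvPowerSeries σ R) : evalHom ha f = evalPS a f := by
  let _ : UniformSpace R := ⊥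
  have : ContinuousSMul R B := continuousSMul_bot
  exact congrFun (MvPowerSeries.coe_aeval ha) f

theorem hasSum_evalPS {σ : Type*} {a : σ → B} (ha : MvPowerSeries.HasEval a)
    (f : MvPowerSeries σ R) :
    HasSum (fun d : σ →₀ ℕ => algebraMap R B (MvPowerSeries.coeff d f) *
      d.prod fun s e => a s ^ e) (evalPS a f) := by
  let _ : UniformSpace R := ⊥
  exact MvPowerSeries.hasSum_eval₂ continuous_of_discreteTopology ha f

theorem evalPS_subst {σ τ : Type*} {c : σ → MvPowerSeries τ R} (hc : MvPowerSeries.HasSubst c)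
    {a : τ → B} (ha : MvPowerSeries.HasEval a) (f : MvPowerSeries σ R) :
    evalPS a (MvPowerSeries.subst c f) = evalPS (fun s => evalPS a (c s)) f := by
  let _ : UniformSpace R := ⊥
  have : ContinuousSMul R B := continuousSMul_bot
  exact MvPowerSeries.eval₂_subst hc ha f

theorem map_evalPS {C : Type*} [CommRing C] [Algebra R C] [UniformSpace C] [IsUniformAddGroup C]
    [IsTopologicalRing C] [IsLinearTopology C C] [CompleteSpace C] [T2Space C]
    {g : B →ₐ[R] C} (hg : Continuous g) {σ : Type*} {a : σ → B} (ha : MvPowerSeries.HasEval a)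
    (f : MvPowerSeries σ R) : g (evalPS a f) = evalPS (fun s => g (a s)) f := by
  let _ : UniformSpace R := ⊥
  have h := MvPowerSeries.comp_eval₂ (φ := algebraMap R B) continuous_of_discreteTopology ha
    (ε := (g : B →+* C)) hg
  have h' := congrFun h f
  simpa [evalPS, Function.comp_def] using h'

theorem IsTopNil.evalPS_mem {N : Ideal B} (hN : IsTopNil N) {σ : Type*} [Finite σ] {a : σ → B}
    (ha : ∀ s, a s ∈ N) {f : MvPowerSeries σ R} (hf : f.constantCoeff = 0) :
    evalPS a f ∈ N := by
  refine hN.isClosed.mem_of_tendsto (hasSum_evalPS (hN.hasEval ha) f)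
    (Eventually.of_forall fun s => N.sum_mem fun d _ => ?_)
  by_cases hd : d = 0
  · subst hd
    have : MvPowerSeries.coeff 0 f = 0 := by simpa using hf
    simp [this]
  · obtain ⟨i, hi⟩ := Finsupp.ne_iff.1 hd
    refine N.mul_mem_left _ ?_
    refine N.prod_mem (Finsupp.mem_support_iff.2 hi) (N.pow_mem_of_mem (ha i) _ ?_)
    exact Nat.pos_of_ne_zero hi

/-- The elements of a closed ideal whose powers tend to `0`, as points of the formal group law
`F`: the addition is `(a, b) ↦ F(a, b)`. -/
@[nolint unusedArguments]
def Point (_F : FormalGroup R) {N : Ideal B} (_hN : IsTopNil N) := {a : B // a ∈ N}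

variable {F : FormalGroup R} {N : Ideal B} {hN : IsTopNil N}

instance : Add (Point F hN) where
  add a b := ⟨evalPS ![a.1, b.1] F.toPowerSeries,
    hN.evalPS_mem (by intro s; fin_cases s; exacts [a.2, b.2]) F.zero_constantCoeff⟩

instance : Zero (Point F hN) := ⟨⟨0, N.zero_mem⟩⟩

theorem Point.add_val (a b : Point F hN) :
    (a + b).1 = evalPS ![a.1, b.1] F.toPowerSeries := rfl

theorem Point.zero_val : (0 : Point F hN).1 = 0 := rfl

theorem Point.hasEval_two (a b : Point F hN) : MvPowerSeries.HasEval ![a.1, b.1] :=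
  hN.hasEval (by intro s; fin_cases s; exacts [a.2, b.2])

theorem Point.hasEval_three (a b c : Point F hN) : MvPowerSeries.HasEval ![a.1, b.1, c.1] :=
  hN.hasEval (by intro s; fin_cases s; exacts [a.2, b.2, c.2])

theorem evalPS_zero {σ : Type*} {a : σ → B} (ha : MvPowerSeries.HasEval a) :
    evalPS a (0 : MvPowerSeries σ R) = 0 := by
  rw [← evalHom_apply ha, map_zero]

instance [F.IsComm] : AddCommMonoid (Point F hN) where
  zero_add a := Subtype.ext (by
    have ha : MvPowerSeries.HasEval (fun _ : Fin 1 => a.1) := hN.hasEval fun _ => a.2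
    have h := congrArg (evalPS fun _ : Fin 1 => a.1)
      (F.zero_add (f := (MvPowerSeries.X 0 : MvPowerSeries (Fin 1) R))
        (by simp [PowerSeries.HasSubst]))
    rw [evalPS_subst MvPowerSeries.HasSubst.zero_X ha, evalPS_X] at h
    rw [Point.add_val, Point.zero_val]
    refine Eq.trans ?_ h
    congr 1
    funext s; fin_cases s
    · simp [evalPS_zero ha]
    · simp [evalPS_X])
  add_zero a := Subtype.ext (by
    have ha : MvPowerSeries.HasEval (fun _ : Fin 1 => a.1) := hN.hasEval fun _ => a.2
    have h := congrArg (evalPS fun _ : Fin 1 => a.1)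
      (F.add_zero (f := (MvPowerSeries.X 0 : MvPowerSeries (Fin 1) R))
        (by simp [PowerSeries.HasSubst]))
    rw [evalPS_subst MvPowerSeries.HasSubst.X_zero ha, evalPS_X] at h
    rw [Point.add_val, Point.zero_val]
    refine Eq.trans ?_ h
    congr 1
    funext s; fin_cases s
    · simp [evalPS_X]
    · simp [evalPS_zero ha])
  add_comm a b := Subtype.ext (by
    have h := congrArg (evalPS ![a.1, b.1]) (FormalGroup.IsComm.comm (F := F))
    rw [evalPS_subst MvPowerSeries.HasSubst.X_X (Point.hasEval_two a b)] at h
    rw [Point.add_val, h, Point.add_val]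
    congr 1
    funext s; fin_cases s <;> simp [evalPS_X])
  add_assoc a b c := Subtype.ext (by
    have h3 := Point.hasEval_three a b c
    have h := congrArg (evalPS ![a.1, b.1, c.1]) F.assoc
    rw [evalPS_subst (MvPowerSeries.HasSubst.cons_subst_zero_left 0 1 2 F.zero_constantCoeff) h3,
      evalPS_subst (MvPowerSeries.HasSubst.cons_subst_zero_right 0 1 2 F.zero_constantCoeff) h3]
      at h
    rw [Point.add_val, Point.add_val (a := a) (b := b + c)]
    convert h using 2
    · funext s; fin_cases s
      · simp only [Fin.zero_eta, Matrix.cons_val_zero]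
        rw [evalPS_subst MvPowerSeries.HasSubst.X_X h3, Point.add_val]
        congr 1; funext s; fin_cases s <;> simp [evalPS_X]
      · simp [evalPS_X]
    · funext s; fin_cases s
      · simp [evalPS_X]
      · simp only [Fin.mk_one, Matrix.cons_val_one, Matrix.cons_val_fin_one]
        rw [evalPS_subst MvPowerSeries.HasSubst.X_X h3, Point.add_val]
        congr 1; funext s; fin_cases s <;> simp [evalPS_X])
  nsmul := nsmulRec

end Evaluation

section Augmentation

variable (R : Type*) [CommRing R] (S : Type*)

theorem uniformContinuous_polyAug :
    @UniformContinuous (PolyRing R S) R _ ⊥ (polyAug R S) := by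
  let _ : UniformSpace R := ⊥
  refine uniformContinuous_of_continuousAt_zero (polyAug R S) ?_
  rw [ContinuousAt, map_zero, nhds_discrete R, tendsto_pure]
  filter_upwards [(hasBasis_poly R S).mem_of_mem (i := 1) trivial] with x hx
  simpa using hx

/-- The augmentation `R⟦x_S⟧ → R`. -/
def powerAug : PowerRing R S →ₐ[R] R :=
  letI : UniformSpace R := ⊥
  { IsDenseInducing.extendRingHom (i := (UniformSpace.Completion.coeRingHom :
      PolyRing R S →+* PowerRing R S)) (f := (polyAug R S : PolyRing R S →+* R))
      (UniformSpace.Completion.isUniformInducing_coe _) UniformSpace.Completion.denseRange_coe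
      (uniformContinuous_polyAug R S) with
    commutes' := fun r =>
      (UniformSpace.Completion.isDenseInducing_coe.extend_eq
        (uniformContinuous_polyAug R S).continuous (algebraMap R (PolyRing R S) r)).trans
        ((polyAug R S).commutes r) }

theorem powerAug_coe (p : PolyRing R S) :
    powerAug R S (UniformSpace.Completion.coeRingHom p) = polyAug R S p := by
  let _ : UniformSpace R := ⊥
  exact UniformSpace.Completion.isDenseInducing_coe.extend_eq
    (uniformContinuous_polyAug R S).continuous p

theorem continuous_powerAug : @Continuous (PowerRing R S) R _ ⊥ (powerAug R S) := by
  let _ : UniformSpace R := ⊥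
  exact (uniformContinuous_uniformly_extend (UniformSpace.Completion.isUniformInducing_coe _)
    UniformSpace.Completion.denseRange_coe (uniformContinuous_polyAug R S)).continuous

theorem isClopen_ker_powerAug : IsClopen (RingHom.ker (powerAug R S) : Set (PowerRing R S)) := by
  let _ : UniformSpace R := ⊥
  exact (isClopen_discrete ({0} : Set R)).preimage (continuous_powerAug R S)

theorem sup_pow_le {A : Type*} [CommRing A] (I K : Ideal A) (n : ℕ) :
    (I ⊔ K) ^ n ≤ I ^ n ⊔ K := by
  induction n with
  | zero => simp
  | succ n ih =>
    calc (I ⊔ K) ^ (n + 1) = (I ⊔ K) ^ n * (I ⊔ K) := pow_succ _ _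
      _ ≤ (I ^ n ⊔ K) * (I ⊔ K) := Ideal.mul_mono ih le_rfl
      _ ≤ I ^ (n + 1) ⊔ K := by
        rw [Ideal.sup_mul, Ideal.mul_sup, ← pow_succ]
        exact sup_le (sup_le le_sup_left (Ideal.mul_le_right.trans le_sup_right))
          (Ideal.mul_le_left.trans le_sup_right)

theorem isTopNil_power : IsTopNil (RingHom.ker (powerAug R S)) where
  isClosed := (isClopen_ker_powerAug R S).isClosed
  pow_le U hU := by
    obtain ⟨K, hK, hKU⟩ := (IsLinearTopology.hasBasis_open_ideal (R := PowerRing R S)).mem_iff.1 hU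
    let c : PolyRing R S →+* PowerRing R S := UniformSpace.Completion.coeRingHom
    have hc : Continuous c := UniformSpace.Completion.continuous_coeRingHom
    obtain ⟨n, -, hn⟩ := (hasBasis_poly R S).mem_iff.1
      ((hK.preimage hc).mem_nhds (show c 0 ∈ K by rw [map_zero]; exact K.zero_mem))
    refine ⟨n, fun x hx => hKU ?_⟩
    have h1 : RingHom.ker (powerAug R S) ≤ Ideal.map c (RingHom.ker (polyAug R S)) ⊔ K := by
      intro y hy
      have hopen : IsOpen ((fun z : PowerRing R S => y - z) ⁻¹'
          ((K : Set (PowerRing R S)) ∩ RingHom.ker (powerAug R S))) :=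
        (hK.inter (isClopen_ker_powerAug R S).isOpen).preimage (continuous_const.sub continuous_id)
      obtain ⟨p, hp⟩ := UniformSpace.Completion.denseRange_coe.exists_mem_open hopen
        ⟨y, by simp⟩
      have hpK : y - c p ∈ K := hp.1
      have hp0 : powerAug R S (y - c p) = 0 := hp.2
      have hp1 : p ∈ RingHom.ker (polyAug R S) := by
        rw [RingHom.mem_ker]
        have : powerAug R S y = 0 := hy
        rw [map_sub, this, zero_sub, neg_eq_zero] at hp0
        rw [← powerAug_coe]; exact hp0
      rw [← add_sub_cancel (c p) y]
      exact Ideal.add_mem _ (Ideal.mem_sup_left (Ideal.mem_map_of_mem c hp1))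
        (Ideal.mem_sup_right hpK)
    have h2 : (Ideal.map c (RingHom.ker (polyAug R S)) ⊔ K) ^ n ≤ K := by
      refine (sup_pow_le _ K n).trans (sup_le ?_ le_rfl)
      rw [← Ideal.map_pow]
      exact Ideal.map_le_iff_le_comap.2 hn
    exact h2 (Ideal.pow_right_mono h1 n hx)

end Augmentation

section Lift

variable {R : Type*} [CommRing R] {B : Type*} [CommRing B] [Algebra R B] [UniformSpace B]
  [IsUniformAddGroup B] [IsTopologicalRing B] [IsLinearTopology B B] [CompleteSpace B]
  [T2Space B] {N : Ideal B} {S : Type*}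

/-- Evaluation of polynomials at a family of elements of `B`. -/
def polyEval (a : S → B) : PolyRing R S →ₐ[R] B := MvPolynomial.aeval a

theorem uniformContinuous_polyEval (hN : IsTopNil N) {a : S → B} (ha : ∀ s, a s ∈ N) :
    UniformContinuous (polyEval (R := R) a) := by
  refine uniformContinuous_of_continuousAt_zero (polyEval (R := R) a) ?_
  rw [ContinuousAt, map_zero]
  refine tendsto_def.2 fun U hU => ?_
  obtain ⟨n, hn⟩ := hN.pow_le U hU
  refine mem_of_superset ((hasBasis_poly R S).mem_of_mem (i := n) trivial) fun x hx => hn ?_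
  have h : RingHom.ker (polyAug R S) ≤ Ideal.comap (polyEval (R := R) a) N := by
    intro p hp
    rw [Ideal.mem_comap, ← Ideal.Quotient.eq_zero_iff_mem]
    have h1 : (Ideal.Quotient.mkₐ R N).comp (polyEval (R := R) a) =
        (Algebra.ofId R (B ⧸ N)).comp (polyAug R S) := by
      refine poly_hom_ext fun s => ?_
      have e1 : polyEval (R := R) a (polyX R S s) = a s :=
        MvPolynomial.aeval_X _ _
      have e2 : polyAug R S (polyX R S s) = 0 :=
        MvPolynomial.aeval_X _ _
      rw [AlgHom.comp_apply, AlgHom.comp_apply, e1, e2, map_zero]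
      exact Ideal.Quotient.eq_zero_iff_mem.2 (ha s)
    have h2 := DFunLike.congr_fun h1 p
    have h3 : polyAug R S p = 0 := hp
    simpa [h3] using h2
  exact (Ideal.le_comap_pow _ n) (Ideal.pow_right_mono h n hx)

/-- The continuous extension of the evaluation of polynomials to `R⟦x_S⟧`. -/
def powerEval (hN : IsTopNil N) {a : S → B} (ha : ∀ s, a s ∈ N) : PowerRing R S →ₐ[R] B :=
  { IsDenseInducing.extendRingHom (i := (UniformSpace.Completion.coeRingHom :
      PolyRing R S →+* PowerRing R S)) (f := (polyEval (R := R) a : PolyRing R S →+* B))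
      (UniformSpace.Completion.isUniformInducing_coe _) UniformSpace.Completion.denseRange_coe
      (uniformContinuous_polyEval hN ha) with
    commutes' := fun r =>
      (UniformSpace.Completion.isDenseInducing_coe.extend_eq
        (uniformContinuous_polyEval (R := R) hN ha).continuous
        (algebraMap R (PolyRing R S) r)).trans ((polyEval (R := R) a).commutes r) }

theorem powerEval_coe (hN : IsTopNil N) {a : S → B} (ha : ∀ s, a s ∈ N) (p : PolyRing R S) :
    powerEval (R := R) hN ha (UniformSpace.Completion.coeRingHom p) = polyEval (R := R) a p :=
  UniformSpace.Completion.isDenseInducing_coe.extend_eq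
    (uniformContinuous_polyEval (R := R) hN ha).continuous p

theorem powerEval_X (hN : IsTopNil N) {a : S → B} (ha : ∀ s, a s ∈ N) (s : S) :
    powerEval (R := R) hN ha (powerX R S s) = a s :=
  (powerEval_coe hN ha _).trans (MvPolynomial.aeval_X _ _)

theorem continuous_powerEval (hN : IsTopNil N) {a : S → B} (ha : ∀ s, a s ∈ N) :
    Continuous (powerEval (R := R) hN ha) :=
  (uniformContinuous_uniformly_extend (UniformSpace.Completion.isUniformInducing_coe _)
    UniformSpace.Completion.denseRange_coe (uniformContinuous_polyEval (R := R) hN ha)).continuous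

theorem powerAug_X (s : S) : powerAug R S (powerX R S s) = 0 :=
  (powerAug_coe R S _).trans (MvPolynomial.aeval_X _ _)

/-- Two continuous algebra homomorphisms on `R⟦x_S⟧` that agree on the variables are equal. -/
theorem power_hom_ext {g h : PowerRing R S →ₐ[R] B} (hg : Continuous g) (hh : Continuous h)
    (H : ∀ s, g (powerX R S s) = h (powerX R S s)) : g = h := by
  have h1 : ∀ p : PolyRing R S, g (UniformSpace.Completion.coeRingHom p) =
      h (UniformSpace.Completion.coeRingHom p) := by
    let c : PolyRing R S →ₐ[R] PowerRing R S :=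
      { (UniformSpace.Completion.coeRingHom : PolyRing R S →+* PowerRing R S) with
        commutes' := fun _ => rfl }
    have h2 : g.comp c = h.comp c := poly_hom_ext H
    exact fun p => DFunLike.congr_fun h2 p
  exact DFunLike.coe_injective
    (UniformSpace.Completion.denseRange_coe.equalizer hg hh (funext h1))

end Lift

section FGRing

variable {R : Type*} [CommRing R] (F : FormalGroup R) (M : Type*) [AddCommGroup M]

/-- The closure of the ideal of `R⟦x_M⟧` generated by `x_0` and by the elements
`x_{μ + ν} - F(x_μ, x_ν)`. -/
def relIdeal : Ideal (PowerRing R M) :=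
  (Ideal.span ({powerX R M 0} ∪ {z | ∃ μ ν : M, z = powerX R M (μ + ν) -
    evalPS ![powerX R M μ, powerX R M ν] F.toPowerSeries})).closure

theorem isClosed_relIdeal : IsClosed (relIdeal F M : Set (PowerRing R M)) :=
  isClosed_closure

/-- The formal group ring `R⟦M⟧_F`. -/
def FGRing := PowerRing R M ⧸ relIdeal F M

instance : CommRing (FGRing F M) := inferInstanceAs (CommRing (PowerRing R M ⧸ relIdeal F M))

instance : Algebra R (FGRing F M) := inferInstanceAs (Algebra R (PowerRing R M ⧸ relIdeal F M))

instance : TopologicalSpace (FGRing F M) :=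
  inferInstanceAs (TopologicalSpace (PowerRing R M ⧸ relIdeal F M))

instance : IsTopologicalRing (FGRing F M) :=
  inferInstanceAs (IsTopologicalRing (PowerRing R M ⧸ relIdeal F M))

/-- The uniform structure of the topological group `R⟦M⟧_F`. -/
instance : UniformSpace (FGRing F M) := IsTopologicalAddGroup.rightUniformSpace (FGRing F M)

instance : IsUniformAddGroup (FGRing F M) := isUniformAddGroup_of_addCommGroup

instance : CompleteSpace (FGRing F M) :=
  QuotientAddGroup.completeSpace_right (PowerRing R M) (relIdeal F M).toAddSubgroup

/-- The quotient map `R⟦x_M⟧ → R⟦M⟧_F`. -/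
def toFGRing : PowerRing R M →ₐ[R] FGRing F M := Ideal.Quotient.mkₐ R (relIdeal F M)

theorem toFGRing_surjective : Function.Surjective (toFGRing F M) :=
  Ideal.Quotient.mkₐ_surjective R (relIdeal F M)

theorem isOpenQuotientMap_toFGRing : IsOpenQuotientMap (toFGRing F M) :=
  QuotientRing.isOpenQuotientMap_mk (relIdeal F M)

theorem continuous_toFGRing : Continuous (toFGRing F M) :=
  (isOpenQuotientMap_toFGRing F M).continuous

theorem toFGRing_eq_zero {z : PowerRing R M} : toFGRing F M z = 0 ↔ z ∈ relIdeal F M :=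
  Ideal.Quotient.eq_zero_iff_mem

instance : T2Space (FGRing F M) := by
  have : T1Space (FGRing F M) := by
    refine IsTopologicalAddGroup.t1Space _ ?_
    rw [← (isOpenQuotientMap_toFGRing F M).isQuotientMap.isClosed_preimage]
    have h : toFGRing F M ⁻¹' {0} = (relIdeal F M : Set (PowerRing R M)) := by
      ext z; exact toFGRing_eq_zero F M
    rw [h]; exact isClosed_relIdeal F M
  infer_instance

instance : IsLinearTopology (FGRing F M) (FGRing F M) := by
  refine isLinearTopology_iff_hasBasis_open_ideal.2 ⟨fun U => ⟨fun hU => ?_, ?_⟩⟩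
  · obtain ⟨K, hK, hKU⟩ := (IsLinearTopology.hasBasis_open_ideal (R := PowerRing R M)).mem_iff.1
      ((continuous_toFGRing F M).continuousAt.preimage_mem_nhds
        (show U ∈ 𝓝 (toFGRing F M 0) by rwa [map_zero]))
    refine ⟨K.map (toFGRing F M), ?_, ?_⟩
    · have h : ((K.map (toFGRing F M) : Ideal (FGRing F M)) : Set (FGRing F M)) =
          toFGRing F M '' K := by
        ext z
        exact Ideal.mem_map_iff_of_surjective (toFGRing F M) (toFGRing_surjective F M)
      rw [h]
      exact (isOpenQuotientMap_toFGRing F M).isOpenMap _ hK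
    · intro z hz
      obtain ⟨y, hy, rfl⟩ :=
        (Ideal.mem_map_iff_of_surjective (toFGRing F M) (toFGRing_surjective F M)).1 hz
      exact hKU hy
  · rintro ⟨K, hK, hKU⟩
    exact mem_of_superset (hK.mem_nhds K.zero_mem) hKU

theorem relIdeal_le_ker_powerAug : relIdeal F M ≤ RingHom.ker (powerAug R M) := by
  refine closure_minimal ?_ (isClopen_ker_powerAug R M).isClosed
  refine SetLike.coe_subset_coe.2 (Ideal.span_le.2 ?_)
  rintro _ (rfl | ⟨μ, ν, rfl⟩)
  · exact powerAug_X 0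
  · refine Ideal.sub_mem _ (powerAug_X _) ((isTopNil_power R M).evalPS_mem ?_ F.zero_constantCoeff)
    intro s; fin_cases s
    exacts [powerAug_X _, powerAug_X _]

/-- The augmentation `R⟦M⟧_F → R`. -/
def aug : FGRing F M →ₐ[R] R :=
  Ideal.Quotient.liftₐ (relIdeal F M) (powerAug R M) fun _ h => relIdeal_le_ker_powerAug F M h

theorem aug_toFGRing (z : PowerRing R M) : aug F M (toFGRing F M z) = powerAug R M z := rfl

theorem isTopNil_aug : IsTopNil (RingHom.ker (aug F M)) where
  isClosed := by
    rw [← (isOpenQuotientMap_toFGRing F M).isQuotientMap.isClosed_preimage]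
    exact (isClopen_ker_powerAug R M).isClosed
  pow_le U hU := by
    obtain ⟨n, hn⟩ := (isTopNil_power R M).pow_le _
      ((continuous_toFGRing F M).continuousAt.preimage_mem_nhds
        (show U ∈ 𝓝 (toFGRing F M 0) by rwa [map_zero]))
    refine ⟨n, fun z hz => ?_⟩
    have h : RingHom.ker (aug F M) ≤ (RingHom.ker (powerAug R M)).map (toFGRing F M) := by
      intro y hy
      obtain ⟨x, rfl⟩ := toFGRing_surjective F M y
      exact Ideal.mem_map_of_mem _ hy
    have hz' := Ideal.pow_right_mono h n hz
    rw [← Ideal.map_pow] at hz'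
    obtain ⟨y, hy, rfl⟩ :=
      (Ideal.mem_map_iff_of_surjective (toFGRing F M) (toFGRing_surjective F M)).1 hz'
    exact hn hy

theorem continuous_aug : @Continuous (FGRing F M) R _ ⊥ (aug F M) :=
  let _ : TopologicalSpace R := ⊥
  (isOpenQuotientMap_toFGRing F M).isQuotientMap.continuous_iff.2 (continuous_powerAug R M)

variable {M}

/-- The class of `x_μ` in `R⟦M⟧_F`. -/
def x (μ : M) : FGRing F M := toFGRing F M (powerX R M μ)

theorem aug_x (μ : M) : aug F M (x F μ) = 0 := powerAug_X μ

theorem x_mem (μ : M) : x F μ ∈ RingHom.ker (aug F M) := RingHom.mem_ker.2 (aug_x F μ)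

theorem x_zero : x F (0 : M) = 0 :=
  (toFGRing_eq_zero F M).2 (subset_closure (Ideal.subset_span (Or.inl rfl)))

theorem x_add (μ ν : M) : x F (μ + ν) = evalPS ![x F μ, x F ν] F.toPowerSeries := by
  have h : toFGRing F M (powerX R M (μ + ν) -
      evalPS ![powerX R M μ, powerX R M ν] F.toPowerSeries) = 0 :=
    (toFGRing_eq_zero F M).2 (subset_closure (Ideal.subset_span (Or.inr ⟨μ, ν, rfl⟩)))
  rw [map_sub, sub_eq_zero] at h
  refine h.trans ?_
  rw [map_evalPS (continuous_toFGRing F M)]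
  · congr 1; funext s; fin_cases s <;> rfl
  · refine (isTopNil_power R M).hasEval ?_
    intro s; fin_cases s
    exacts [powerAug_X _, powerAug_X _]

/-- The homomorphism `μ ↦ x_μ` from `M` to the points of `F` in `R⟦M⟧_F`. -/
def xHom [F.IsComm] : M →+ Point F (isTopNil_aug F M) where
  toFun μ := ⟨x F μ, aug_x F μ⟩
  map_zero' := Subtype.ext (x_zero F)
  map_add' μ ν := Subtype.ext (x_add F μ ν)

variable {F}
variable {B : Type*} [CommRing B] [Algebra R B] [UniformSpace B] [IsUniformAddGroup B]
  [IsTopologicalRing B] [IsLinearTopology B B] [CompleteSpace B] [T2Space B] {N : Ideal B}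
  {hN : IsTopNil N} [F.IsComm]

theorem relIdeal_le_ker_powerEval (φ : M →+ Point F hN) :
    relIdeal F M ≤ RingHom.ker (powerEval (R := R) hN (a := fun μ => (φ μ).1) fun μ => (φ μ).2) := by
  have hc := continuous_powerEval (R := R) hN (a := fun μ => (φ μ).1) fun μ => (φ μ).2
  refine closure_minimal ?_ (isClosed_singleton.preimage hc)
  refine SetLike.coe_subset_coe.2 (Ideal.span_le.2 ?_)
  rintro _ (rfl | ⟨μ, ν, rfl⟩)
  · refine RingHom.mem_ker.2 ((powerEval_X _ _ _).trans ?_)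
    rw [map_zero]; rfl
  · refine RingHom.mem_ker.2 ?_
    rw [map_sub, sub_eq_zero, powerEval_X, map_add, Point.add_val, map_evalPS hc]
    · congr 1; funext s; fin_cases s <;> simp [powerEval_X]
    · refine (isTopNil_power R M).hasEval ?_
      intro s; fin_cases s
      exacts [powerAug_X _, powerAug_X _]

/-- The continuous homomorphism on `R⟦M⟧_F` given by a homomorphism from `M` to points of `F`. -/
def lift (φ : M →+ Point F hN) : FGRing F M →ₐ[R] B :=
  Ideal.Quotient.liftₐ (relIdeal F M) (powerEval hN fun μ => (φ μ).2)
    fun _ h => relIdeal_le_ker_powerEval φ h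

theorem lift_x (φ : M →+ Point F hN) (μ : M) : lift φ (x F μ) = (φ μ).1 :=
  powerEval_X (R := R) hN (fun μ => (φ μ).2) μ

theorem continuous_lift (φ : M →+ Point F hN) : Continuous (lift φ) :=
  (isOpenQuotientMap_toFGRing F M).isQuotientMap.continuous_iff.2
    (continuous_powerEval hN fun μ => (φ μ).2)

theorem hom_ext {g h : FGRing F M →ₐ[R] B} (hg : Continuous g) (hh : Continuous h)
    (H : ∀ μ, g (x F μ) = h (x F μ)) : g = h := by
  have h1 : g.comp (toFGRing F M) = h.comp (toFGRing F M) :=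
    power_hom_ext (hg.comp (continuous_toFGRing F M)) (hh.comp (continuous_toFGRing F M)) H
  refine AlgHom.ext fun z => ?_
  obtain ⟨y, rfl⟩ := toFGRing_surjective F M z
  exact DFunLike.congr_fun h1 y

end FGRing

section Kappa
variable {R : Type*} [CommRing R] (F : FormalGroup R)

/-- The power series `g` with `F(X, Y) = X + Y - X Y g(X, Y)`. -/
def gSeries : MvPowerSeries (Fin 2) R :=
  fun d => -MvPowerSeries.coeff (d + (Finsupp.single 0 1 + Finsupp.single 1 1)) F.toPowerSeries

theorem coeff_gSeries (d : Fin 2 →₀ ℕ) : MvPowerSeries.coeff d (gSeries F) =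
    -MvPowerSeries.coeff (d + (Finsupp.single 0 1 + Finsupp.single 1 1)) F.toPowerSeries := rfl

theorem coeff_axis_zero (d : Fin 2 →₀ ℕ) (hd : d 1 = 0) :
    MvPowerSeries.coeff d F.toPowerSeries =
      MvPowerSeries.coeff d (MvPowerSeries.X 0 : MvPowerSeries (Fin 2) R) := by
  classical
  have h := congrArg (MvPowerSeries.coeff d)
    (F.add_zero (f := (MvPowerSeries.X 0 : MvPowerSeries (Fin 2) R)) (by simp [PowerSeries.HasSubst]))
  rw [← h, MvPowerSeries.coeff_subst MvPowerSeries.HasSubst.X_zero, finsum_eq_single _ d]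
  · have : d = Finsupp.single 0 (d 0) := by ext i; fin_cases i <;> simp [hd]
    simp [Finsupp.prod_fintype, hd, MvPowerSeries.coeff_X_pow, ← this]
  · intro e he
    by_cases h1 : e 1 = 0
    · have h0 : d ≠ Finsupp.single 0 (e 0) := by
        intro h; apply he; rw [h]; ext i; fin_cases i <;> simp [h1]
      simp [Finsupp.prod_fintype, h1, MvPowerSeries.coeff_X_pow, h0]
    · simp [Finsupp.prod_fintype, h1]

theorem coeff_axis_one (d : Fin 2 →₀ ℕ) (hd : d 0 = 0) :
    MvPowerSeries.coeff d F.toPowerSeries =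
      MvPowerSeries.coeff d (MvPowerSeries.X 1 : MvPowerSeries (Fin 2) R) := by
  classical
  have h := congrArg (MvPowerSeries.coeff d)
    (F.zero_add (f := (MvPowerSeries.X 1 : MvPowerSeries (Fin 2) R)) (by simp [PowerSeries.HasSubst]))
  rw [← h, MvPowerSeries.coeff_subst MvPowerSeries.HasSubst.zero_X, finsum_eq_single _ d]
  · have : d = Finsupp.single 1 (d 1) := by ext i; fin_cases i <;> simp [hd]
    simp [Finsupp.prod_fintype, hd, MvPowerSeries.coeff_X_pow, ← this]
  · intro e he
    by_cases h1 : e 0 = 0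
    · have h0 : d ≠ Finsupp.single 1 (e 1) := by
        intro h; apply he; rw [h]; ext i; fin_cases i <;> simp [h1]
      simp [Finsupp.prod_fintype, h1, MvPowerSeries.coeff_X_pow, h0]
    · simp [Finsupp.prod_fintype, h1]

theorem toPowerSeries_eq : F.toPowerSeries = MvPowerSeries.X 0 + MvPowerSeries.X 1 -
    MvPowerSeries.X 0 * MvPowerSeries.X 1 * gSeries F := by
  classical
  have hm : (MvPowerSeries.X 0 * MvPowerSeries.X 1 : MvPowerSeries (Fin 2) R) =
      MvPowerSeries.monomial (Finsupp.single 0 1 + Finsupp.single 1 1) 1 := by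
    rw [MvPowerSeries.X, MvPowerSeries.X, MvPowerSeries.monomial_mul_monomial, one_mul]
  ext d
  rw [map_sub, map_add, hm, MvPowerSeries.coeff_monomial_mul, one_mul, coeff_gSeries]
  by_cases h1 : d 1 = 0
  · have h2 : ¬ (Finsupp.single 0 1 + Finsupp.single 1 1 ≤ d) := fun h => by
      simpa [h1] using h 1
    have h3 : d ≠ Finsupp.single 1 1 := fun h => by simp [h] at h1
    rw [if_neg h2, coeff_axis_zero F d h1, MvPowerSeries.coeff_X (s := (1 : Fin 2)), if_neg h3]
    simp
  by_cases h0 : d 0 = 0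
  · have h2 : ¬ (Finsupp.single 0 1 + Finsupp.single 1 1 ≤ d) := fun h => by
      simpa [h0] using h 0
    have h3 : d ≠ Finsupp.single 0 1 := fun h => by simp [h] at h0
    rw [if_neg h2, coeff_axis_one F d h0, MvPowerSeries.coeff_X (s := (0 : Fin 2)), if_neg h3]
    simp
  · have h2 : Finsupp.single 0 1 + Finsupp.single 1 1 ≤ d := by
      intro i; fin_cases i <;> simp <;> omega
    have h3 : d ≠ Finsupp.single 0 1 := fun h => by simp [h] at h1
    have h4 : d ≠ Finsupp.single 1 1 := fun h => by simp [h] at h0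
    rw [if_pos h2, tsub_add_cancel_of_le h2, MvPowerSeries.coeff_X, MvPowerSeries.coeff_X,
      if_neg h3, if_neg h4]
    simp

end Kappa

section Twisted

variable {A : Type*} [CommRing A]

/-- The ring `A[η] / (η² - y η)`, with basis `1`, `η` over `A`: the element `⟨a, b⟩` is
`a + b η`. -/
def Twisted (y : A) := QuadraticAlgebra A 0 y

variable (y : A)

instance : CommRing (Twisted y) := inferInstanceAs (CommRing (QuadraticAlgebra A 0 y))

instance {R : Type*} [CommRing R] [Algebra R A] : Algebra R (Twisted y) :=
  inferInstanceAs (Algebra R (QuadraticAlgebra A 0 y))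

variable {y}

/-- The element `a + b η`. -/
def Twisted.mk (a b : A) : Twisted y := ⟨a, b⟩

/-- The coordinate `a` of `a + b η`. -/
def Twisted.re (z : Twisted y) : A := QuadraticAlgebra.re z

/-- The coordinate `b` of `a + b η`. -/
def Twisted.im (z : Twisted y) : A := QuadraticAlgebra.im z

theorem Twisted.ext {z w : Twisted y} (h1 : z.re = w.re) (h2 : z.im = w.im) : z = w :=
  QuadraticAlgebra.ext h1 h2

theorem Twisted.re_mk (a b : A) : (Twisted.mk a b : Twisted y).re = a := rfl
theorem Twisted.im_mk (a b : A) : (Twisted.mk a b : Twisted y).im = b := rfl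
theorem Twisted.re_zero : (0 : Twisted y).re = 0 := rfl
theorem Twisted.im_zero : (0 : Twisted y).im = 0 := rfl
theorem Twisted.re_one : (1 : Twisted y).re = 1 := rfl
theorem Twisted.im_one : (1 : Twisted y).im = 0 := rfl
theorem Twisted.re_add (z w : Twisted y) : (z + w).re = z.re + w.re := rfl
theorem Twisted.im_add (z w : Twisted y) : (z + w).im = z.im + w.im := rfl
theorem Twisted.re_mul (z w : Twisted y) : (z * w).re = z.re * w.re :=
  (QuadraticAlgebra.re_mul _ _).trans (by rw [zero_mul, zero_mul, add_zero]; rfl)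
theorem Twisted.im_mul (z w : Twisted y) :
    (z * w).im = z.re * w.im + z.im * w.re + y * z.im * w.im :=
  QuadraticAlgebra.im_mul _ _
theorem Twisted.re_algebraMap {R : Type*} [CommRing R] [Algebra R A] (r : R) :
    (algebraMap R (Twisted y) r).re = algebraMap R A r := rfl
theorem Twisted.im_algebraMap {R : Type*} [CommRing R] [Algebra R A] (r : R) :
    (algebraMap R (Twisted y) r).im = 0 := rfl

/-- `A[η] / (η² - y η)` is `A × A` as an additive group. -/
def Twisted.toProd : Twisted y →+ A × A where
  toFun z := (z.re, z.im)
  map_zero' := rfl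
  map_add' _ _ := rfl

variable [UniformSpace A]

instance : UniformSpace (Twisted y) := UniformSpace.comap Twisted.toProd inferInstance

theorem Twisted.isUniformInducing : IsUniformInducing (Twisted.toProd (y := y)) := ⟨rfl⟩

theorem Twisted.continuous_re : Continuous (Twisted.re (y := y)) :=
  continuous_fst.comp Twisted.isUniformInducing.isInducing.continuous

theorem Twisted.continuous_im : Continuous (Twisted.im (y := y)) :=
  continuous_snd.comp Twisted.isUniformInducing.isInducing.continuous

theorem Twisted.continuous_mk {X : Type*} [TopologicalSpace X] {f g : X → A} (hf : Continuous f)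
    (hg : Continuous g) : Continuous fun t => (Twisted.mk (f t) (g t) : Twisted y) :=
  Twisted.isUniformInducing.isInducing.continuous_iff.2 (hf.prodMk hg)

instance [T2Space A] : T2Space (Twisted y) :=
  T2Space.of_injective_continuous (f := Twisted.toProd (y := y))
    (fun _ _ h => Twisted.ext (congrArg Prod.fst h) (congrArg Prod.snd h))
    Twisted.isUniformInducing.isInducing.continuous

instance [CompleteSpace A] : CompleteSpace (Twisted y) := by
  refine Twisted.isUniformInducing.completeSpace ?_
  have h : Set.range (Twisted.toProd (y := y)) = Set.univ :=
    Set.range_eq_univ.2 fun p => ⟨Twisted.mk p.1 p.2, rfl⟩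
  rw [h]; exact completeSpace_iff_isComplete_univ.1 inferInstance

instance [IsUniformAddGroup A] : IsUniformAddGroup (Twisted y) :=
  IsUniformAddGroup.comap Twisted.toProd

instance [IsUniformAddGroup A] [IsTopologicalRing A] : IsTopologicalRing (Twisted y) where
  continuous_mul := by
    have h : (fun p : Twisted y × Twisted y => p.1 * p.2) = fun p => Twisted.mk
        (p.1.re * p.2.re) (p.1.re * p.2.im + p.1.im * p.2.re + y * p.1.im * p.2.im) := by
      funext p; exact Twisted.ext (Twisted.re_mul _ _) (Twisted.im_mul _ _)
    rw [h]
    have h1 := (Twisted.continuous_re (y := y)).comp (continuous_fst (Y := Twisted y))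
    have h2 := (Twisted.continuous_im (y := y)).comp (continuous_fst (Y := Twisted y))
    have h3 := (Twisted.continuous_re (y := y)).comp (continuous_snd (X := Twisted y))
    have h4 := (Twisted.continuous_im (y := y)).comp (continuous_snd (X := Twisted y))
    exact Twisted.continuous_mk (h1.mul h3)
      (((h1.mul h4).add (h2.mul h3)).add ((continuous_const.mul h2).mul h4))

/-- The elements of `A[η] / (η² - y η)` with both coordinates in an ideal of `A`. -/
def Twisted.ideal (K : Ideal A) : Ideal (Twisted y) where
  carrier := {z | z.re ∈ K ∧ z.im ∈ K}
  zero_mem' := ⟨K.zero_mem, K.zero_mem⟩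
  add_mem' h1 h2 := ⟨K.add_mem h1.1 h2.1, K.add_mem h1.2 h2.2⟩
  smul_mem' z w h := by
    refine ⟨?_, ?_⟩
    · rw [smul_eq_mul, Twisted.re_mul]; exact K.mul_mem_left _ h.1
    · rw [smul_eq_mul, Twisted.im_mul]
      exact K.add_mem (K.add_mem (K.mul_mem_left _ h.2) (K.mul_mem_left _ h.1))
        (K.mul_mem_left _ h.2)

/-- The elements `a + b η` with `a` in a given ideal of `A`. -/
def Twisted.reIdeal (K : Ideal A) : Ideal (Twisted y) where
  carrier := {z | z.re ∈ K}
  zero_mem' := K.zero_mem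
  add_mem' h1 h2 := K.add_mem h1 h2
  smul_mem' z w h := by
    change (z * w).re ∈ K
    rw [Twisted.re_mul]; exact K.mul_mem_left _ h

variable [IsUniformAddGroup A] [IsTopologicalRing A] [IsLinearTopology A A]

theorem Twisted.exists_ideal {U : Set (Twisted y)} (hU : U ∈ 𝓝 0) :
    ∃ K : Ideal A, IsOpen (K : Set A) ∧ ((Twisted.ideal K : Ideal (Twisted y)) : Set (Twisted y)) ⊆ U := by
  rw [Twisted.isUniformInducing.isInducing.nhds_eq_comap, mem_comap] at hU
  obtain ⟨V, hV, hVU⟩ := hU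
  obtain ⟨V1, h1, V2, h2, hV12⟩ := mem_nhds_prod_iff.1 hV
  obtain ⟨K, hK, hKV⟩ := (IsLinearTopology.hasBasis_open_ideal (R := A)).mem_iff.1
    (inter_mem h1 h2)
  exact ⟨K, hK, fun z hz => hVU (hV12 ⟨(hKV hz.1).1, (hKV hz.2).2⟩)⟩

theorem Twisted.isOpen_ideal {K : Ideal A} (hK : IsOpen (K : Set A)) :
    IsOpen ((Twisted.ideal K : Ideal (Twisted y)) : Set (Twisted y)) :=
  (hK.preimage Twisted.continuous_re).inter (hK.preimage Twisted.continuous_im)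

instance : IsLinearTopology (Twisted y) (Twisted y) := by
  refine isLinearTopology_iff_hasBasis_open_ideal.2 ⟨fun U => ⟨fun hU => ?_, ?_⟩⟩
  · obtain ⟨K, hK, hKU⟩ := Twisted.exists_ideal hU
    exact ⟨_, Twisted.isOpen_ideal hK, hKU⟩
  · rintro ⟨K, hK, hKU⟩
    exact mem_of_superset (hK.mem_nhds K.zero_mem) hKU

theorem IsTopNil.twisted {N : Ideal A} (hN : IsTopNil N) (hy : y ∈ N) :
    IsTopNil (Twisted.reIdeal N : Ideal (Twisted y)) where
  isClosed := hN.isClosed.preimage Twisted.continuous_re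
  pow_le U hU := by
    obtain ⟨K, hK, hKU⟩ := Twisted.exists_ideal hU
    obtain ⟨n, hn⟩ := hN.pow_le K (hK.mem_nhds K.zero_mem)
    refine ⟨2 * n, fun z hz => hKU ?_⟩
    have h1 : (Twisted.reIdeal N : Ideal (Twisted y)) ^ 2 ≤ Twisted.ideal N := by
      rw [pow_two]
      refine Ideal.mul_le.2 fun z hz w hw => ⟨?_, ?_⟩
      · rw [Twisted.re_mul]; exact N.mul_mem_left _ hw
      · rw [Twisted.im_mul, mul_assoc]
        exact N.add_mem (N.add_mem (N.mul_mem_right _ hz) (N.mul_mem_left _ hw))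
          (N.mul_mem_right _ hy)
    have h2 : ∀ m : ℕ, (Twisted.ideal N : Ideal (Twisted y)) ^ m ≤ Twisted.ideal (N ^ m) := by
      intro m
      induction m with
      | zero =>
        intro z _
        exact ⟨by simp, by simp⟩
      | succ m ih =>
        rw [pow_succ]
        refine Ideal.mul_le.2 fun z hz w hw => ?_
        have hz' := ih hz
        rw [pow_succ]
        refine ⟨?_, ?_⟩
        · rw [Twisted.re_mul]; exact Ideal.mul_mem_mul hz'.1 hw.1
        · rw [Twisted.im_mul]
          refine Ideal.add_mem _ (Ideal.add_mem _ (Ideal.mul_mem_mul hz'.1 hw.2)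
            (Ideal.mul_mem_mul hz'.2 hw.1)) (Ideal.mul_mem_mul (Ideal.mul_mem_left _ _ hz'.2) hw.2)
    have h3 := Ideal.pow_right_mono h1 n (by rw [← pow_mul]; exact hz)
    have h4 := h2 n h3
    exact ⟨hn h4.1, hn h4.2⟩

end Twisted

section PointMap

variable {R : Type*} [CommRing R] {F : FormalGroup R} [F.IsComm]
variable {B : Type*} [CommRing B] [Algebra R B] [UniformSpace B] [IsUniformAddGroup B]
  [IsTopologicalRing B] [IsLinearTopology B B] [CompleteSpace B] [T2Space B] {N : Ideal B}
  {hN : IsTopNil N}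
variable {C : Type*} [CommRing C] [Algebra R C] [UniformSpace C] [IsUniformAddGroup C]
  [IsTopologicalRing C] [IsLinearTopology C C] [CompleteSpace C] [T2Space C] {K : Ideal C}
  {hK : IsTopNil K}

/-- A continuous homomorphism `B → C` maps points of `F` in `B` to points of `F` in `C`. -/
def Point.map (g : B →ₐ[R] C) (hg : Continuous g) (h : ∀ z ∈ N, g z ∈ K) :
    Point F hN →+ Point F hK where
  toFun a := ⟨g a.1, h _ a.2⟩
  map_zero' := Subtype.ext (map_zero g)
  map_add' a b := Subtype.ext (by
    refine (map_evalPS hg (Point.hasEval_two a b) F.toPowerSeries).trans ?_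
    refine congrArg (fun c => evalPS c F.toPowerSeries) ?_
    funext s; fin_cases s <;> rfl)

theorem Point.map_val (g : B →ₐ[R] C) (hg : Continuous g) (h : ∀ z ∈ N, g z ∈ K)
    (a : Point F hN) : (Point.map (hK := hK) g hg h a).1 = g a.1 := rfl

end PointMap

section Eta

variable {R : Type*} [CommRing R] (F : FormalGroup R) [F.IsComm]
variable {A : Type*} [CommRing A] [Algebra R A] [UniformSpace A] [IsUniformAddGroup A]
  [IsTopologicalRing A] [IsLinearTopology A A] [CompleteSpace A] [T2Space A] {N : Ideal A}
  {hN : IsTopNil N} {y : A}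

variable (R y) in
/-- The inclusion of `A` in `A[η] / (η² - y η)`. -/
def Twisted.incl : A →ₐ[R] Twisted y where
  toFun a := Twisted.mk a 0
  map_one' := rfl
  map_zero' := rfl
  map_add' a b := Twisted.ext rfl (add_zero 0).symm
  map_mul' a b := by
    refine Twisted.ext ?_ ?_
    · rw [Twisted.re_mul]; rfl
    · rw [Twisted.im_mul]; simp [Twisted.im_mk]
  commutes' _ := rfl

variable (R y) in
/-- The homomorphism `A[η] / (η² - y η) → A` over `A` with `η ↦ 0`. -/
def Twisted.reHom : Twisted y →ₐ[R] A where
  toFun := Twisted.re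
  map_one' := rfl
  map_zero' := rfl
  map_add' _ _ := rfl
  map_mul' := Twisted.re_mul
  commutes' _ := rfl

variable (R y) in
/-- The homomorphism `A[η] / (η² - y η) → A` over `A` with `η ↦ y`. -/
def Twisted.evHom : Twisted y →ₐ[R] A where
  toFun z := z.re + y * z.im
  map_one' := by rw [Twisted.re_one, Twisted.im_one, mul_zero, add_zero]
  map_zero' := by rw [Twisted.re_zero, Twisted.im_zero, mul_zero, add_zero]
  map_add' z w := by rw [Twisted.re_add, Twisted.im_add]; ring
  map_mul' z w := by rw [Twisted.re_mul, Twisted.im_mul]; ring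
  commutes' r := by rw [Twisted.re_algebraMap, Twisted.im_algebraMap, mul_zero, add_zero]

theorem Twisted.continuous_incl : Continuous (Twisted.incl R y) :=
  Twisted.continuous_mk (g := fun _ : A => (0 : A)) continuous_id continuous_const

theorem Twisted.continuous_reHom : Continuous (Twisted.reHom R y) := Twisted.continuous_re

theorem Twisted.continuous_evHom : Continuous (Twisted.evHom R y) :=
  Twisted.continuous_re.add (continuous_const.mul Twisted.continuous_im)

variable (y) in
/-- The element `η`. -/
def Twisted.eta : Twisted y := Twisted.mk 0 1

theorem Twisted.re_eta : (Twisted.eta y).re = 0 := rfl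
theorem Twisted.im_eta : (Twisted.eta y).im = 1 := rfl
theorem Twisted.re_incl (a : A) : (Twisted.incl R y a).re = a := rfl
theorem Twisted.im_incl (a : A) : (Twisted.incl R y a).im = 0 := rfl
theorem Twisted.evHom_apply (z : Twisted y) : Twisted.evHom R y z = z.re + y * z.im := rfl
theorem Twisted.evHom_incl (a : A) : Twisted.evHom R y (Twisted.incl R y a) = a := by
  rw [Twisted.evHom_apply, Twisted.re_incl, Twisted.im_incl, mul_zero, add_zero]
theorem Twisted.evHom_eta : Twisted.evHom R y (Twisted.eta y) = y := by
  rw [Twisted.evHom_apply, Twisted.re_eta, Twisted.im_eta, zero_add, mul_one]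

theorem Twisted.eta_mul (z : Twisted y) :
    Twisted.eta y * z = Twisted.eta y * Twisted.incl R y (Twisted.evHom R y z) := by
  refine Twisted.ext ?_ ?_
  · rw [Twisted.re_mul, Twisted.re_mul]; simp [Twisted.re_eta]
  · rw [Twisted.im_mul, Twisted.im_mul]
    simp only [Twisted.re_eta, Twisted.im_eta, Twisted.re_incl, Twisted.im_incl,
      Twisted.evHom_apply]; ring

variable {F} in
theorem evalPS_toPowerSeries {a : Fin 2 → A} (ha : MvPowerSeries.HasEval a) :
    evalPS a F.toPowerSeries = a 0 + a 1 - a 0 * a 1 * evalPS a (gSeries F) := by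
  conv_lhs => rw [toPowerSeries_eq F]
  rw [← evalHom_apply ha, map_sub, map_add, map_mul, map_mul, evalHom_apply ha, evalHom_apply ha,
    evalHom_apply ha, evalPS_X, evalPS_X]

variable {F} in
/-- The inverse of `η` for `F`, where `y'` is the inverse of `y`: it is `h η` with
`h = κ y' - 1` and `κ = g(y, y')`. -/
def Twisted.negEta (y' : A) : Twisted y :=
  Twisted.incl R y (evalPS ![y, y'] (gSeries F) * y' - 1) * Twisted.eta y

theorem Twisted.eta_add_negEta (a b : Point F hN) (h : a + b = 0) :
    evalPS ![Twisted.eta a.1, Twisted.negEta (F := F) b.1] F.toPowerSeries = (0 : Twisted a.1) := by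
  have hab := congrArg Subtype.val h
  rw [Point.add_val, Point.zero_val, evalPS_toPowerSeries (Point.hasEval_two a b)] at hab
  simp only [Matrix.cons_val_zero, Matrix.cons_val_one, Matrix.cons_val_fin_one] at hab
  have he : MvPowerSeries.HasEval ![Twisted.eta a.1, Twisted.negEta (F := F) b.1] := by
    refine (hN.twisted a.2).hasEval ?_
    intro s; fin_cases s
    · exact N.zero_mem
    · exact Ideal.mul_mem_left _ _ N.zero_mem
  have hev : Twisted.evHom R a.1 (evalPS ![Twisted.eta a.1, Twisted.negEta (F := F) b.1]
      (gSeries F)) = evalPS ![a.1, b.1] (gSeries F) := by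
    rw [map_evalPS Twisted.continuous_evHom he]
    congr 1
    funext s; fin_cases s
    · exact Twisted.evHom_eta
    · simp only [Twisted.negEta, Fin.mk_one, Matrix.cons_val_one, Matrix.cons_val_fin_one, map_mul,
        Twisted.evHom_incl, Twisted.evHom_eta]
      linear_combination -hab
  rw [evalPS_toPowerSeries he]
  simp only [Matrix.cons_val_zero, Matrix.cons_val_one, Matrix.cons_val_fin_one]
  set z := evalPS ![Twisted.eta a.1, Twisted.negEta (F := F) b.1] (gSeries F) with hz
  have h1 := Twisted.eta_mul (R := R) z
  rw [hev] at h1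
  set k := evalPS ![a.1, b.1] (gSeries F)
  have h2 : Twisted.eta a.1 * Twisted.eta a.1 = Twisted.incl R a.1 a.1 * Twisted.eta a.1 := by
    refine Twisted.ext ?_ ?_
    · rw [Twisted.re_mul, Twisted.re_mul]; simp [Twisted.re_eta]
    · rw [Twisted.im_mul, Twisted.im_mul]
      simp [Twisted.re_eta, Twisted.im_eta, Twisted.re_incl, Twisted.im_incl]
  have h3 := congrArg (Twisted.incl R a.1) hab
  simp only [Twisted.negEta, map_sub, map_add, map_mul, map_one, map_zero] at h3 ⊢
  linear_combination (-(Twisted.incl R a.1 k * Twisted.incl R a.1 b.1 - 1) * Twisted.eta a.1) * h1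
    - (Twisted.incl R a.1 k * Twisted.incl R a.1 b.1 - 1) * Twisted.incl R a.1 k * h2
    + Twisted.eta a.1 * Twisted.incl R a.1 k * h3

end Eta

section Demazure

variable {R : Type*} [CommRing R] (F : FormalGroup R) [F.IsComm] {M : Type*} [AddCommGroup M]

/-- The functoriality of `R⟦M⟧_F` in `M`. -/
def mapHom {M' : Type*} [AddCommGroup M'] (f : M →+ M') : FGRing F M →ₐ[R] FGRing F M' :=
  lift ((xHom F).comp f)

theorem mapHom_x {M' : Type*} [AddCommGroup M'] (f : M →+ M') (μ : M) :
    mapHom F f (x F μ) = x F (f μ) := lift_x ((xHom F).comp f) μ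

/-- The homomorphism `λ ↦ λ - c(λ) α`. -/
def reflHom (α : M) (c : M →+ ℤ) : M →+ M where
  toFun μ := μ - c μ • α
  map_zero' := by simp
  map_add' μ ν := by rw [map_add, add_smul]; abel

/-- The point `η` of `F` in `R⟦M⟧_F[η] / (η² - x_α η)`, with its inverse. -/
def etaUnit (α : M) : AddUnits (Point F ((isTopNil_aug F M).twisted (x_mem F α))) where
  val := ⟨Twisted.eta (x F α), map_zero (aug F M)⟩
  neg := ⟨Twisted.negEta (F := F) (x F (-α)), Ideal.mul_mem_left _ _ (map_zero (aug F M))⟩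
  val_neg := Subtype.ext (Twisted.eta_add_negEta F (xHom F α) (xHom F (-α))
    (by rw [← map_add, add_neg_cancel, map_zero]))
  neg_val := (add_comm _ _).trans (Subtype.ext (Twisted.eta_add_negEta F (xHom F α) (xHom F (-α))
    (by rw [← map_add, add_neg_cancel, map_zero])))

/-- The homomorphism from `M` to points of `F`, mapping `λ` to the sum of `x_λ` and
`-c(λ)` times `η`. -/
def demazurePoint (α : M) (c : M →+ ℤ) :
    M →+ Point F ((isTopNil_aug F M).twisted (x_mem F α)) :=
  (Point.map (Twisted.incl R (x F α)) Twisted.continuous_incl fun _ h => h).comp (xHom F) +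
    (AddUnits.coeHom _).comp ((zmultiplesHom _ (etaUnit F α)).comp (-c))

/-- The continuous homomorphism `u ↦ u - Δ(u) η` to `R⟦M⟧_F[η] / (η² - x_α η)`, with
`x_λ ↦ x_λ + -c(λ) η` (sum and multiple for the formal group law). -/
def demazureHom (α : M) (c : M →+ ℤ) : FGRing F M →ₐ[R] Twisted (x F α) :=
  lift (demazurePoint F α c)

theorem continuous_demazureHom (α : M) (c : M →+ ℤ) : Continuous (demazureHom F α c) :=
  continuous_lift _

/-- The operator `Δ_α`, for a root `α` with coroot `c`: minus the coefficient of `η` in the image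
of `u` under the homomorphism above. Over a domain it is `(u - s_α(u)) / x_α` when `x_α ≠ 0`, by
`x_mul_demazure`; in general it is the base change of this operator over the Lazard ring, by
`map_demazure` and continuity. -/
def demazure (α : M) (c : M →+ ℤ) : Module.End R (FGRing F M) where
  toFun u := -(demazureHom F α c u).im
  map_add' u v := by rw [map_add, Twisted.im_add, neg_add]
  map_smul' r u := by
    rw [Algebra.smul_def, map_mul, AlgHom.commutes, Twisted.im_mul, Twisted.re_algebraMap,
      Twisted.im_algebraMap, RingHom.id_apply, Algebra.smul_def]
    ring

theorem re_demazureHom (α : M) (c : M →+ ℤ) (u : FGRing F M) : (demazureHom F α c u).re = u := by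
  have h : (Twisted.reHom R (x F α)).comp (demazureHom F α c) = AlgHom.id R _ := by
    refine hom_ext ((Twisted.continuous_reHom (R := R)).comp (continuous_demazureHom F α c)) continuous_id ?_
    intro μ
    let P : Point F ((isTopNil_aug F M).twisted (x_mem F α)) →+ Point F (isTopNil_aug F M) :=
      Point.map (Twisted.reHom R (x F α)) Twisted.continuous_reHom fun _ h => h
    have h0 : AddUnits.map P (etaUnit F α) = 0 := AddUnits.ext (Subtype.ext rfl)
    have h1 : P (demazurePoint F α c μ) = xHom F μ := by
      have h2 : P ((((-c μ) • etaUnit F α : AddUnits _)) :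
          Point F ((isTopNil_aug F M).twisted (x_mem F α))) =
          ((AddUnits.map P ((-c μ) • etaUnit F α) : AddUnits _) : Point F (isTopNil_aug F M)) := rfl
      have h3 : demazurePoint F α c μ = Point.map (Twisted.incl R (x F α)) Twisted.continuous_incl
        (fun _ h => h) (xHom F μ) + (((-c μ) • etaUnit F α : AddUnits _) :
          Point F ((isTopNil_aug F M).twisted (x_mem F α))) := rfl
      rw [h3, map_add, h2, map_zsmul, h0, smul_zero, AddUnits.val_zero, add_zero]
      exact Subtype.ext rfl
    exact (congrArg (Twisted.reHom R (x F α)) (lift_x (demazurePoint F α c) μ)).trans (congrArg Subtype.val h1)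
  exact DFunLike.congr_fun h u

theorem demazureHom_apply (α : M) (c : M →+ ℤ) (u : FGRing F M) :
    demazureHom F α c u = Twisted.mk u (-demazure F α c u) :=
  Twisted.ext (re_demazureHom F α c u) (neg_neg _).symm

/-- The defining property `Δ(u) x_α = u - s_α(u)`. -/
theorem x_mul_demazure (α : M) (c : M →+ ℤ) (u : FGRing F M) :
    x F α * demazure F α c u = u - mapHom F (reflHom α c) u := by
  have h : (Twisted.evHom R (x F α)).comp (demazureHom F α c) = mapHom F (reflHom α c) := by
    refine hom_ext ((Twisted.continuous_evHom (R := R)).comp (continuous_demazureHom F α c))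
      (continuous_lift _) ?_
    intro μ
    let P : Point F ((isTopNil_aug F M).twisted (x_mem F α)) →+ Point F (isTopNil_aug F M) :=
      Point.map (Twisted.evHom R (x F α)) Twisted.continuous_evHom fun z h =>
        Ideal.add_mem _ h (Ideal.mul_mem_right _ _ (x_mem F α))
    have h0 : AddUnits.map P (etaUnit F α) =
        AddUnits.map (xHom F) (toAddUnits α) := AddUnits.ext (Subtype.ext Twisted.evHom_eta)
    have h1 : P (demazurePoint F α c μ) = xHom F (reflHom α c μ) := by
      have h2 : P ((((-c μ) • etaUnit F α : AddUnits _)) :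
          Point F ((isTopNil_aug F M).twisted (x_mem F α))) =
          ((AddUnits.map P ((-c μ) • etaUnit F α) : AddUnits _) : Point F (isTopNil_aug F M)) := rfl
      have h3 : demazurePoint F α c μ = Point.map (Twisted.incl R (x F α)) Twisted.continuous_incl
        (fun _ h => h) (xHom F μ) + (((-c μ) • etaUnit F α : AddUnits _) :
          Point F ((isTopNil_aug F M).twisted (x_mem F α))) := rfl
      have h4 : ((AddUnits.map (xHom F) (toAddUnits ((-c μ) • α)) : AddUnits _) :
          Point F (isTopNil_aug F M)) = xHom F ((-c μ) • α) := rfl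
      have h5 : P (Point.map (Twisted.incl R (x F α)) Twisted.continuous_incl
        (fun _ h => h) (xHom F μ)) = xHom F μ := Subtype.ext (Twisted.evHom_incl _)
      rw [h3, map_add, h2, map_zsmul, h0, ← map_zsmul, ← map_zsmul, h4, h5, ← map_add]
      congr 1
      change _ = μ - c μ • α
      rw [neg_smul, sub_eq_add_neg]
    exact ((congrArg (Twisted.evHom R (x F α)) (lift_x (demazurePoint F α c) μ)).trans
      (congrArg Subtype.val h1)).trans (mapHom_x F _ μ).symm
  have h1 := DFunLike.congr_fun h u
  rw [AlgHom.comp_apply, demazureHom_apply, Twisted.evHom_apply, Twisted.re_mk, Twisted.im_mk] at h1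
  rw [← h1]; ring

/-- The Leibniz rule for `Δ_α`. -/
theorem demazure_mul (α : M) (c : M →+ ℤ) (u v : FGRing F M) :
    demazure F α c (u * v) = demazure F α c u * v + u * demazure F α c v -
      demazure F α c u * demazure F α c v * x F α := by
  have h := congrArg Twisted.im (map_mul (demazureHom F α c) u v)
  simp only [demazureHom_apply, Twisted.im_mul, Twisted.im_mk, Twisted.re_mk] at h
  linear_combination -h

theorem continuous_demazure (α : M) (c : M →+ ℤ) : Continuous (demazure F α c) :=
  (Twisted.continuous_im.comp (continuous_demazureHom F α c)).neg

/-- The element `g(x_α, x_{-α})`. -/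
def kappa (α : M) : FGRing F M := evalPS ![x F α, x F (-α)] (gSeries F)

theorem kappa_spec (α : M) : x F α * x F (-α) * kappa F α = x F α + x F (-α) := by
  have h := evalPS_toPowerSeries (F := F) (Point.hasEval_two (xHom F α) (xHom F (-α)))
  have h1 : evalPS ![x F α, x F (-α)] F.toPowerSeries = 0 := by
    rw [← x_add, add_neg_cancel, x_zero]
  have h2 : evalPS ![x F α, x F (-α)] F.toPowerSeries =
      x F α + x F (-α) - x F α * x F (-α) * kappa F α := h
  rw [h1] at h2
  linear_combination h2

/-- The operator `C_α = g(x_α, x_{-α}) - Δ_α`. -/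
def cOp (α : M) (c : M →+ ℤ) : Module.End R (FGRing F M) :=
  LinearMap.mulLeft R (kappa F α) - demazure F α c

end Demazure

section BaseChange

variable {R : Type*} [CommRing R] (F : FormalGroup R) [F.IsComm] {R' : Type*} [CommRing R']
  (φ : R →+* R')

instance : (F.map φ).IsComm where
  comm := by
    have h := congrArg (MvPowerSeries.map φ) (FormalGroup.IsComm.comm (F := F))
    rw [MvPowerSeries.map_subst MvPowerSeries.HasSubst.X_X] at h
    refine h.trans ?_
    refine congrArg (fun a => MvPowerSeries.subst a _) ?_
    funext s; fin_cases s <;> simp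

theorem evalPS_map {B : Type*} [CommRing B] [Algebra R' B] [UniformSpace B]
    [IsUniformAddGroup B] [IsTopologicalRing B] [IsLinearTopology B B] [CompleteSpace B]
    [T2Space B] {σ : Type*} {a : σ → B} (ha : MvPowerSeries.HasEval a)
    (f : MvPowerSeries σ R) :
    letI : Algebra R B := Algebra.compHom B φ
    evalPS a f = evalPS (R := R') a (MvPowerSeries.map φ f) := by
  let _ : Algebra R B := Algebra.compHom B φ
  refine (hasSum_evalPS ha f).unique ?_
  have h := hasSum_evalPS ha (MvPowerSeries.map φ f)
  simp only [MvPowerSeries.coeff_map] at h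
  exact h

variable {M : Type*} [AddCommGroup M]

/-- The operators `Δ_α` are compatible with change of the base ring. -/
theorem map_demazure (α : M) (c : M →+ ℤ) (G : FGRing F M →+* FGRing (F.map φ) M)
    (hG : Continuous G) (hR : ∀ r, G (algebraMap R _ r) = algebraMap R' _ (φ r))
    (hx : ∀ μ, G (x F μ) = x (F.map φ) μ) (u : FGRing F M) :
    G (demazure F α c u) = demazure (F.map φ) α c (G u) := by
  let _ : Algebra R (Twisted (x (F.map φ) α)) := Algebra.compHom _ φ
  have hmul : ∀ z w : Twisted (x F α), Twisted.mk (y := x (F.map φ) α) (G (z * w).re)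
      (G (z * w).im) = Twisted.mk (G z.re) (G z.im) * Twisted.mk (G w.re) (G w.im) := by
    intro z w
    refine Twisted.ext ?_ ?_
    · simp [Twisted.re_mk, Twisted.re_mul]
    · simp [Twisted.re_mk, Twisted.im_mk, Twisted.im_mul, hx]
  let T : Twisted (x F α) →ₐ[R] Twisted (x (F.map φ) α) :=
    { toFun := fun z => Twisted.mk (G z.re) (G z.im)
      map_one' := Twisted.ext (map_one G) (map_zero G)
      map_zero' := Twisted.ext (map_zero G) (map_zero G)
      map_add' := fun z w => Twisted.ext (map_add G _ _) (map_add G _ _)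
      map_mul' := hmul
      commutes' := fun r => Twisted.ext (hR r) (map_zero G) }
  have hT : Continuous T :=
    Twisted.continuous_mk (hG.comp Twisted.continuous_re) (hG.comp Twisted.continuous_im)
  let D : FGRing F M →ₐ[R] Twisted (x (F.map φ) α) :=
    { (demazureHom (F.map φ) α c : FGRing (F.map φ) M →+* _).comp G with
      commutes' := fun r => by
        change demazureHom (F.map φ) α c (G (algebraMap R _ r)) = algebraMap R' _ (φ r)
        rw [hR, AlgHom.commutes] }
  have hD : Continuous D := (continuous_demazureHom (F.map φ) α c).comp hG
  have hN := (isTopNil_aug (F.map φ) M).twisted (x_mem (F.map φ) α)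
  let J : Point F hN →+ Point (F.map φ) hN :=
    { toFun := fun a => ⟨a.1, a.2⟩
      map_zero' := rfl
      map_add' := fun a b => Subtype.ext (evalPS_map φ (Point.hasEval_two a b) F.toPowerSeries) }
  have haug : ∀ z ∈ RingHom.ker (aug F M), G z ∈ RingHom.ker (aug (F.map φ) M) := by
    let _ : UniformSpace R' := ⊥
    let _ : Algebra R R' := φ.toAlgebra
    let a1 : FGRing F M →ₐ[R] R' := { (φ : R →+* R').comp (aug F M : FGRing F M →+* R) with
      commutes' := fun r => by
        change φ (aug F M (algebraMap R _ r)) = φ r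
        rw [AlgHom.commutes]; rfl }
    let a2 : FGRing F M →ₐ[R] R' := { (aug (F.map φ) M : FGRing (F.map φ) M →+* R').comp G with
      commutes' := fun r => by
        change aug (F.map φ) M (G (algebraMap R _ r)) = φ r
        rw [hR, AlgHom.commutes]; rfl }
    have h12 : a1 = a2 := by
      refine hom_ext ?_ ?_ fun μ => ?_
      · let _ : TopologicalSpace R := ⊥
        have : DiscreteTopology R := ⟨rfl⟩
        exact (continuous_of_discreteTopology (f := φ)).comp (continuous_aug F M)
      · exact (continuous_aug (F.map φ) M).comp hG
      · change φ (aug F M (x F μ)) = aug (F.map φ) M (G (x F μ))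
        rw [hx, aug_x, aug_x, map_zero]
    intro z hz
    have h13 : φ (aug F M z) = aug (F.map φ) M (G z) := DFunLike.congr_fun h12 z
    rw [RingHom.mem_ker] at hz ⊢
    rw [← h13, hz, map_zero]
  let P : Point F ((isTopNil_aug F M).twisted (x_mem F α)) →+ Point (F.map φ) hN :=
    J.comp (Point.map T hT fun z h => haug _ h)
  have h0 : AddUnits.map P (etaUnit F α) = etaUnit (F.map φ) α :=
    AddUnits.ext (Subtype.ext (Twisted.ext (map_zero G) (map_one G)))
  have h1 : ∀ μ, P (demazurePoint F α c μ) = demazurePoint (F.map φ) α c μ := by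
    intro μ
    have h3 : demazurePoint F α c μ = Point.map (Twisted.incl R (x F α)) Twisted.continuous_incl
      (fun _ h => h) (xHom F μ) + (((-c μ) • etaUnit F α : AddUnits _) :
        Point F ((isTopNil_aug F M).twisted (x_mem F α))) := rfl
    have h2 : P ((((-c μ) • etaUnit F α : AddUnits _)) :
        Point F ((isTopNil_aug F M).twisted (x_mem F α))) =
        ((AddUnits.map P ((-c μ) • etaUnit F α) : AddUnits _) : Point (F.map φ) hN) := rfl
    rw [h3, map_add, h2, map_zsmul, h0]
    exact congrArg (· + _) (Subtype.ext (Twisted.ext (hx μ) (map_zero G)))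
  have h : T.comp (demazureHom F α c) = D :=
    hom_ext (hT.comp (continuous_demazureHom F α c)) hD fun μ =>
      (congrArg T (lift_x (demazurePoint F α c) μ)).trans ((congrArg Subtype.val (h1 μ)).trans
        (((congrArg (demazureHom (F.map φ) α c) (hx μ)).trans
          (lift_x (demazurePoint (F.map φ) α c) μ)).symm))
  have h4 := congrArg Twisted.im (DFunLike.congr_fun h u)
  have h5 : (D u).im = -demazure (F.map φ) α c (G u) := (neg_neg _).symm
  have h6 : ((T.comp (demazureHom F α c)) u).im = G (-demazure F α c u) :=
    congrArg G (neg_neg _).symm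
  rw [h5, h6, map_neg, neg_inj] at h4
  exact h4

end BaseChange

section RootDatum

variable {ι M N : Type*} [AddCommGroup M] [AddCommGroup N] (P : RootDatum ι M N)

section Word

variable {P} (b : P.Base)

/-- The product of the simple reflections of a word. -/
def wordProd (l : List b.support) : P.weylGroup :=
  (l.map fun i => RootPairing.weylGroup.ofIdx P i).prod

/-- `l` is a reduced decomposition of `w`: a shortest word in the simple reflections with
product `w`. -/
def IsReducedWord (l : List b.support) (w : P.weylGroup) : Prop :=
  wordProd b l = w ∧ ∀ l' : List b.support, wordProd b l' = w → l.length ≤ l'.length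

/-- `l` is a reduced decomposition of an element of the greatest length. -/
def IsLongestWord (l : List b.support) : Prop :=
  IsReducedWord b l (wordProd b l) ∧
    ∀ l' : List b.support, IsReducedWord b l' (wordProd b l') → l'.length ≤ l.length

end Word

section Operators

variable {R : Type*} [CommRing R] (F : FormalGroup R) [F.IsComm]

/-- The operator `Δ_α` on `R⟦M⟧_F`, for the root `α` with index `i`. -/
def rootDelta (i : ι) : Module.End R (FGRing F M) :=
  demazure F (P.root i) (P.coroot' i).toAddMonoidHom

/-- The operator `C_α` on `R⟦M⟧_F`, for the root `α` with index `i`. -/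
def rootC (i : ι) : Module.End R (FGRing F M) :=
  cOp F (P.root i) (P.coroot' i).toAddMonoidHom

/-- The composition of the operators `Δ_α` along a word in the simple roots. -/
def deltaWord {P : RootDatum ι M N} (b : P.Base) (l : List b.support) :
    Module.End R (FGRing F M) :=
  (l.map fun i => rootDelta P F i).prod

/-- The composition of the operators `C_α` along a word in the simple roots. -/
def cWord {P : RootDatum ι M N} (b : P.Base) (l : List b.support) :
    Module.End R (FGRing F M) :=
  (l.map fun i => rootC P F i).prod

/-- The subalgebra of `R`-linear endomorphisms of `R⟦M⟧_F` generated by the `Δ_α`, for all roots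
`α`, and by the multiplications by elements of `R⟦M⟧_F`. -/
def operatorAlgebra : Subalgebra R (Module.End R (FGRing F M)) :=
  Algebra.adjoin R (Set.range (rootDelta P F) ∪ Set.range (LinearMap.mulLeft R))

/-- The operator algebra as an `R⟦M⟧_F`-module, where `(u • T) v = u * T v`. -/
def operatorModule : Submodule (FGRing F M) (Module.End R (FGRing F M)) where
  carrier := operatorAlgebra P F
  zero_mem' := zero_mem _
  add_mem' := add_mem
  smul_mem' u T hT := by
    have h : u • T = LinearMap.mulLeft R u * T := LinearMap.ext fun _ => rfl
    rw [h]
    exact mul_mem (Algebra.subset_adjoin (Or.inr ⟨u, rfl⟩)) hT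

end Operators

/-- The torsion index of a root datum: the index in `ℤ` of the image of the augmentation of the
operator attached to the longest element of the Weyl group, for the additive formal group law. -/
def torsionIndex {P : RootDatum ι M N} (b : P.Base) : ℕ :=
  (AddSubgroup.closure {k : ℤ | ∃ l : List b.support, IsLongestWord b l ∧
    ∃ u : FGRing (FormalGroup.𝔾ₐ : FormalGroup ℤ) M,
      k = aug FormalGroup.𝔾ₐ M (deltaWord FormalGroup.𝔾ₐ b l u)}).index

end RootDatum

end FormalGroupRing

end

/-! The core is a relation between words in the simple roots: two reduced words with the same
product give compositions of the `Δ_i` that differ by a combination of compositions along shorter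
words, and a word that is not reduced is itself such a combination. Filtering by length, the span
`V` of the chosen `Δ_{I_w}` is then stable under left composition with every simple `Δ_i`, hence
with `s_i = 1 - x_i Δ_i`, hence with every `Δ_{wα} = w Δ_α w⁻¹`. It is a module and contains `1`, so
it is the whole operator algebra. The `C`-words are triangular over the `Δ`-words, with signs on the
diagonal, so they span as well.

The relation is proved in a good ring and then pushed forward. Two things go wrong for `R⟦M⟧_F`
itself: `R` may have zero divisors, and a root may be divisible in `M`, so that `x_α` need not be
prime. The first is cured by Lazard's theorem in the form `exists_formalGroup_map_eq`: every
commutative law is the image, along a surjection, of a law over a polynomial ring over `ℤ`. The lift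
is built degree by degree through its logarithm over the fraction field; the obstruction is a
symmetric `2`-cocycle, controlled by the comparison lemma `IsSymmCocycle.exists_eq_smul`. The second
is cured by passing to the sum of `M` and the root lattice, where the roots `(α, α)` are primitive.
There the ring is a domain and the `x_β`, for positive `β`, are primes that do not divide each
other.

Over the field of fractions, a word becomes a combination `∑ T_v v` of elements of the Weyl group.
Its coefficients have at most simple poles along the `x_β`, and the residues at `v` and `s_β v`
cancel; this tameness is preserved by each simple operator (`IsTame.twist`). The coefficient of a
reduced word at its own product `w` is, up to sign, the inverse of the product of the `x_β` over the
inversions of `w`. A tame combination supported in lengths at most `k` has top coefficients with no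
other poles, so they can be cleared by reduced words with integral coefficients
(`exists_eq_sum_wordCoeff`). The resulting relations pass to `R⟦M⟧_F` because the image of the good
ring is dense and the operators are continuous.

Independence has two proofs. If `2` is regular, every root is `1` or `2` times a primitive vector,
so the `x_α` are regular, and distinct elements of the Weyl group are separated by a regular
difference `x_{wμ} - x_{vμ}`; Dedekind's argument and the triangularity by length then apply. If the
torsion index `t` is regular, an element `u` realizing `t` is evaluated along completions `K_v` of
the reduced words to longest words: the augmentation of the matrix `Δ_{I_w}(Δ_{K_v}(u))` is block
triangular with diagonal blocks `t` times the identity, so its determinant is regular. The values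
needed for `F` are compared with those for the additive law by leading forms. Finally, a spanning
family with as many members as a basis is a basis, which settles the `C`-words. -/

set_option linter.unusedSectionVars false

/-! ### Lazard's comparison lemma for symmetric cocycles. -/

section Comparison

/-- The coefficients `a i` of `X ^ i * Y ^ (n - i)`, for `0 < i < n`, of a symmetric polynomial
`2`-cocycle that is homogeneous of degree `n`. -/
structure IsSymmCocycle {B : Type*} [AddCommGroup B] (n : ℕ) (a : ℕ → B) : Prop where
  symm : ∀ i j, 0 < i → 0 < j → i + j = n → a i = a j
  rel : ∀ i j k, 0 < i → 0 < j → 0 < k → i + j + k = n →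
    (i + j).choose i • a (i + j) = (j + k).choose j • a i

namespace IsSymmCocycle

/-- Lucas' theorem, used `t` times: multiplication by `p ^ t` appends `t` zero digits in base `p`.
-/
theorem choose_prime_pow_mul (p : ℕ) [Fact p.Prime] (t a b : ℕ) :
    (p ^ t * a).choose (p ^ t * b) ≡ a.choose b [MOD p] := by
  induction t with
  | zero => simp [Nat.ModEq.refl]
  | succ t ih =>
    have hp := (Fact.out : p.Prime).pos
    have h := Choose.choose_modEq_choose_mod_mul_choose_div_nat (p := p)
      (n := p ^ (t + 1) * a) (k := p ^ (t + 1) * b)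
    have h1 : ∀ c, p ^ (t + 1) * c % p = 0 := fun c =>
      Nat.mod_eq_zero_of_dvd (Dvd.intro (p ^ t * c) (by ring))
    have h2 : ∀ c, p ^ (t + 1) * c / p = p ^ t * c := fun c => by
      rw [show p ^ (t + 1) * c = p * (p ^ t * c) by ring, Nat.mul_div_cancel_left _ hp]
    rw [h1, h1, h2, h2, Nat.choose_self, one_mul] at h
    exact h.trans ih

/-- This is the model cocycle. It is paired below with an arbitrary one, so that both obey the same
proportionalities. -/
theorem choose (n : ℕ) : IsSymmCocycle n fun i => (n.choose i : ℤ) where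
  symm i j _ _ h := by subst h; rw [Nat.choose_symm_add]
  rel i j k _ _ _ h := by
    subst h
    have h1 := Nat.choose_mul (n := i + j + k) (k := i + j) (s := i)
    rw [show i + j + k - i = j + k by omega, show i + j - i = j by omega] at h1
    simp only [nsmul_eq_mul]
    norm_cast
    linarith [h1 (by omega)]

variable {B : Type*} [AddCommGroup B] {n : ℕ} {a : ℕ → B}

theorem prod {B' : Type*} [AddCommGroup B'] {a' : ℕ → B'} (h : IsSymmCocycle n a)
    (h' : IsSymmCocycle n a') : IsSymmCocycle n fun i => (a i, a' i) where
  symm i j hi hj e := Prod.ext (h.symm i j hi hj e) (h'.symm i j hi hj e)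
  rel i j k hi hj hk e := Prod.ext (h.rel i j k hi hj hk e) (h'.rel i j k hi hj hk e)

/-- The cocycle relation at `i = p ^ t`, `j = p ^ t * (m - 1)` has on the left the coefficient `(p ^
t * m).choose (p ^ t)`, which is congruent to `m` modulo `p`. -/
theorem smul_eq_prime_pow (h : IsSymmCocycle n a) {p : ℕ} (hp : p.Prime) (t m : ℕ)
    (hm : ¬ p ∣ m) (hmn : p ^ t * m < n) :
    ∃ u v : ℕ, ¬ p ∣ u ∧ u • a (p ^ t * m) = v • a (p ^ t) := by
  have : Fact p.Prime := ⟨hp⟩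
  have hpt := pow_pos hp.pos t
  rcases m with - | m
  · simp at hm
  rcases Nat.eq_zero_or_pos m with rfl | h0
  · exact ⟨1, 1, by simpa using hp.one_lt.ne', by simp⟩
  · have h1 := h.rel (p ^ t) (p ^ t * m) (n - p ^ t * (m + 1)) hpt (by positivity) (by omega)
      (by rw [mul_add] at *; omega)
    rw [show p ^ t + p ^ t * m = p ^ t * (m + 1) by ring] at h1
    refine ⟨_, _, ?_, h1⟩
    have h2 := choose_prime_pow_mul p t (m + 1) 1
    rw [mul_one, Nat.choose_one_right] at h2
    rwa [h2.dvd_iff dvd_rfl]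

/-- In the relation at `i = p ^ t`, `j = p ^ t * (p - 1)` the coefficient on the right is `(n - p ^
t).choose (p ^ t * (p - 1))`. Since `p ^ (t + 1)` divides `n`, the last digit of `(n - p ^ t) / p ^
t` is `p - 1`, and Lucas' theorem gives `1` modulo `p`. -/
theorem smul_prime_pow_eq_succ (h : IsSymmCocycle n a) {p : ℕ} (hp : p.Prime) (t : ℕ)
    (hd : p ^ (t + 1) ∣ n) (hn : p ^ (t + 1) < n) :
    ∃ u v : ℕ, ¬ p ∣ u ∧ u • a (p ^ t) = v • a (p ^ (t + 1)) := by
  have : Fact p.Prime := ⟨hp⟩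
  obtain ⟨m, rfl⟩ := hd
  have hpt := pow_pos hp.pos t
  have h2 := hp.two_le
  -- With `p = r + 2` and one unit split off from `m`, no truncated subtraction is left.
  obtain ⟨r, rfl⟩ : ∃ r, p = r + 2 := ⟨p - 2, by omega⟩
  obtain ⟨m, rfl⟩ : ∃ m', m = m' + 1 := ⟨m - 1, by
    rcases m with - | m
    · simp at hn
    · simp⟩
  have hm : 0 < (r + 2) ^ (t + 1) * m := by
    rw [mul_add] at hn; omega
  have h1 := h.rel ((r + 2) ^ t) ((r + 2) ^ t * (r + 1)) ((r + 2) ^ (t + 1) * m) hpt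
    (by positivity) hm (by ring)
  rw [show (r + 2) ^ t + (r + 2) ^ t * (r + 1) = (r + 2) ^ (t + 1) by ring] at h1
  refine ⟨_, _, ?_, h1.symm⟩
  rw [show (r + 2) ^ t * (r + 1) + (r + 2) ^ (t + 1) * m =
    (r + 2) ^ t * ((r + 2) * m + (r + 1)) by ring]
  have h3 := (choose_prime_pow_mul (r + 2) t ((r + 2) * m + (r + 1)) (r + 1)).trans
    (Choose.choose_modEq_choose_mod_mul_choose_div_nat (p := r + 2))
  have e1 : ((r + 2) * m + (r + 1)) % (r + 2) = r + 1 := by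
    rw [Nat.mul_add_mod]; exact Nat.mod_eq_of_lt (by omega)
  have e2 : (r + 1) % (r + 2) = r + 1 := Nat.mod_eq_of_lt (by omega)
  have e3 : (r + 1) / (r + 2) = 0 := Nat.div_eq_of_lt (by omega)
  rw [e1, e2, e3, Nat.choose_self, Nat.choose_zero_right, one_mul] at h3
  rw [h3.dvd_iff dvd_rfl]
  exact hp.one_lt.ne' ∘ Nat.dvd_one.1

theorem smul_prime_pow_eq (h : IsSymmCocycle n a) {p : ℕ} (hp : p.Prime) {s t : ℕ} (hts : t ≤ s)
    (hd : p ^ s ∣ n) (hn : p ^ s < n) :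
    ∃ u v : ℕ, ¬ p ∣ u ∧ u • a (p ^ t) = v • a (p ^ s) := by
  induction s, hts using Nat.le_induction with
  | base => exact ⟨1, 1, by simpa using hp.one_lt.ne', rfl⟩
  | succ s hts ih =>
    have hlt : p ^ s < p ^ (s + 1) := Nat.pow_lt_pow_right hp.one_lt (by omega)
    obtain ⟨u, v, hu, huv⟩ := ih ((pow_dvd_pow p (by omega)).trans hd) (hlt.trans hn)
    obtain ⟨u', v', hu', huv'⟩ := h.smul_prime_pow_eq_succ hp s hd hn
    refine ⟨u' * u, v * v', hp.prime.not_dvd_mul hu' hu, ?_⟩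
    rw [mul_smul, huv, mul_smul, ← huv', smul_comm]

/-- After localization at `p` all values are multiples of a single one. Its index `q` is the largest
power of `p` that divides `n` and is smaller than `n`. -/
theorem exists_smul_eq (h : IsSymmCocycle n a) (hn : 2 ≤ n) {p : ℕ} (hp : p.Prime) :
    ∃ q, ∀ m, 0 < m → m < n → ∃ u v : ℕ, ¬ p ∣ u ∧ u • a m = v • a q := by
  obtain ⟨e, n', hn', rfl⟩ := Nat.exists_eq_pow_mul_and_not_dvd (by omega : n ≠ 0) p hp.ne_one
  have hpe := pow_pos hp.pos e
  -- the exponent of the generator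
  obtain ⟨s, hs, hsn, hsm⟩ : ∃ s, p ^ s ∣ p ^ e * n' ∧ p ^ s < p ^ e * n' ∧
      ∀ m, 0 < m → p ^ s * m < p ^ e * n' → ¬ p ∣ m ∨
        ∃ m', ¬ p ∣ m' ∧ p ^ s * m + p ^ s * m' = p ^ e * n' := by
    rcases Nat.lt_or_ge 1 n' with h1 | h1
    · refine ⟨e, Dvd.intro _ rfl, by nlinarith, fun m _ hm => ?_⟩
      have hm' : m < n' := lt_of_mul_lt_mul_left hm (Nat.zero_le _)
      by_cases hpm : p ∣ m
      · refine Or.inr ⟨n' - m, fun h => hn' ?_, by rw [← mul_add]; congr 1; omega⟩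
        have := dvd_add h hpm
        rwa [Nat.sub_add_cancel hm'.le] at this
      · exact Or.inl hpm
    · obtain rfl : n' = 1 := by
        rcases n' with - | n'
        · simp at hn'
        · omega
      rcases e with - | e
      · simp at hn
      · refine ⟨e, by rw [mul_one]; exact pow_dvd_pow p (by omega), ?_, fun m h0 hm => Or.inl ?_⟩
        · rw [mul_one]; exact Nat.pow_lt_pow_right hp.one_lt (by omega)
        · rw [mul_one, pow_succ] at hm
          exact Nat.not_dvd_of_pos_of_lt h0 (lt_of_mul_lt_mul_left hm (Nat.zero_le _))
  refine ⟨p ^ s, fun m h0 hm => ?_⟩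
  obtain ⟨t, m', hm', rfl⟩ := Nat.exists_eq_pow_mul_and_not_dvd h0.ne' p hp.ne_one
  rcases Nat.le_total t s with hts | hst
  · obtain ⟨u, v, hu, huv⟩ := h.smul_eq_prime_pow hp t m' hm' hm
    obtain ⟨u', v', hu', huv'⟩ := h.smul_prime_pow_eq hp hts hs hsn
    refine ⟨u' * u, v * v', hp.prime.not_dvd_mul hu' hu, ?_⟩
    rw [mul_smul, huv, mul_smul, ← huv', smul_comm]
  -- The index is now `p ^ s` times a cofactor. If `p` divides the cofactor, then `n` is not a power
  -- of `p`, and the reflected index `n - i` has a cofactor prime to `p`; symmetry of the cocycle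
  -- replaces one by the other.
  · obtain ⟨r, rfl⟩ := Nat.exists_eq_add_of_le hst
    rw [pow_add, mul_assoc] at hm h0 ⊢
    rcases hsm (p ^ r * m') (Nat.pos_of_mul_pos_left h0) hm with h1 | ⟨m₂, h1, h2⟩
    · exact h.smul_eq_prime_pow hp s _ h1 hm
    · have h3 : 0 < p ^ s * m₂ := by omega
      rw [h.symm _ _ h0 h3 h2]
      exact h.smul_eq_prime_pow hp s _ h1 (by omega)

/-- The pair of the given cocycle and the binomial one is a cocycle, so at each prime both are
expressed by their values at `q` with the same integers. Cross-multiplication kills the difference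
of the two sides by an integer prime to `p`. As this holds for every `p`, the additive order of the
difference is `1`. -/
theorem mul_smul_eq (h : IsSymmCocycle n a) (hn : 2 ≤ n) {d : ℕ} (hd : 0 < d)
    (hdn : ∀ i, 0 < i → i < n → d ∣ n.choose i) {i m : ℕ} (hi : 0 < i) (hi' : i < n)
    (hm : 0 < m) (hm' : m < n) :
    (n.choose m / d) • a i = (n.choose i / d) • a m := by
  obtain ⟨ci, hci⟩ := hdn i hi hi'
  obtain ⟨cm, hcm⟩ := hdn m hm hm'
  rw [hci, hcm, Nat.mul_div_cancel_left _ hd, Nat.mul_div_cancel_left _ hd]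
  have key : ∀ p : ℕ, p.Prime → ∃ u : ℕ, ¬ p ∣ u ∧ u • (cm • a i - ci • a m) = 0 := by
    intro p hp
    obtain ⟨q, hq⟩ := (h.prod (choose n)).exists_smul_eq hn hp
    obtain ⟨u, v, hu, huv⟩ := hq i hi hi'
    obtain ⟨u', v', hu', huv'⟩ := hq m hm hm'
    have e1 := congrArg Prod.fst huv
    have e2 := congrArg Prod.snd huv
    have e3 := congrArg Prod.fst huv'
    have e4 := congrArg Prod.snd huv'
    simp only [Prod.smul_fst, Prod.smul_snd, nsmul_eq_mul] at e1 e2 e3 e4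
    norm_cast at e2 e4
    by_cases hz : v = 0
    · subst hz
      have hup : 0 < u := Nat.pos_of_ne_zero fun h => hu (h ▸ dvd_zero p)
      have : 0 < n.choose i := Nat.choose_pos hi'.le
      simp only [zero_mul] at e2
      exact absurd e2 (by positivity)
    by_cases hz' : n.choose q = 0
    · have hup : 0 < u := Nat.pos_of_ne_zero fun h => hu (h ▸ dvd_zero p)
      have : 0 < n.choose i := Nat.choose_pos hi'.le
      rw [hz', mul_zero] at e2
      exact absurd e2 (by positivity)
    -- The second coordinates determine the ratio of the two multipliers, once the nonzero factor
    -- `n.choose q * d` is cancelled.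
    have e5 : v * (u' * cm) = v' * (u * ci) := by
      refine Nat.eq_of_mul_eq_mul_left (Nat.mul_pos (Nat.pos_of_ne_zero hz') hd) ?_
      have e6 : u * (d * ci) = v * n.choose q := by rw [← hci, e2]
      have e7 : u' * (d * cm) = v' * n.choose q := by rw [← hcm, e4]
      calc n.choose q * d * (v * (u' * cm)) = (v * n.choose q) * (u' * (d * cm)) := by ring
        _ = (u * (d * ci)) * (v' * n.choose q) := by rw [e6, e7]
        _ = _ := by ring
    refine ⟨u * u', hp.prime.not_dvd_mul hu hu', ?_⟩
    rw [smul_sub, sub_eq_zero]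
    calc (u * u') • cm • a i = (u' * cm) • (u • a i) := by simp only [smul_smul]; congr 1; ring
      _ = (v' * (u * ci)) • a q := by rw [e1, smul_smul, ← e5]; congr 1; ring
      _ = (u * ci) • (u' • a m) := by rw [e3]; simp only [smul_smul]; congr 1; ring
      _ = _ := by simp only [smul_smul]; congr 1; ring
  rw [← sub_eq_zero]
  set z := cm • a i - ci • a m
  rw [← AddMonoid.addOrderOf_eq_one_iff]
  by_contra h1
  obtain ⟨p, hp, hpd⟩ := Nat.exists_prime_and_dvd h1
  obtain ⟨u, hu, huz⟩ := key p hp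
  exact hu (hpd.trans (addOrderOf_dvd_of_nsmul_eq_zero huz))

/-- Lazard's comparison lemma: a symmetric `2`-cocycle is a multiple of
`((X + Y) ^ n - X ^ n - Y ^ n) / d`, where `d` is the greatest common divisor of the
coefficients of the numerator. -/
theorem exists_eq_smul (h : IsSymmCocycle n a) (hn : 2 ≤ n) :
    ∃ d : ℕ, 0 < d ∧ (∀ i, 0 < i → i < n → d ∣ n.choose i) ∧
      ∃ c : B, ∀ i, 0 < i → i < n → a i = (n.choose i / d) • c := by
  let d := (Finset.Ioo 0 n).gcd n.choose
  have hdn : ∀ i, 0 < i → i < n → d ∣ n.choose i := fun i h0 h1 =>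
    Finset.gcd_dvd (Finset.mem_Ioo.2 ⟨h0, h1⟩)
  have hd : 0 < d := Nat.pos_of_ne_zero fun h0 => by
    have := hdn 1 one_pos (by omega)
    rw [h0, zero_dvd_iff, Nat.choose_one_right] at this
    omega
  refine ⟨d, hd, hdn, ?_⟩
  have h1 : (Finset.Ioo 0 n).gcd (fun i => n.choose i / d) = 1 :=
    Finset.gcd_div_eq_one (i := 1) (Finset.mem_Ioo.2 ⟨one_pos, by omega⟩) (by simp; omega)
  have h2 : (Finset.Ioo 0 n).gcd (fun i => ((n.choose i / d : ℕ) : ℤ)) = 1 := by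
    have : ∀ s : Finset ℕ, s.gcd (fun i => ((n.choose i / d : ℕ) : ℤ)) =
        ((s.gcd fun i => n.choose i / d : ℕ) : ℤ) := by
      intro s
      induction s using Finset.induction_on with
      | empty => simp
      | insert x s hx ih => rw [Finset.gcd_insert, Finset.gcd_insert, ih]; rfl
    rw [this, h1]; rfl
  obtain ⟨g, hg⟩ := Finset.gcd_eq_sum_mul (Finset.Ioo 0 n) fun i => ((n.choose i / d : ℕ) : ℤ)
  rw [h2] at hg
  -- The quotients `n.choose i / d` are coprime; `c` is the combination of the values of `a` with
  -- their Bézout coefficients.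
  refine ⟨∑ i ∈ Finset.Ioo 0 n, g i • a i, fun m h0 hm => ?_⟩
  rw [Finset.smul_sum]
  calc a m = (1 : ℤ) • a m := (one_smul _ _).symm
    _ = ∑ i ∈ Finset.Ioo 0 n, (((n.choose i / d : ℕ) : ℤ) * g i) • a m := by
      rw [hg, Finset.sum_smul]
    _ = _ := Finset.sum_congr rfl fun i hi => by
      rw [Finset.mem_Ioo] at hi
      rw [smul_comm, h.mul_smul_eq hn hd hdn hi.1 hi.2 h0 hm, mul_comm, mul_smul, natCast_zsmul]

end IsSymmCocycle

end Comparison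

/-! ### Power series modulo terms of high degree. -/

noncomputable section

open MvPowerSeries

section OrderIdeal

variable (σ R : Type*) [CommRing R]

/-- The ideal of the power series without terms of degree less than `m`. -/
def orderIdeal (m : ℕ) : Ideal (MvPowerSeries σ R) where
  carrier := {f | ∀ d : σ →₀ ℕ, d.degree < m → coeff d f = 0}
  zero_mem' _ _ := map_zero _
  add_mem' hf hg d hd := by rw [map_add, hf d hd, hg d hd, add_zero]
  smul_mem' f g hg d hd := by
    classical
    rw [smul_eq_mul, coeff_mul]
    refine Finset.sum_eq_zero fun p hp => ?_
    rw [Finset.HasAntidiagonal.mem_antidiagonal] at hp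
    rw [hg p.2 (lt_of_le_of_lt (Finsupp.degree_mono (hp ▸ le_add_self)) hd), mul_zero]

variable {σ R}

theorem mem_orderIdeal {m : ℕ} {f : MvPowerSeries σ R} :
    f ∈ orderIdeal σ R m ↔ ∀ d : σ →₀ ℕ, d.degree < m → coeff d f = 0 := Iff.rfl

theorem orderIdeal_anti {m n : ℕ} (h : m ≤ n) : orderIdeal σ R n ≤ orderIdeal σ R m :=
  fun _ hf d hd => hf d (lt_of_lt_of_le hd h)

theorem mul_mem_orderIdeal {m n k : ℕ} (hk : k ≤ m + n) {f g : MvPowerSeries σ R}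
    (hf : f ∈ orderIdeal σ R m) (hg : g ∈ orderIdeal σ R n) : f * g ∈ orderIdeal σ R k := by
  classical
  intro d hd
  rw [coeff_mul]
  refine Finset.sum_eq_zero fun p hp => ?_
  rw [Finset.HasAntidiagonal.mem_antidiagonal] at hp
  by_cases h : p.1.degree < m
  · rw [hf _ h, zero_mul]
  · rw [hg, mul_zero]
    rw [← hp, map_add] at hd
    omega

theorem mem_orderIdeal_zero (f : MvPowerSeries σ R) : f ∈ orderIdeal σ R 0 :=
  fun _ hd => absurd hd (Nat.not_lt_zero _)

theorem mem_orderIdeal_one {f : MvPowerSeries σ R} :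
    f ∈ orderIdeal σ R 1 ↔ f.constantCoeff = 0 := by
  rw [mem_orderIdeal]
  refine ⟨fun h => h 0 (by simp), fun h d hd => ?_⟩
  rw [Nat.lt_one_iff, Finsupp.degree_eq_zero_iff] at hd
  rw [hd]; exact h

theorem pow_mem_orderIdeal {f : MvPowerSeries σ R} (hf : f.constantCoeff = 0) (m : ℕ) :
    f ^ m ∈ orderIdeal σ R m := by
  induction m with
  | zero => exact mem_orderIdeal_zero _
  | succ m ih => rw [pow_succ]; exact mul_mem_orderIdeal le_rfl ih (mem_orderIdeal_one.2 hf)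

/-- The leading form of a product depends only on the leading forms of the factors. -/
theorem mul_sub_mul_mem_orderIdeal {m n k : ℕ} (hk : k ≤ m + n + 1) {f f' g g' : MvPowerSeries σ R}
    (hf : f ∈ orderIdeal σ R m) (hff : f - f' ∈ orderIdeal σ R (m + 1))
    (hg : g' ∈ orderIdeal σ R n) (hgg : g - g' ∈ orderIdeal σ R (n + 1)) :
    f * g - f' * g' ∈ orderIdeal σ R k := by
  have h : f * g - f' * g' = f * (g - g') + (f - f') * g' := by ring
  rw [h]
  exact add_mem (mul_mem_orderIdeal (by omega) hf hgg) (mul_mem_orderIdeal (by omega) hff hg)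

theorem pow_sub_pow_mem_orderIdeal {f f' : MvPowerSeries σ R} (hf : f.constantCoeff = 0)
    (h : f - f' ∈ orderIdeal σ R 2) (m : ℕ) : f ^ m - f' ^ m ∈ orderIdeal σ R (m + 1) := by
  have hf' : f'.constantCoeff = 0 := by
    have := mem_orderIdeal_one.1 (orderIdeal_anti one_le_two h)
    rw [map_sub, hf, zero_sub, neg_eq_zero] at this
    exact this
  induction m with
  | zero => simp
  | succ m ih =>
    rw [pow_succ, pow_succ]
    exact mul_sub_mul_mem_orderIdeal le_rfl (pow_mem_orderIdeal hf m) ih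
      (mem_orderIdeal_one.2 hf') h

variable {τ : Type*} [Finite τ]

theorem prod_pow_mem_orderIdeal {a : τ → MvPowerSeries σ R} (ha : ∀ s, (a s).constantCoeff = 0)
    (d : τ →₀ ℕ) : (d.prod fun s e => a s ^ e) ∈ orderIdeal σ R d.degree := by
  classical
  induction d using Finsupp.induction_linear with
  | zero => exact mem_orderIdeal_zero _
  | add d e hd he =>
    rw [Finsupp.prod_add_index' (fun _ => pow_zero _) (fun _ _ _ => pow_add _ _ _), map_add]
    exact mul_mem_orderIdeal le_rfl hd he
  | single s m =>
    rw [Finsupp.prod_single_index (h := fun s e => a s ^ e) (pow_zero _), Finsupp.degree_single]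
    exact pow_mem_orderIdeal (ha s) m

/-- A monomial of degree `e` in series without constant term has order at least `e`, so substitution
does not lower the order. -/
theorem subst_sub_subst_mem_left {a : τ → MvPowerSeries σ R} (ha : ∀ s, (a s).constantCoeff = 0)
    {f f' : MvPowerSeries τ R} {m : ℕ} (h : f - f' ∈ orderIdeal τ R m) :
    subst a f - subst a f' ∈ orderIdeal σ R m := by
  intro e he
  have hs := hasSubst_of_constantCoeff_zero ha
  rw [← subst_sub hs, coeff_subst hs]
  refine finsum_eq_zero_of_forall_eq_zero fun d => ?_
  by_cases hd : d.degree < m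
  · rw [h d hd, zero_smul]
  · rw [prod_pow_mem_orderIdeal ha d e (by omega), smul_zero]

theorem subst_sub_subst_mem_right {a a' : τ → MvPowerSeries σ R}
    (ha : ∀ s, (a s).constantCoeff = 0) (ha' : ∀ s, (a' s).constantCoeff = 0)
    {m : ℕ} (h : ∀ s, a s - a' s ∈ orderIdeal σ R m) (f : MvPowerSeries τ R) :
    subst a f - subst a' f ∈ orderIdeal σ R m := by
  intro e he
  rw [map_sub, coeff_subst (hasSubst_of_constantCoeff_zero ha),
    coeff_subst (hasSubst_of_constantCoeff_zero ha'), sub_eq_zero]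
  refine finsum_congr fun d => ?_
  have h1 : (d.prod fun s e => a s ^ e) - (d.prod fun s e => a' s ^ e) ∈ orderIdeal σ R m := by
    rw [← Ideal.Quotient.mk_eq_mk_iff_sub_mem, Finsupp.prod, Finsupp.prod, map_prod, map_prod]
    refine Finset.prod_congr rfl fun s _ => ?_
    rw [map_pow, map_pow, Ideal.Quotient.mk_eq_mk_iff_sub_mem _ _ |>.2 (h s)]
  have h2 := h1 e he
  rw [map_sub, sub_eq_zero] at h2
  rw [h2]

end OrderIdeal

/-! ### Formal group laws defined by a logarithm. -/

section OfLog

variable {R : Type*} [CommRing R]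

theorem constantCoeff_psubst {σ : Type*} {a : MvPowerSeries σ R} (ha : a.constantCoeff = 0)
    {f : PowerSeries R} (hf : PowerSeries.constantCoeff f = 0) :
    (PowerSeries.subst a f).constantCoeff = 0 := PowerSeries.constantCoeff_subst_eq_zero ha f hf

/-- A power series `X + ⋯`. -/
structure IsLog (l : PowerSeries R) : Prop where
  constantCoeff : PowerSeries.constantCoeff l = 0
  coeff_one : PowerSeries.coeff 1 l = 1

variable {l : PowerSeries R}

theorem IsLog.isUnit (h : IsLog l) : IsUnit (PowerSeries.coeff 1 l) := by
  rw [h.coeff_one]; exact isUnit_one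

/-- The inverse of `l` for composition. -/
def IsLog.inv (h : IsLog l) : PowerSeries R := l.substInvOfIsUnit h.isUnit

theorem IsLog.inv_isLog (h : IsLog l) : IsLog h.inv where
  constantCoeff := PowerSeries.constantCoeff_substInvOfIsUnit _ _
  coeff_one := by
    have : h.isUnit.unit = 1 := Units.ext h.coeff_one
    rw [IsLog.inv, PowerSeries.coeff_one_substInvOfIsUnit, this, inv_one, Units.val_one]

variable {σ : Type*}

theorem hasSubst_of_constantCoeff {a : MvPowerSeries σ R} (ha : a.constantCoeff = 0) :
    PowerSeries.HasSubst a := PowerSeries.HasSubst.of_constantCoeff_zero ha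

theorem IsLog.subst_inv (h : IsLog l) {a : MvPowerSeries σ R} (ha : a.constantCoeff = 0) :
    PowerSeries.subst (PowerSeries.subst a l) h.inv = a := by
  rw [← PowerSeries.subst_comp_subst_apply
    (PowerSeries.HasSubst.of_constantCoeff_zero' h.constantCoeff) (hasSubst_of_constantCoeff ha),
    IsLog.inv, PowerSeries.subst_substInvOfIsUnit_left _ h.constantCoeff,
    PowerSeries.subst_X (hasSubst_of_constantCoeff ha)]

theorem IsLog.subst_log (h : IsLog l) {a : MvPowerSeries σ R} (ha : a.constantCoeff = 0) :
    PowerSeries.subst (PowerSeries.subst a h.inv) l = a := by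
  rw [← PowerSeries.subst_comp_subst_apply
    (PowerSeries.HasSubst.of_constantCoeff_zero' h.inv_isLog.constantCoeff)
    (hasSubst_of_constantCoeff ha),
    IsLog.inv, PowerSeries.subst_substInvOfIsUnit_right _ h.constantCoeff,
    PowerSeries.subst_X (hasSubst_of_constantCoeff ha)]

theorem psubst_sub_mem_left {a : MvPowerSeries σ R} (ha : a.constantCoeff = 0)
    {f f' : PowerSeries R} {m : ℕ} (h : ∀ n < m, PowerSeries.coeff n f = PowerSeries.coeff n f') :
    PowerSeries.subst a f - PowerSeries.subst a f' ∈ orderIdeal σ R m := by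
  refine subst_sub_subst_mem_left (fun _ => ha) fun d hd => ?_
  obtain ⟨n, rfl⟩ : ∃ n, d = Finsupp.single () n := ⟨d (), by ext; simp⟩
  rw [Finsupp.degree_single] at hd
  rw [map_sub, sub_eq_zero]
  exact h n hd

theorem psubst_sub_mem_right {a a' : MvPowerSeries σ R} (ha : a.constantCoeff = 0)
    (ha' : a'.constantCoeff = 0) {m : ℕ} (h : a - a' ∈ orderIdeal σ R m) (f : PowerSeries R) :
    PowerSeries.subst a f - PowerSeries.subst a' f ∈ orderIdeal σ R m :=
  subst_sub_subst_mem_right (fun _ => ha) (fun _ => ha') (fun _ => h) f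

/-- The power series `l⁻¹(l(a) + l(b))`. -/
def IsLog.sum (h : IsLog l) (a b : MvPowerSeries σ R) : MvPowerSeries σ R :=
  PowerSeries.subst (PowerSeries.subst a l + PowerSeries.subst b l) h.inv

theorem IsLog.constantCoeff_add (h : IsLog l) {a b : MvPowerSeries σ R}
    (ha : a.constantCoeff = 0) (hb : b.constantCoeff = 0) :
    (PowerSeries.subst a l + PowerSeries.subst b l).constantCoeff = 0 := by
  rw [map_add, constantCoeff_psubst ha h.constantCoeff, constantCoeff_psubst hb h.constantCoeff,
    add_zero]

theorem IsLog.constantCoeff_sum (h : IsLog l) {a b : MvPowerSeries σ R}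
    (ha : a.constantCoeff = 0) (hb : b.constantCoeff = 0) : (h.sum a b).constantCoeff = 0 :=
  constantCoeff_psubst (h.constantCoeff_add ha hb) h.inv_isLog.constantCoeff

theorem IsLog.log_sum (h : IsLog l) {a b : MvPowerSeries σ R} (ha : a.constantCoeff = 0)
    (hb : b.constantCoeff = 0) :
    PowerSeries.subst (h.sum a b) l = PowerSeries.subst a l + PowerSeries.subst b l :=
  h.subst_log (h.constantCoeff_add ha hb)

theorem constantCoeff_cons {a b : MvPowerSeries σ R} (ha : a.constantCoeff = 0)
    (hb : b.constantCoeff = 0) (s : Fin 2) : (![a, b] s).constantCoeff = 0 := by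
  fin_cases s
  exacts [ha, hb]

theorem IsLog.subst_sum (h : IsLog l) {a b : MvPowerSeries σ R} (ha : a.constantCoeff = 0)
    (hb : b.constantCoeff = 0) :
    subst ![a, b] (h.sum (X 0 : MvPowerSeries (Fin 2) R) (X 1)) = h.sum a b := by
  have hs : HasSubst ![a, b] := hasSubst_of_constantCoeff_zero (constantCoeff_cons ha hb)
  have h0 : (X 0 : MvPowerSeries (Fin 2) R).constantCoeff = 0 := constantCoeff_X _
  have h1 : (X 1 : MvPowerSeries (Fin 2) R).constantCoeff = 0 := constantCoeff_X _
  have h2 : ∀ (c : MvPowerSeries (Fin 2) R) (f : PowerSeries R), c.constantCoeff = 0 →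
      subst ![a, b] (PowerSeries.subst c f) = PowerSeries.subst (subst ![a, b] c) f :=
    fun c f hc => subst_comp_subst_apply (hasSubst_of_constantCoeff hc).const hs f
  rw [IsLog.sum, h2 _ _ (h.constantCoeff_add h0 h1), subst_add hs, h2 _ _ h0, h2 _ _ h1,
    subst_X hs, subst_X hs]
  rfl

theorem IsLog.sum_sub_mem (h : IsLog l) {a b : MvPowerSeries σ R} (ha : a.constantCoeff = 0)
    (hb : b.constantCoeff = 0) : h.sum a b - (a + b) ∈ orderIdeal σ R 2 := by
  have key : ∀ {l : PowerSeries R}, IsLog l → ∀ {c : MvPowerSeries σ R}, c.constantCoeff = 0 →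
      PowerSeries.subst c l - c ∈ orderIdeal σ R 2 := by
    intro l h c hc
    have := psubst_sub_mem_left hc (f := l) (f' := PowerSeries.X) (m := 2) fun n hn => by
      interval_cases n
      · rw [PowerSeries.coeff_zero_eq_constantCoeff, h.constantCoeff]; simp
      · rw [h.coeff_one, PowerSeries.coeff_one_X]
    rwa [PowerSeries.subst_X (hasSubst_of_constantCoeff hc)] at this
  have h1 := key h.inv_isLog (h.constantCoeff_add ha hb)
  have h2 := add_mem h1 (add_mem (key h ha) (key h hb))
  convert h2 using 1
  rw [IsLog.sum]; ring

/-- The formal group law `l⁻¹(l(X) + l(Y))`. -/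
def IsLog.formalGroup (h : IsLog l) : FormalGroup R where
  toPowerSeries := h.sum (X 0) (X 1)
  zero_constantCoeff := h.constantCoeff_sum (constantCoeff_X _) (constantCoeff_X _)
  lin_coeff_X := by
    classical
    have := h.sum_sub_mem (constantCoeff_X (0 : Fin 2)) (constantCoeff_X 1)
      (Finsupp.single 0 1) (by simp)
    rw [map_sub, sub_eq_zero] at this
    rw [this, map_add, coeff_index_single_X, coeff_index_single_X]; simp
  lin_coeff_Y := by
    classical
    have := h.sum_sub_mem (constantCoeff_X (0 : Fin 2)) (constantCoeff_X 1)
      (Finsupp.single 1 1) (by simp)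
    rw [map_sub, sub_eq_zero] at this
    rw [this, map_add, coeff_index_single_X, coeff_index_single_X]; simp
  assoc := by
    have h0 := constantCoeff_X (R := R) (0 : Fin 3)
    have h1 := constantCoeff_X (R := R) (1 : Fin 3)
    have h2 := constantCoeff_X (R := R) (2 : Fin 3)
    rw [h.subst_sum h0 h1, h.subst_sum (h.constantCoeff_sum h0 h1) h2, h.subst_sum h1 h2,
      h.subst_sum h0 (h.constantCoeff_sum h1 h2), IsLog.sum, h.log_sum h0 h1]
    conv_rhs => rw [IsLog.sum, h.log_sum h1 h2]
    rw [add_assoc]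

instance (h : IsLog l) : h.formalGroup.IsComm where
  comm := by
    change h.sum (X 0) (X 1) = subst ![X 1, X 0] (h.sum (X 0) (X 1))
    rw [h.subst_sum (constantCoeff_X _) (constantCoeff_X _), IsLog.sum, add_comm]; rfl

end OfLog

end

/-! ### Binary forms and the obstruction to associativity. -/

noncomputable section

open MvPowerSeries FormalGroupRing

section Form

variable {R σ : Type*} [CommRing R]

/-- The binary form `∑ h i * a ^ i * b ^ (m - i)`. -/
def binaryForm (h : ℕ → R) (m : ℕ) (a b : MvPowerSeries σ R) : MvPowerSeries σ R :=
  ∑ i ∈ Finset.range (m + 1), C (h i) * (a ^ i * b ^ (m - i))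

theorem subst_binaryForm {τ : Type*} (h : ℕ → R) (m : ℕ) (c d : MvPowerSeries σ R)
    {a : σ → MvPowerSeries τ R} (ha : HasSubst a) :
    subst a (binaryForm h m c d) = binaryForm h m (subst a c) (subst a d) := by
  rw [← coe_substAlgHom ha, binaryForm, map_sum, binaryForm]
  refine Finset.sum_congr rfl fun i _ => ?_
  rw [map_mul, map_mul, map_pow, map_pow]
  congr 1
  rw [coe_substAlgHom ha, subst_C]

theorem subst_cons_binaryForm (h : ℕ → R) (m : ℕ) {a b : MvPowerSeries σ R}
    (ha : a.constantCoeff = 0) (hb : b.constantCoeff = 0) :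
    subst ![a, b] (binaryForm h m (X 0 : MvPowerSeries (Fin 2) R) (X 1)) = binaryForm h m a b := by
  have hs : HasSubst ![a, b] := hasSubst_of_constantCoeff_zero (constantCoeff_cons ha hb)
  rw [subst_binaryForm _ _ _ _ hs, subst_X hs, subst_X hs]
  rfl

/-- Modulo degree `m + 1`, a form of degree `m` sees only the linear parts of its arguments. -/
theorem binaryForm_sub_mem (h : ℕ → R) (m : ℕ) {a a' b b' : MvPowerSeries σ R}
    (ha : a.constantCoeff = 0) (hb : b.constantCoeff = 0) (hb' : b'.constantCoeff = 0)
    (haa : a - a' ∈ orderIdeal σ R 2) (hbb : b - b' ∈ orderIdeal σ R 2) :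
    binaryForm h m a b - binaryForm h m a' b' ∈ orderIdeal σ R (m + 1) := by
  rw [binaryForm, binaryForm, ← Finset.sum_sub_distrib]
  refine sum_mem fun i hi => ?_
  rw [Finset.mem_range] at hi
  rw [← mul_sub]
  refine Ideal.mul_mem_left _ _ (mul_sub_mul_mem_orderIdeal (m := i) (n := m - i) (by omega)
    (pow_mem_orderIdeal ha i) (pow_sub_pow_mem_orderIdeal ha haa i) (pow_mem_orderIdeal hb' _)
    (pow_sub_pow_mem_orderIdeal hb hbb _))

theorem coeff_binaryForm (h : ℕ → R) (m : ℕ) (d : Fin 2 →₀ ℕ) :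
    coeff d (binaryForm h m (X 0 : MvPowerSeries (Fin 2) R) (X 1)) =
      if d.degree = m then h (d 0) else 0 := by
  classical
  have hdeg : d.degree = d 0 + d 1 := by
    rw [Finsupp.degree_eq_sum, Fin.sum_univ_two]
  have h1 : ∀ i, coeff d (C (h i) * ((X 0 : MvPowerSeries (Fin 2) R) ^ i * X 1 ^ (m - i))) =
      if d 0 = i ∧ d 1 = m - i then h i else 0 := by
    intro i
    rw [coeff_C_mul, X_pow_eq, X_pow_eq, monomial_mul_monomial, coeff_monomial, one_mul]
    have : d = Finsupp.single 0 i + Finsupp.single 1 (m - i) ↔ d 0 = i ∧ d 1 = m - i := by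
      constructor
      · rintro rfl; simp
      · rintro ⟨h0, h1⟩; ext s; fin_cases s <;> simp [h0, h1]
    simp only [this]
    split_ifs <;> simp
  rw [binaryForm, map_sum]
  simp only [h1]
  split_ifs with hd
  · rw [Finset.sum_eq_single (d 0)]
    · rw [if_pos ⟨rfl, by omega⟩]
    · intro i _ hi
      rw [if_neg fun h => hi h.1.symm]
    · intro h; rw [Finset.mem_range] at h; omega
  · refine Finset.sum_eq_zero fun i hi => if_neg ?_
    rw [Finset.mem_range] at hi
    omega

theorem sub_binaryForm_mem {f : MvPowerSeries (Fin 2) R} {m : ℕ} (hf : f ∈ orderIdeal (Fin 2) R m)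
    {h : ℕ → R} (hh : ∀ d : Fin 2 →₀ ℕ, d.degree = m → coeff d f = h (d 0)) :
    f - binaryForm h m (X 0) (X 1) ∈ orderIdeal (Fin 2) R (m + 1) := by
  intro d hd
  rw [map_sub, coeff_binaryForm]
  split_ifs with h1
  · rw [hh d h1, sub_self]
  · rw [hf d (by omega), sub_zero]

/-- The exponent of `X 0 ^ i * X 1 ^ j * X 2 ^ k`. -/
def exponent (i j k : ℕ) : Fin 3 →₀ ℕ :=
  Finsupp.single 0 i + Finsupp.single 1 j + Finsupp.single 2 k

theorem degree_exponent (i j k : ℕ) : (exponent i j k).degree = i + j + k := by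
  rw [exponent, map_add, map_add, Finsupp.degree_single, Finsupp.degree_single,
    Finsupp.degree_single]

theorem coeff_exponent (i j k p q r : ℕ) :
    coeff (exponent i j k) ((X 0 : MvPowerSeries (Fin 3) R) ^ p * X 1 ^ q * X 2 ^ r) =
      if i = p ∧ j = q ∧ k = r then 1 else 0 := by
  classical
  rw [X_pow_eq, X_pow_eq, X_pow_eq, monomial_mul_monomial, monomial_mul_monomial, coeff_monomial,
    mul_one, mul_one]
  refine if_congr ⟨fun h => ?_, ?_⟩ rfl rfl
  · have h0 := DFunLike.congr_fun h 0
    have h1 := DFunLike.congr_fun h 1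
    have h2 := DFunLike.congr_fun h 2
    simp [exponent] at h0 h1 h2
    exact ⟨h0, h1, h2⟩
  · rintro ⟨rfl, rfl, rfl⟩; rfl

theorem coeff_binaryForm_add_left (h : ℕ → R) (i j k : ℕ) :
    coeff (exponent i j k) (binaryForm h (i + j + k) (X 0 + X 1) (X 2)) =
      (i + j).choose i • h (i + j) := by
  rw [binaryForm, map_sum, Finset.sum_eq_single (i + j)]
  · rw [coeff_C_mul, add_pow, Finset.sum_mul, map_sum, Finset.sum_eq_single i]
    · rw [mul_right_comm, ← map_natCast (C (σ := Fin 3) (R := R)), mul_comm _ (C _), coeff_C_mul,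
        coeff_exponent, if_pos (by omega), nsmul_eq_mul]
      ring
    · intro p _ hp
      rw [mul_right_comm, ← map_natCast (C (σ := Fin 3) (R := R)), mul_comm, coeff_C_mul,
        coeff_exponent, if_neg (by omega), mul_zero]
    · intro hp; rw [Finset.mem_range] at hp; omega
  · intro a ha haij
    rw [Finset.mem_range] at ha
    rw [coeff_C_mul, add_pow, Finset.sum_mul, map_sum, Finset.sum_eq_zero, mul_zero]
    intro p hp
    rw [Finset.mem_range] at hp
    rw [mul_right_comm, ← map_natCast (C (σ := Fin 3) (R := R)), mul_comm, coeff_C_mul,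
        coeff_exponent, if_neg (by omega), mul_zero]
  · intro hp; rw [Finset.mem_range] at hp; omega

theorem coeff_binaryForm_add_right (h : ℕ → R) (i j k : ℕ) :
    coeff (exponent i j k) (binaryForm h (i + j + k) (X 0) (X 1 + X 2)) =
      (j + k).choose j • h i := by
  have e : ∀ (a p q : ℕ) (c : R), (X 0 : MvPowerSeries (Fin 3) R) ^ a * (X 1 ^ p * X 2 ^ q *
      (C c)) = C c * (X 0 ^ a * X 1 ^ p * X 2 ^ q) := fun a p q c => by ring
  rw [binaryForm, map_sum, Finset.sum_eq_single i]
  · rw [coeff_C_mul, add_pow, Finset.mul_sum, map_sum, Finset.sum_eq_single j]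
    · rw [← map_natCast (C (σ := Fin 3) (R := R)), e, coeff_C_mul,
        coeff_exponent, if_pos (by omega), nsmul_eq_mul, show i + j + k - i = j + k by omega]
      ring
    · intro p _ hp
      rw [← map_natCast (C (σ := Fin 3) (R := R)), e, coeff_C_mul,
        coeff_exponent, if_neg (by omega), mul_zero]
    · intro hp; rw [Finset.mem_range] at hp; omega
  · intro a ha haij
    rw [coeff_C_mul, add_pow, Finset.mul_sum, map_sum, Finset.sum_eq_zero, mul_zero]
    intro p hp
    rw [← map_natCast (C (σ := Fin 3) (R := R)), e, coeff_C_mul,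
        coeff_exponent, if_neg (by omega), mul_zero]
  · intro hp; rw [Finset.mem_range] at hp; omega

/-- Two of the four terms of the coboundary involve only two variables, so they contribute nothing
at monomials in all three. The remaining two give exactly the relation required of a cocycle. -/
theorem coeff_binaryForm_left (h : ℕ → R) (i j k m : ℕ) (hk : 0 < k) :
    coeff (exponent i j k) (binaryForm h m (X 0) (X 1)) = 0 := by
  rw [binaryForm, map_sum]
  refine Finset.sum_eq_zero fun a _ => ?_
  have := coeff_exponent (R := R) i j k a (m - a) 0
  rw [pow_zero, mul_one] at this
  rw [coeff_C_mul, this, if_neg (by omega), mul_zero]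

theorem coeff_binaryForm_right (h : ℕ → R) (i j k m : ℕ) (hi : 0 < i) :
    coeff (exponent i j k) (binaryForm h m (X 1) (X 2)) = 0 := by
  rw [binaryForm, map_sum]
  refine Finset.sum_eq_zero fun a _ => ?_
  have := coeff_exponent (R := R) i j k 0 a (m - a)
  rw [pow_zero, one_mul] at this
  rw [coeff_C_mul, this, if_neg (by omega), mul_zero]

end Form

section Obstruction

variable {R σ : Type*} [CommRing R]

/-- The power series `X + Y - X Y q`. -/
def ofQuot (q : MvPowerSeries (Fin 2) R) : MvPowerSeries (Fin 2) R := X 0 + X 1 - X 0 * X 1 * q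

theorem constantCoeff_ofQuot (q : MvPowerSeries (Fin 2) R) : (ofQuot q).constantCoeff = 0 := by
  simp [ofQuot]

theorem subst_ofQuot (q : MvPowerSeries (Fin 2) R) {a b : MvPowerSeries σ R}
    (ha : a.constantCoeff = 0) (hb : b.constantCoeff = 0) :
    subst ![a, b] (ofQuot q) = a + b - a * b * subst ![a, b] q := by
  have hs : HasSubst ![a, b] := hasSubst_of_constantCoeff_zero (constantCoeff_cons ha hb)
  rw [ofQuot, subst_sub hs, subst_add hs, subst_mul hs, subst_mul hs, subst_X hs, subst_X hs]
  rfl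

theorem constantCoeff_subst_cons {f : MvPowerSeries (Fin 2) R} (hf : f.constantCoeff = 0)
    {a b : MvPowerSeries σ R} (ha : a.constantCoeff = 0) (hb : b.constantCoeff = 0) :
    (subst ![a, b] f).constantCoeff = 0 :=
  constantCoeff_subst_eq_zero (hasSubst_of_constantCoeff_zero (constantCoeff_cons ha hb))
    (constantCoeff_cons ha hb) hf

theorem subst_ofQuot_sub_mem (q : MvPowerSeries (Fin 2) R) {a b : MvPowerSeries σ R}
    (ha : a.constantCoeff = 0) (hb : b.constantCoeff = 0) :
    subst ![a, b] (ofQuot q) - (a + b) ∈ orderIdeal σ R 2 := by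
  rw [subst_ofQuot q ha hb, show a + b - a * b * subst ![a, b] q - (a + b) =
    -(subst ![a, b] q * (a * b)) by ring]
  exact neg_mem (Ideal.mul_mem_left _ _ (mul_mem_orderIdeal le_rfl (mem_orderIdeal_one.2 ha)
    (mem_orderIdeal_one.2 hb)))

/-- The nonlinear part of `ofQuot q` carries the factor `X Y`, so errors of order `m` in the
arguments simply add up, to first order. -/
theorem subst_ofQuot_sub_sub_mem (q : MvPowerSeries (Fin 2) R) {a a' b b' : MvPowerSeries σ R}
    (ha : a.constantCoeff = 0) (ha' : a'.constantCoeff = 0) (hb : b.constantCoeff = 0)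
    (hb' : b'.constantCoeff = 0) {m : ℕ}
    (haa : a - a' ∈ orderIdeal σ R m) (hbb : b - b' ∈ orderIdeal σ R m) :
    subst ![a, b] (ofQuot q) - subst ![a', b'] (ofQuot q) - ((a - a') + (b - b')) ∈
      orderIdeal σ R (m + 1) := by
  rw [subst_ofQuot q ha hb, subst_ofQuot q ha' hb']
  have hq : subst ![a, b] q - subst ![a', b'] q ∈ orderIdeal σ R m :=
    subst_sub_subst_mem_right (constantCoeff_cons ha hb) (constantCoeff_cons ha' hb')
      (by intro s; fin_cases s; exacts [haa, hbb]) q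
  have e : a + b - a * b * subst ![a, b] q - (a' + b' - a' * b' * subst ![a', b'] q) -
      ((a - a') + (b - b')) = -(((a - a') * b + (b - b') * a') * subst ![a, b] q +
        (subst ![a, b] q - subst ![a', b'] q) * (a' * b')) := by ring
  rw [e]
  refine neg_mem (add_mem (Ideal.mul_mem_right _ _ (add_mem
    (mul_mem_orderIdeal le_rfl haa (mem_orderIdeal_one.2 hb))
    (mul_mem_orderIdeal le_rfl hbb (mem_orderIdeal_one.2 ha')))) ?_)
  exact mul_mem_orderIdeal le_rfl hq (orderIdeal_anti one_le_two
    (mul_mem_orderIdeal le_rfl (mem_orderIdeal_one.2 ha') (mem_orderIdeal_one.2 hb')))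

/-- The law `G` is associative, and it is `ofQuot q` plus the form `h`, up to degree `m`. Expanding
both bracketings of `G` therefore shows that the associator of `ofQuot q` is minus the coboundary of
`h`. -/
theorem associator_add_mem (G : FormalGroup R) (q : MvPowerSeries (Fin 2) R) {m : ℕ} (hm : 2 ≤ m)
    (h1 : G.toPowerSeries - ofQuot q ∈ orderIdeal (Fin 2) R m) {h : ℕ → R}
    (h2 : G.toPowerSeries - ofQuot q - binaryForm h m (X 0) (X 1) ∈
      orderIdeal (Fin 2) R (m + 1)) {x y z : MvPowerSeries σ R}
    (hx : x.constantCoeff = 0) (hy : y.constantCoeff = 0) (hz : z.constantCoeff = 0) :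
    (subst ![subst ![x, y] (ofQuot q), z] (ofQuot q) -
      subst ![x, subst ![y, z] (ofQuot q)] (ofQuot q)) +
      (binaryForm h m x y + binaryForm h m (x + y) z - binaryForm h m y z -
        binaryForm h m x (y + z)) ∈ orderIdeal σ R (m + 1) := by
  have key : ∀ {a b : MvPowerSeries σ R}, a.constantCoeff = 0 → b.constantCoeff = 0 →
      subst ![a, b] G.toPowerSeries - subst ![a, b] (ofQuot q) - binaryForm h m a b ∈
        orderIdeal σ R (m + 1) := by
    intro a b ha hb
    have hc := constantCoeff_cons ha hb
    have := subst_sub_subst_mem_left hc (f := G.toPowerSeries - ofQuot q)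
      (f' := binaryForm h m (X 0) (X 1)) h2
    rwa [subst_sub (hasSubst_of_constantCoeff_zero hc), subst_cons_binaryForm h m ha hb] at this
  have key1 : ∀ {a b : MvPowerSeries σ R}, a.constantCoeff = 0 → b.constantCoeff = 0 →
      subst ![a, b] G.toPowerSeries - subst ![a, b] (ofQuot q) ∈ orderIdeal σ R m := by
    intro a b ha hb
    exact subst_sub_subst_mem_left (constantCoeff_cons ha hb) h1
  have hG := G.zero_constantCoeff
  have hg := constantCoeff_ofQuot q
  have cxy := constantCoeff_subst_cons hG hx hy
  have cyz := constantCoeff_subst_cons hG hy hz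
  have cxy' := constantCoeff_subst_cons hg hx hy
  have cyz' := constantCoeff_subst_cons hg hy hz
  have s1 := key cxy hz
  have s2 := subst_ofQuot_sub_sub_mem q cxy cxy' hz hz (key1 hx hy) (by simp)
  have s3 := key hx hy
  have s4 := binaryForm_sub_mem h m cxy hz hz (a' := x + y) (by
    have := add_mem (orderIdeal_anti hm (key1 hx hy)) (subst_ofQuot_sub_mem q hx hy)
    rwa [sub_add_sub_cancel] at this) (by simp : z - z ∈ _)
  have t1 := key hx cyz
  have t2 := subst_ofQuot_sub_sub_mem q hx hx cyz cyz' (by simp) (key1 hy hz)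
  have t3 := key hy hz
  have t4 := binaryForm_sub_mem h m hx cyz (b' := y + z) (a' := x) (by rw [map_add, hy, hz, add_zero])
    (by simp) (by
    have := add_mem (orderIdeal_anti hm (key1 hy hz)) (subst_ofQuot_sub_mem q hy hz)
    rwa [sub_add_sub_cancel] at this)
  have hassoc := G.assoc' (hasSubst_of_constantCoeff hx) (hasSubst_of_constantCoeff hy)
    (hasSubst_of_constantCoeff hz)
  -- The `s` terms expand the left bracketing of `G` and the `t` terms the right one: outer form,
  -- transmitted inner error, inner form, and linearization of the outer form.
  have := add_mem (add_mem (neg_mem (add_mem s1 s2)) (neg_mem (add_mem s3 s4)))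
    (add_mem (add_mem t1 t2) (add_mem t3 t4))
  refine (congrArg (· ∈ orderIdeal σ R (m + 1)) ?_).mp this
  rw [hassoc]
  ring

end Obstruction

end

/-! ### Lazard's theorem: lifting formal group laws. -/

noncomputable section

open MvPowerSeries FormalGroupRing

section Lift

variable {A K R : Type*} [CommRing A] [Field K] [CharZero K] [Algebra A K] [CommRing R]
  {φ : A →+* R}

theorem ofQuot_gSeries (F : FormalGroup R) : ofQuot (gSeries F) = F.toPowerSeries :=
  (toPowerSeries_eq F).symm

theorem map_ofQuot {R' : Type*} [CommRing R'] (f : R →+* R') (q : MvPowerSeries (Fin 2) R) :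
    map f (ofQuot q) = ofQuot (map f q) := by
  simp [ofQuot]

/-- The power series `g(g(X, Y), Z) - g(X, g(Y, Z))`. -/
def psAssociator (g : MvPowerSeries (Fin 2) R) : MvPowerSeries (Fin 3) R :=
  subst ![subst ![X 0, X 1] g, X 2] g - subst ![X 0, subst ![X 1, X 2] g] g

theorem map_psAssociator {R' : Type*} [CommRing R'] {f : R →+* R'} {g : MvPowerSeries (Fin 2) R}
    (hg : g.constantCoeff = 0) : map f (psAssociator g) = psAssociator (map f g) := by
  rw [psAssociator, psAssociator, map_sub, map_subst (HasSubst.cons_subst_zero_left 0 1 2 hg),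
    map_subst (HasSubst.cons_subst_zero_right 0 1 2 hg)]
  congr 2
  · funext s; fin_cases s
    · simp only [Fin.zero_eta, Matrix.cons_val_zero]
      rw [map_subst HasSubst.X_X]
      congr 1; funext s; fin_cases s <;> simp
    · simp
  · funext s; fin_cases s
    · simp
    · simp only [Fin.mk_one, Matrix.cons_val_one, Matrix.cons_val_fin_one]
      rw [map_subst HasSubst.X_X]
      congr 1; funext s; fin_cases s <;> simp

theorem coeff_swap (F : FormalGroup R) [F.IsComm] (i j : ℕ) :
    coeff (Finsupp.single 0 i + Finsupp.single 1 j) F.toPowerSeries =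
      coeff (Finsupp.single 0 j + Finsupp.single 1 i) F.toPowerSeries := by
  classical
  conv_lhs => rw [FormalGroup.IsComm.comm (F := F), coeff_subst HasSubst.X_X]
  rw [finsum_eq_single _ (Finsupp.single 0 j + Finsupp.single 1 i)]
  · rw [Finsupp.prod_fintype _ _ fun _ => pow_zero _, Fin.prod_univ_two]
    simp [X_pow_eq, monomial_mul_monomial, add_comm]
  · intro d hd
    rw [Finsupp.prod_fintype _ _ fun _ => pow_zero _, Fin.prod_univ_two]
    have : ¬ (Finsupp.single 0 i + Finsupp.single 1 j : Fin 2 →₀ ℕ) =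
        Finsupp.single 1 (d 0) + Finsupp.single 0 (d 1) := by
      intro h
      apply hd
      have h0 := DFunLike.congr_fun h 0
      have h1 := DFunLike.congr_fun h 1
      simp at h0 h1
      ext s; fin_cases s <;> simp [h0, h1]
    simp [X_pow_eq, monomial_mul_monomial, coeff_monomial, this]

theorem eq_single_add_single (d : Fin 2 →₀ ℕ) :
    d = Finsupp.single 0 (d 0) + Finsupp.single 1 (d 1) := by
  ext s; fin_cases s <;> simp

theorem degree_fin_two (d : Fin 2 →₀ ℕ) : d.degree = d 0 + d 1 := by
  rw [Finsupp.degree_eq_sum, Fin.sum_univ_two]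

/-- The coefficient of `G` is the image of an element that `φ` maps to the coefficient of `F`. -/
def LiftsAt (φ : A →+* R) (G : FormalGroup K) (F : FormalGroup R) (d : Fin 2 →₀ ℕ) : Prop :=
  ∃ a : A, algebraMap A K a = coeff d G.toPowerSeries ∧ φ a = coeff d F.toPowerSeries

theorem LiftsAt.of_axis {G : FormalGroup K} {F : FormalGroup R} {d : Fin 2 →₀ ℕ}
    (hd : d 0 = 0 ∨ d 1 = 0) : LiftsAt φ G F d := by
  classical
  rcases hd with hd | hd
  · refine ⟨coeff d (X 1), ?_, ?_⟩
    · rw [coeff_axis_one G d hd, coeff_X, coeff_X]; split_ifs <;> simp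
    · rw [coeff_axis_one F d hd, coeff_X, coeff_X]; split_ifs <;> simp
  · refine ⟨coeff d (X 0), ?_, ?_⟩
    · rw [coeff_axis_zero G d hd, coeff_X, coeff_X]; split_ifs <;> simp
    · rw [coeff_axis_zero F d hd, coeff_X, coeff_X]; split_ifs <;> simp

/-- This supplies a series over `A` that reduces to `F` in all degrees and agrees with `G` as far as
`G` is already integral. It need not be associative; that failure is what the next step corrects. -/
theorem exists_lift_quot (hφ : Function.Surjective φ) {G : FormalGroup K} {F : FormalGroup R}
    {n : ℕ} (h : ∀ d, d.degree ≤ n → LiftsAt φ G F d) :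
    ∃ q : MvPowerSeries (Fin 2) A, map φ q = gSeries F ∧
      G.toPowerSeries - ofQuot (map (algebraMap A K) q) ∈ orderIdeal (Fin 2) K (n + 1) := by
  -- A coefficient of degree `e` of the quotient series is one of degree `e + 2` of the law, so `e <
  -- n - 1` is the range where lifts compatible with `G` are given. Beyond it any lift will do.
  have h1 : ∀ d : Fin 2 →₀ ℕ, ∃ a, φ a = coeff d (gSeries F) ∧
      (d.degree < n - 1 → algebraMap A K a = coeff d (gSeries G)) := by
    intro d
    by_cases hd : d.degree < n - 1
    · obtain ⟨a, h1, h2⟩ := h (d + (Finsupp.single 0 1 + Finsupp.single 1 1)) (by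
        simp only [map_add, Finsupp.degree_single]; omega)
      exact ⟨-a, by rw [map_neg, h2, coeff_gSeries], fun _ => by rw [map_neg, h1, coeff_gSeries]⟩
    · obtain ⟨a, ha⟩ := hφ (coeff d (gSeries F))
      exact ⟨a, ha, fun h => absurd h hd⟩
  obtain ⟨q, hq⟩ : ∃ q : MvPowerSeries (Fin 2) A, ∀ d, φ (coeff d q) = coeff d (gSeries F) ∧
      (d.degree < n - 1 → algebraMap A K (coeff d q) = coeff d (gSeries G)) := by
    choose q hq using h1
    exact ⟨q, hq⟩
  refine ⟨q, ?_, ?_⟩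
  · ext d; rw [coeff_map]; exact (hq d).1
  · rw [← ofQuot_gSeries G, ofQuot, ofQuot, sub_sub_sub_cancel_left, ← mul_sub]
    have h3 : map (algebraMap A K) q - gSeries G ∈ orderIdeal (Fin 2) K (n - 1) := by
      intro d hd
      rw [map_sub, coeff_map, sub_eq_zero]
      exact (hq d).2 hd
    have h4 : (X 0 * X 1 : MvPowerSeries (Fin 2) K) ∈ orderIdeal (Fin 2) K 2 :=
      mul_mem_orderIdeal le_rfl (mem_orderIdeal_one.2 (constantCoeff_X _))
        (mem_orderIdeal_one.2 (constantCoeff_X _))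
    exact mul_mem_orderIdeal (by omega) h4 h3

theorem IsLog.add {K : Type*} [CommRing K] {l : PowerSeries K} (h : IsLog l) {n : ℕ} (hn : 1 ≤ n)
    (c : K) : IsLog (l + PowerSeries.C c * PowerSeries.X ^ (n + 1)) where
  constantCoeff := by simp [h.constantCoeff]
  coeff_one := by
    rw [map_add, h.coeff_one, PowerSeries.coeff_C_mul, PowerSeries.coeff_X_pow, if_neg (by omega),
      mul_zero, add_zero]

/-- With `G` the old law and `E` the proposed correction, the new logarithm takes at `G + E` the
value `l(G) + E + c (X + Y) ^ (n + 1)`, modulo degree `n + 2`. By the choice of `E` this is the sum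
of its values at `X` and `Y`; the inverse of the logarithm then gives the claim. -/
theorem IsLog.formalGroup_add_sub_mem {l : PowerSeries K} (h : IsLog l) {n : ℕ} (hn : 1 ≤ n)
    (c : K) : (h.add hn c).formalGroup.toPowerSeries - (h.formalGroup.toPowerSeries +
      C c * (X 0 ^ (n + 1) + X 1 ^ (n + 1) - (X 0 + X 1) ^ (n + 1))) ∈
        orderIdeal (Fin 2) K (n + 2) := by
  set l' := l + PowerSeries.C c * PowerSeries.X ^ (n + 1) with hl'
  set h' := h.add hn c
  have h0 := constantCoeff_X (R := K) (0 : Fin 2)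
  have h1 := constantCoeff_X (R := K) (1 : Fin 2)
  set G := h.sum (X 0 : MvPowerSeries (Fin 2) K) (X 1) with hG
  have hG0 : G.constantCoeff = 0 := h.constantCoeff_sum h0 h1
  set E : MvPowerSeries (Fin 2) K := C c * (X 0 ^ (n + 1) + X 1 ^ (n + 1) - (X 0 + X 1) ^ (n + 1))
    with hE
  have hE1 : E ∈ orderIdeal (Fin 2) K (n + 1) :=
    Ideal.mul_mem_left _ _ (sub_mem (add_mem (pow_mem_orderIdeal h0 _) (pow_mem_orderIdeal h1 _))
      (pow_mem_orderIdeal (by rw [map_add, h0, h1, add_zero]) _))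
  have hE0 : E.constantCoeff = 0 := mem_orderIdeal_one.1 (orderIdeal_anti (by omega) hE1)
  have hGE : (G + E).constantCoeff = 0 := by rw [map_add, hG0, hE0, add_zero]
  have hsub : ∀ {a : MvPowerSeries (Fin 2) K}, a.constantCoeff = 0 →
      PowerSeries.subst a l' = PowerSeries.subst a l + C c * a ^ (n + 1) := by
    intro a ha
    have hs := hasSubst_of_constantCoeff ha
    rw [hl', PowerSeries.subst_add hs, PowerSeries.subst_mul hs, PowerSeries.subst_pow hs,
      PowerSeries.subst_X hs, PowerSeries.subst_C]
  have key : PowerSeries.subst (G + E) l' - (PowerSeries.subst (X 0) l' +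
      PowerSeries.subst (X 1) l') ∈ orderIdeal (Fin 2) K (n + 2) := by
    have k1 : PowerSeries.subst (G + E) l - PowerSeries.subst G l - E ∈
        orderIdeal (Fin 2) K (n + 2) := by
      have k2 : ∀ m, PowerSeries.coeff m (l - PowerSeries.X) = if m < 2 then 0 else
          PowerSeries.coeff m l := by
        intro m
        rw [map_sub, PowerSeries.coeff_X]
        split_ifs with e1 e2 e2
        · rw [e1, h.coeff_one, sub_self]
        · omega
        · obtain rfl : m = 0 := by omega
          rw [PowerSeries.coeff_zero_eq_constantCoeff, h.constantCoeff, sub_zero]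
        · rw [sub_zero]
      -- Writing `l = X + X ^ 2 r` shows that the nonlinear part of `l(G + E) - l(G)` gains one more
      -- degree than `E`.
      obtain ⟨r, hr⟩ : (PowerSeries.X : PowerSeries K) ^ 2 ∣ l - PowerSeries.X :=
        PowerSeries.X_pow_dvd_iff.2 fun m hm => by rw [k2, if_pos hm]
      have k3 : ∀ {a : MvPowerSeries (Fin 2) K}, a.constantCoeff = 0 →
          PowerSeries.subst a l = a + a ^ 2 * PowerSeries.subst a r := by
        intro a ha
        have hs := hasSubst_of_constantCoeff ha
        rw [← sub_add_cancel l PowerSeries.X, hr, PowerSeries.subst_add hs,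
          PowerSeries.subst_mul hs, PowerSeries.subst_pow hs, PowerSeries.subst_X hs, add_comm]
      rw [k3 hGE, k3 hG0]
      have e : G + E + (G + E) ^ 2 * PowerSeries.subst (G + E) r -
          (G + G ^ 2 * PowerSeries.subst G r) - E = (E * (G + (G + E))) * PowerSeries.subst (G + E) r
            + (PowerSeries.subst (G + E) r - PowerSeries.subst G r) * G ^ 2 := by ring
      rw [e]
      refine add_mem (Ideal.mul_mem_right _ _ (mul_mem_orderIdeal (n := 1) (by omega) hE1
        (mem_orderIdeal_one.2 (by rw [map_add, hG0, hGE, add_zero])))) ?_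
      exact mul_mem_orderIdeal (by omega) (psubst_sub_mem_right hGE hG0 (m := n + 1)
        (by rwa [add_sub_cancel_left]) r) (pow_mem_orderIdeal hG0 2)
    have k4 : (G + E) ^ (n + 1) - (X 0 + X 1) ^ (n + 1) ∈ orderIdeal (Fin 2) K (n + 2) := by
      refine pow_sub_pow_mem_orderIdeal hGE ?_ _
      have := add_mem (h.sum_sub_mem h0 h1) (orderIdeal_anti (by omega) hE1)
      rwa [← hG, sub_add_eq_add_sub] at this
    rw [hsub hGE, hsub h0, hsub h1]
    have := add_mem k1 (Ideal.mul_mem_left _ (C c) k4)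
    refine (congrArg (· ∈ orderIdeal (Fin 2) K (n + 2)) ?_).mp this
    rw [hG, h.log_sum h0 h1, ← hG, hE]
    ring
  have := psubst_sub_mem_right (constantCoeff_psubst hGE h'.constantCoeff)
    (h'.constantCoeff_add h0 h1) key h'.inv
  rw [h'.subst_inv hGE] at this
  have h3 := neg_mem this
  rwa [neg_sub] at h3

theorem coeff_pow_add_pow_sub (n : ℕ) (d : Fin 2 →₀ ℕ) (h0 : 0 < d 0) (h1 : 0 < d 1)
    (hd : d 0 + d 1 = n) :
    coeff d (X 0 ^ n + X 1 ^ n - (X 0 + X 1) ^ n : MvPowerSeries (Fin 2) K) =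
      -((n.choose (d 0) : ℕ) : K) := by
  classical
  have e : (X 0 + X 1 : MvPowerSeries (Fin 2) K) ^ n =
      binaryForm (fun i => ((n.choose i : ℕ) : K)) n (X 0) (X 1) := by
    rw [add_pow, binaryForm]
    refine Finset.sum_congr rfl fun i _ => ?_
    rw [map_natCast, mul_comm]
  rw [e, map_sub, map_add, coeff_binaryForm, degree_fin_two, if_pos hd, X_pow_eq, X_pow_eq,
    coeff_monomial, coeff_monomial, if_neg, if_neg]
  · simp
  · intro h; rw [h] at h0; simp at h0
  · intro h; rw [h] at h1; simp at h1

/-- The difference in degree `n + 1` between `G` and an integral lift `g` of `F` is a symmetric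
cocycle modulo the image of `ker φ`, because `g` reduces to the commutative and associative law `F`.
The comparison lemma makes it a multiple of the binomial cocycle, which a change of the logarithm in
degree `n + 1` removes. -/
theorem exists_log_step (hφ : Function.Surjective φ)
    (F : FormalGroup R) [F.IsComm] {l : PowerSeries K} (hl : IsLog l) {n : ℕ} (hn : 1 ≤ n)
    (h : ∀ d, d.degree ≤ n → LiftsAt φ hl.formalGroup F d) :
    ∃ c : K, ∀ d, d.degree ≤ n + 1 → LiftsAt φ (hl.add hn c).formalGroup F d := by
  obtain ⟨q, hq1, hq2⟩ := exists_lift_quot hφ h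
  set G := hl.formalGroup with hGdef
  set g := ofQuot q with hg
  have hmapg : map φ g = F.toPowerSeries := by rw [hg, map_ofQuot, hq1, ofQuot_gSeries]
  -- The cocycle takes its values in `K ⧸ J`: an error in `J` can be moved into the lift `g` without
  -- changing its reduction.
  set J : AddSubgroup K := (RingHom.ker φ).toAddSubgroup.map (algebraMap A K : A →+ K) with hJ
  have memJ : ∀ a, φ a = 0 → algebraMap A K a ∈ J := fun a ha => ⟨a, ha, rfl⟩
  let e : ℕ → Fin 2 →₀ ℕ := fun i => Finsupp.single 0 i + Finsupp.single 1 (n + 1 - i)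
  let k : ℕ → K := fun i => coeff (e i) (G.toPowerSeries - map (algebraMap A K) g)
  have he : ∀ d : Fin 2 →₀ ℕ, d.degree = n + 1 → d = e (d 0) := by
    intro d hd
    rw [degree_fin_two] at hd
    rw [show e (d 0) = Finsupp.single 0 (d 0) + Finsupp.single 1 (n + 1 - d 0) from rfl,
      ← hd, Nat.add_sub_cancel_left, ← eq_single_add_single]
  have hg' : ofQuot (map (algebraMap A K) q) = map (algebraMap A K) g := (map_ofQuot _ q).symm
  have hk := sub_binaryForm_mem hq2 (h := k) fun d hd => by
    rw [hg']; exact congrArg (fun d => coeff d _) (he d hd)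
  have hsymm : ∀ i j, i + j = n + 1 → k i - k j ∈ J := by
    intro i j hij
    have e1 : e i = Finsupp.single 0 i + Finsupp.single 1 j := by
      simp only [e]; congr 2; omega
    have e2 : e j = Finsupp.single 0 j + Finsupp.single 1 i := by
      simp only [e]; congr 2; omega
    have h1 : k i - k j = algebraMap A K (coeff (e j) g - coeff (e i) g) := by
      simp only [k, map_sub, coeff_map]
      rw [e1, e2, coeff_swap G i j]; ring
    rw [h1]
    refine memJ _ ?_
    rw [map_sub, ← coeff_map, ← coeff_map, hmapg, e1, e2, coeff_swap F, sub_self]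
  have hrel : ∀ i j r, 0 < i → 0 < j → 0 < r → i + j + r = n + 1 →
      (i + j).choose i • k (i + j) - (j + r).choose j • k i ∈ J := by
    intro i j r hi hj hr hijr
    have c0 := constantCoeff_X (0 : Fin 3) (R := K)
    have c1 := constantCoeff_X (1 : Fin 3) (R := K)
    have c2 := constantCoeff_X (2 : Fin 3) (R := K)
    have h1 := associator_add_mem G _ (by omega) hq2 hk c0 c1 c2 (exponent i j r)
      (by rw [degree_exponent]; omega)
    rw [hg', ← psAssociator, ← map_psAssociator (constantCoeff_ofQuot q), map_add, map_sub, map_sub, map_add, ← hijr, coeff_binaryForm_add_left,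
      coeff_binaryForm_add_right, coeff_binaryForm_left _ _ _ _ _ hr,
      coeff_binaryForm_right _ _ _ _ _ hi, coeff_map] at h1
    have h2 : (i + j).choose i • k (i + j) - (j + r).choose j • k i =
        algebraMap A K (-coeff (exponent i j r) (psAssociator g)) := by
      rw [map_neg]; linear_combination h1
    rw [h2]
    refine memJ _ ?_
    rw [map_neg, ← coeff_map, map_psAssociator (constantCoeff_ofQuot q), hmapg, psAssociator, F.assoc, sub_self, map_zero, neg_zero]
  have hcoc : IsSymmCocycle (n + 1) fun i => (QuotientAddGroup.mk (k i) : K ⧸ J) := by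
    refine ⟨fun i j _ _ hij => ?_, fun i j r hi hj hr hijr => ?_⟩
    · rw [QuotientAddGroup.eq_iff_sub_mem]; exact hsymm i j hij
    · rw [← QuotientAddGroup.mk_nsmul, ← QuotientAddGroup.mk_nsmul,
        QuotientAddGroup.eq_iff_sub_mem]
      exact hrel i j r hi hj hr hijr
  obtain ⟨m, hm, hmn, c', hc'⟩ := hcoc.exists_eq_smul (by omega)
  obtain ⟨c, rfl⟩ := QuotientAddGroup.mk_surjective c'
  -- The new logarithm subtracts `(n + 1).choose i * c / m` from the coefficient, which is the given
  -- multiple of `c` since `m` divides the binomial coefficients. What remains is the coefficient of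
  -- `g` plus an element of `J`.
  refine ⟨c / m, fun d hd => ?_⟩
  have hmem := hl.formalGroup_add_sub_mem hn (c / m) d (by omega)
  rw [map_sub, sub_eq_zero] at hmem
  by_cases hd' : d.degree ≤ n
  · obtain ⟨a, h1, h2⟩ := h d hd'
    refine ⟨a, ?_, h2⟩
    rw [h1, hmem, map_add]
    have h0 := constantCoeff_X (R := K) (0 : Fin 2)
    have h1 := constantCoeff_X (R := K) (1 : Fin 2)
    have hE1 : C (c / m) * (X 0 ^ (n + 1) + X 1 ^ (n + 1) - (X 0 + X 1) ^ (n + 1)) ∈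
        orderIdeal (Fin 2) K (n + 1) :=
      Ideal.mul_mem_left _ _ (sub_mem (add_mem (pow_mem_orderIdeal h0 _) (pow_mem_orderIdeal h1 _))
        (pow_mem_orderIdeal (by rw [map_add, h0, h1, add_zero]) _))
    rw [hE1 d (by omega), add_zero]
  by_cases h0 : d 0 = 0
  · exact LiftsAt.of_axis (Or.inl h0)
  by_cases h1 : d 1 = 0
  · exact LiftsAt.of_axis (Or.inr h1)
  have hdeg := degree_fin_two d
  have h2 := hc' (d 0) (by omega) (by omega)
  rw [← QuotientAddGroup.mk_nsmul, QuotientAddGroup.eq_iff_sub_mem] at h2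
  obtain ⟨a, ha, ha'⟩ := h2
  refine ⟨coeff d g + a, ?_, ?_⟩
  · rw [map_add (algebraMap A K)]
    have h3 : coeff d (G.toPowerSeries - map (algebraMap A K) g) = k (d 0) :=
      congrArg (fun d => coeff d _) (he d (by omega))
    have h4 : algebraMap A K a = k (d 0) - ((n + 1).choose (d 0) / m) • c := ha'
    rw [map_sub, coeff_map] at h3
    rw [hmem, map_add, coeff_C_mul, coeff_pow_add_pow_sub _ d (by omega) (by omega) (by omega),
      h4, ← h3, nsmul_eq_mul, Nat.cast_div (hmn _ (by omega) (by omega))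
        (Nat.cast_ne_zero.2 hm.ne')]
    ring
  · have h5 : φ a = 0 := ha
    rw [map_add, h5, add_zero, ← coeff_map, hmapg]

/-- Lazard's theorem: a commutative formal group law lifts along a surjective homomorphism from a
subring of a field of characteristic zero. -/
theorem exists_map_eq (hφ : Function.Surjective φ) (hinj : Function.Injective (algebraMap A K))
    (F : FormalGroup R) [F.IsComm] : ∃ G : FormalGroup A, G.IsComm ∧ G.map φ = F := by
  -- Stage `n` is a logarithm whose law lifts `F` up to degree `n + 1`. At stage `0` the logarithm
  -- `X` suffices, as all exponents of degree at most `1` lie on an axis.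
  let S : ℕ → Type _ := fun n => {l : PowerSeries K // ∃ hl : IsLog l,
    ∀ d, d.degree ≤ n + 1 → LiftsAt φ hl.formalGroup F d}
  have hX : IsLog (PowerSeries.X : PowerSeries K) := ⟨by simp, by simp⟩
  let s0 : S 0 := ⟨PowerSeries.X, hX, fun d hd => LiftsAt.of_axis (by
    have := degree_fin_two d; omega)⟩
  have hstep : ∀ n (l : S n), ∃ l' : S (n + 1), ∃ c : K,
      l'.1 = l.1 + PowerSeries.C c * PowerSeries.X ^ (n + 2) := by
    rintro n ⟨l, hl, hd⟩
    obtain ⟨c, hc⟩ := exists_log_step hφ F hl (by omega : 1 ≤ n + 1) hd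
    exact ⟨⟨_, hl.add (by omega) c, hc⟩, c, rfl⟩
  choose next hnext using hstep
  let s : ∀ n, S n := fun n => Nat.rec s0 next n
  have hs : ∀ n, ∃ c, (s (n + 1)).1 = (s n).1 + PowerSeries.C c * PowerSeries.X ^ (n + 2) :=
    fun n => hnext n (s n)
  have hcoeff : ∀ m n, m ≤ n + 1 → ∀ r, PowerSeries.coeff m (s (n + r)).1 =
      PowerSeries.coeff m (s n).1 := by
    intro m n hmn r
    induction r with
    | zero => rfl
    | succ r ih =>
      obtain ⟨c, hc⟩ := hs (n + r)
      rw [← add_assoc, hc, map_add, ih, PowerSeries.coeff_C_mul, PowerSeries.coeff_X_pow,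
        if_neg (by omega), mul_zero, add_zero]
  -- Passing from stage `n` to `n + 1` changes only the coefficient of degree `n + 2`, so the stages
  -- converge and this diagonal is the limit.
  let l : PowerSeries K := PowerSeries.mk fun m => PowerSeries.coeff m (s m).1
  have hl : ∀ m n, m ≤ n + 1 → PowerSeries.coeff m l = PowerSeries.coeff m (s n).1 := by
    intro m n hmn
    rw [PowerSeries.coeff_mk]
    rcases Nat.le_total m n with h | h
    · obtain ⟨r, rfl⟩ := Nat.exists_eq_add_of_le h
      exact (hcoeff m m (by omega) r).symm
    · obtain ⟨r, rfl⟩ := Nat.exists_eq_add_of_le h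
      exact hcoeff _ _ hmn r
  have hlog : IsLog l := by
    refine ⟨?_, ?_⟩
    · rw [← PowerSeries.coeff_zero_eq_constantCoeff_apply, hl 0 0 (by omega)]; simp [s, s0]
    · rw [hl 1 0 (by omega)]; simp [s, s0]
  have hlift : ∀ d, LiftsAt φ hlog.formalGroup F d := by
    intro d
    obtain ⟨hn, hd⟩ := (s d.degree).2
    obtain ⟨a, h1, h2⟩ := hd d (by omega)
    refine ⟨a, ?_, h2⟩
    rw [h1]
    have h0 := constantCoeff_X (R := K) (0 : Fin 2)
    have h1 := constantCoeff_X (R := K) (1 : Fin 2)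
    have key : ∀ {a : MvPowerSeries (Fin 2) K}, a.constantCoeff = 0 →
        PowerSeries.subst a l - PowerSeries.subst a (s d.degree).1 ∈
          orderIdeal (Fin 2) K (d.degree + 2) :=
      fun ha => psubst_sub_mem_left ha fun m hm => hl m _ (by omega)
    have hsum := hlog.constantCoeff_sum h0 h1
    have k1 := key hsum
    have k2 := add_mem (key h0) (key h1)
    rw [hlog.log_sum h0 h1] at k1
    have k3 := psubst_sub_mem_right (constantCoeff_psubst hsum hn.constantCoeff)
      (hn.constantCoeff_add h0 h1) (m := d.degree + 2) (by
        have := sub_mem k2 k1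
        refine (congrArg (· ∈ orderIdeal (Fin 2) K (d.degree + 2)) ?_).mp this
        ring) hn.inv
    rw [hn.subst_inv hsum] at k3
    have := k3 d (by omega)
    rw [map_sub, sub_eq_zero] at this
    exact this.symm
  choose a ha1 ha2 using hlift
  let g : MvPowerSeries (Fin 2) A := a
  have hcg : ∀ d, coeff d g = a d := fun _ => rfl
  have hgK : map (algebraMap A K) g = hlog.formalGroup.toPowerSeries := by
    ext d; rw [coeff_map, hcg, ha1]
  have hgR : map φ g = F.toPowerSeries := by ext d; rw [coeff_map, hcg, ha2]
  -- The axioms of a formal group law over `A` are checked in `K`, where they hold for the law of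
  -- the limit logarithm.
  have hmap : ∀ {σ : Type} {p q : MvPowerSeries σ A}, map (algebraMap A K) p =
      map (algebraMap A K) q → p = q := fun h => by
    ext d
    have := congrArg (coeff d) h
    rw [coeff_map, coeff_map] at this
    exact hinj this
  have hg0 : g.constantCoeff = 0 := hinj (by
    rw [← constantCoeff_map, hgK, hlog.formalGroup.zero_constantCoeff, map_zero])
  let G : FormalGroup A :=
    { toPowerSeries := g
      zero_constantCoeff := hg0
      lin_coeff_X := hinj (by rw [← coeff_map, hgK, hlog.formalGroup.lin_coeff_X, map_one])
      lin_coeff_Y := hinj (by rw [← coeff_map, hgK, hlog.formalGroup.lin_coeff_Y, map_one])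
      assoc := sub_eq_zero.1 (hmap (by
        refine (map_psAssociator hg0).trans ?_
        rw [hgK, psAssociator, hlog.formalGroup.assoc, sub_self, map_zero])) }
  refine ⟨G, ⟨hmap ?_⟩, FormalGroup.ext hgR⟩
  change map _ g = map _ (subst ![X 1, X 0] g)
  rw [map_subst HasSubst.X_X, hgK]
  conv_lhs => rw [FormalGroup.IsComm.comm (F := hlog.formalGroup)]
  congr 1
  funext s; fin_cases s <;> simp

end Lift

/-- Every commutative formal group law is the image of one over a polynomial ring over `ℤ`. -/
theorem exists_formalGroup_map_eq {R : Type*} [CommRing R] (F : FormalGroup R) [F.IsComm] :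
    ∃ (G : FormalGroup (MvPolynomial R ℤ)) (φ : MvPolynomial R ℤ →+* R),
      G.IsComm ∧ Function.Surjective φ ∧ G.map φ = F := by
  let φ : MvPolynomial R ℤ →+* R := (MvPolynomial.aeval (id : R → R) : MvPolynomial R ℤ →ₐ[ℤ] R)
  have hφ : Function.Surjective φ := fun r => ⟨MvPolynomial.X r, MvPolynomial.aeval_X _ _⟩
  have : CharZero (FractionRing (MvPolynomial R ℤ)) :=
    charZero_of_injective_algebraMap (IsFractionRing.injective (MvPolynomial R ℤ) _)
  obtain ⟨G, h1, h2⟩ := exists_map_eq (K := FractionRing (MvPolynomial R ℤ)) hφ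
    (IsFractionRing.injective _ _) F
  exact ⟨G, φ, h1, hφ, h2⟩

end

/-! ### Coordinates: the formal group ring as a power series ring. -/

noncomputable section

open MvPowerSeries FormalGroupRing

section PowerSeriesTopology

/-- Power series over `R` with the topology of coefficientwise stabilization. -/
def DiscreteSeries (σ R : Type*) := MvPowerSeries σ R

variable (σ R : Type*) [CommRing R]

instance : CommRing (DiscreteSeries σ R) := inferInstanceAs (CommRing (MvPowerSeries σ R))
instance : Algebra R (DiscreteSeries σ R) := inferInstanceAs (Algebra R (MvPowerSeries σ R))

open MvPowerSeries.WithPiTopology in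
instance : UniformSpace (DiscreteSeries σ R) :=
  letI : UniformSpace R := ⊥
  inferInstanceAs (UniformSpace (MvPowerSeries σ R))

open MvPowerSeries.WithPiTopology in
instance : IsUniformAddGroup (DiscreteSeries σ R) :=
  letI : UniformSpace R := ⊥
  inferInstanceAs (IsUniformAddGroup (MvPowerSeries σ R))

open MvPowerSeries.WithPiTopology in
instance : IsTopologicalRing (DiscreteSeries σ R) :=
  letI : UniformSpace R := ⊥
  inferInstanceAs (IsTopologicalRing (MvPowerSeries σ R))

open MvPowerSeries.WithPiTopology in
instance : IsLinearTopology (DiscreteSeries σ R) (DiscreteSeries σ R) :=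
  letI : UniformSpace R := ⊥
  inferInstanceAs (IsLinearTopology (MvPowerSeries σ R) (MvPowerSeries σ R))

open MvPowerSeries.WithPiTopology in
instance : CompleteSpace (DiscreteSeries σ R) :=
  letI : UniformSpace R := ⊥
  inferInstanceAs (CompleteSpace (MvPowerSeries σ R))

open MvPowerSeries.WithPiTopology in
instance : T2Space (DiscreteSeries σ R) :=
  letI : UniformSpace R := ⊥
  inferInstanceAs (T2Space (MvPowerSeries σ R))

/-- The constant coefficient. -/
def DiscreteSeries.aug : DiscreteSeries σ R →ₐ[R] R :=
  { (constantCoeff : MvPowerSeries σ R →+* R) with commutes' := fun r => constantCoeff_C r }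

/-- The variable of index `s`. -/
def DiscreteSeries.X (s : σ) : DiscreteSeries σ R := (MvPowerSeries.X s : MvPowerSeries σ R)

theorem DiscreteSeries.aug_X (s : σ) : DiscreteSeries.aug σ R (DiscreteSeries.X σ R s) = 0 :=
  constantCoeff_X s

open MvPowerSeries.WithPiTopology in
theorem DiscreteSeries.isClosed_ker_aug :
    IsClosed (RingHom.ker (DiscreteSeries.aug σ R) : Set (DiscreteSeries σ R)) := by
  let _ : UniformSpace R := ⊥
  have : T1Space R := inferInstance
  exact (isClosed_singleton (x := (0 : R))).preimage
    (continuous_constantCoeff R : Continuous (constantCoeff : MvPowerSeries σ R →+* R))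

open MvPowerSeries.WithPiTopology in
theorem DiscreteSeries.isTopNil_aug : IsTopNil (RingHom.ker (DiscreteSeries.aug σ R)) where
  isClosed := DiscreteSeries.isClosed_ker_aug σ R
  pow_le U hU := by
    let _ : UniformSpace R := ⊥
    let V : Set ((σ →₀ ℕ) → R) := U
    have hU' : V ∈ 𝓝 (0 : (σ →₀ ℕ) → R) := hU
    rw [nhds_pi, Filter.mem_pi'] at hU'
    obtain ⟨T, t, ht, hT⟩ := hU'
    -- A basic neighbourhood of `0` restricts only the coefficients in the finite set `T`, all of
    -- which vanish once the order exceeds their degrees.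
    refine ⟨T.sup Finsupp.degree + 1, fun f hf => hT fun d hd => ?_⟩
    have h1 : ∀ n, (RingHom.ker (DiscreteSeries.aug σ R)) ^ n ≤
        (orderIdeal σ R n : Ideal (MvPowerSeries σ R)) := by
      intro n
      induction n with
      | zero => exact fun g _ => mem_orderIdeal_zero _
      | succ n ih =>
        rw [pow_succ]
        exact Ideal.mul_le.2 fun a ha c hc => mul_mem_orderIdeal le_rfl (ih ha)
          (mem_orderIdeal_one.2 hc)
    have h2 : (coeff d (f : MvPowerSeries σ R)) = 0 :=
      h1 _ hf d (Nat.lt_succ_of_le (Finset.le_sup (f := Finsupp.degree) hd))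
    have h3 : (f : (σ →₀ ℕ) → R) d = 0 := h2
    change (f : (σ →₀ ℕ) → R) d ∈ t d
    rw [h3]
    exact mem_of_mem_nhds (ht d)

variable {σ R}

theorem DiscreteSeries.evalPS_X_eq [Finite σ] (f : MvPowerSeries σ R) :
    evalPS (DiscreteSeries.X σ R) f = f :=
  (congrFun (MvPowerSeries.subst_self (σ := σ) (R := R)) f)

end PowerSeriesTopology

section Inverse

variable {R : Type*} [CommRing R] {σ : Type*}

/-- The formal inverse solves `b = -a + a b g(a, b)`. The factor `a` makes the right side a
contraction in `b` for the order filtration, so the iterates from `0` converge. -/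
theorem exists_subst_eq_zero (F : FormalGroup R) [F.IsComm] {a : MvPowerSeries σ R}
    (ha : a.constantCoeff = 0) :
    ∃ b : MvPowerSeries σ R, b.constantCoeff = 0 ∧ subst ![a, b] F.toPowerSeries = 0 := by
  let Φ : MvPowerSeries σ R → MvPowerSeries σ R := fun b => -a + a * b * subst ![a, b] (gSeries F)
  let B : ℕ → MvPowerSeries σ R := fun k => Φ^[k] 0
  have hB : ∀ k, B (k + 1) = Φ (B k) := fun k => Function.iterate_succ_apply' _ _ _
  have hB0 : ∀ k, (B k).constantCoeff = 0 := by
    intro k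
    cases k with
    | zero => exact map_zero _
    | succ k => rw [hB]; simp [Φ, ha]
  have key : ∀ {b c : MvPowerSeries σ R} {k : ℕ}, b.constantCoeff = 0 → c.constantCoeff = 0 →
      b - c ∈ orderIdeal σ R k → Φ b - Φ c ∈ orderIdeal σ R (k + 1) := by
    intro b c k hb hc h
    have h1 : subst ![a, b] (gSeries F) - subst ![a, c] (gSeries F) ∈ orderIdeal σ R k := by
      refine subst_sub_subst_mem_right (constantCoeff_cons ha hb) (constantCoeff_cons ha hc) ?_ _
      intro s; fin_cases s
      · simp
      · exact h
    have h2 : Φ b - Φ c = a * ((b - c) * subst ![a, b] (gSeries F) +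
        c * (subst ![a, b] (gSeries F) - subst ![a, c] (gSeries F))) := by
      simp only [Φ]; ring
    rw [h2]
    refine mul_mem_orderIdeal (m := 1) (n := k) (by omega) (mem_orderIdeal_one.2 ha) ?_
    exact Ideal.add_mem _ (Ideal.mul_mem_right _ _ h) (Ideal.mul_mem_left _ _ h1)
  have hstep : ∀ k, B (k + 1) - B k ∈ orderIdeal σ R k := by
    intro k
    induction k with
    | zero => exact mem_orderIdeal_zero _
    | succ k ih => rw [hB (k + 1)]; nth_rw 2 [hB k]; exact key (hB0 _) (hB0 _) ih
  have hle : ∀ k j, B (k + j) - B k ∈ orderIdeal σ R k := by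
    intro k j
    induction j with
    | zero => simp
    | succ j ih =>
      have : B (k + (j + 1)) - B k = (B (k + j + 1) - B (k + j)) + (B (k + j) - B k) := by
        rw [add_assoc]; ring
      rw [this]
      exact Ideal.add_mem _ (orderIdeal_anti (Nat.le_add_right _ _) (hstep (k + j))) ih
  -- From the iterate with index `deg d + 1` on, the coefficient at `d` no longer changes.
  let b : MvPowerSeries σ R := fun d => coeff d (B (d.degree + 1))
  have hb : ∀ k, b - B k ∈ orderIdeal σ R k := by
    intro k d hd
    obtain ⟨j, rfl⟩ := Nat.exists_eq_add_of_le (Nat.succ_le_of_lt hd)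
    have h1 := hle (d.degree + 1) j d (Nat.lt_succ_self _)
    rw [map_sub, sub_eq_zero] at h1 ⊢
    exact h1.symm
  have hb0 : b.constantCoeff = 0 := by
    have h1 := mem_orderIdeal_one.1 (hb 1)
    rwa [map_sub, hB0, sub_zero] at h1
  have hfix : b = Φ b := by
    rw [← sub_eq_zero]
    ext d
    have h1 : b - Φ b ∈ orderIdeal σ R (d.degree + 1) := by
      have h2 : b - Φ b = (b - B (d.degree + 1)) - (Φ b - Φ (B d.degree)) := by rw [hB]; ring
      rw [h2]
      exact Ideal.sub_mem _ (hb _) (key hb0 (hB0 _) (hb _))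
    exact h1 d (Nat.lt_succ_self _)
  refine ⟨b, hb0, ?_⟩
  have h1 := evalPS_toPowerSeries (F := F) (A := DiscreteSeries σ R) (a := ![a, b])
    ((DiscreteSeries.isTopNil_aug σ R).hasEval (constantCoeff_cons ha hb0))
  refine h1.trans ?_
  have h2 : b = -a + a * b * subst ![a, b] (gSeries F) := hfix
  change a + b - a * b * subst ![a, b] (gSeries F) = 0
  linear_combination h2

end Inverse

section Coordinates

/-- The points of a formal group law carry only a monoid structure here. A homomorphism from a group
lands in the invertible elements, where linearity over `ℤ` is available. -/
theorem AddMonoidHom.basis_ext {M P σ : Type*} [AddCommGroup M] [AddCommMonoid P]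
    (e : Module.Basis σ ℤ M) {f g : M →+ P} (h : ∀ i, f (e i) = g (e i)) : f = g := by
  have h1 : (f.toHomAddUnits).toIntLinearMap = (g.toHomAddUnits).toIntLinearMap :=
    e.ext fun i => AddUnits.ext (h i)
  ext m
  exact congrArg AddUnits.val (DFunLike.congr_fun h1 m)

variable {R : Type*} [CommRing R] (F : FormalGroup R) [F.IsComm] {M : Type*} [AddCommGroup M]
  {σ : Type*} [Finite σ] (e : Module.Basis σ ℤ M)

/-- The variable of index `s` as an invertible point of the formal group law. -/
def DiscreteSeries.unitX (s : σ) : AddUnits (Point F (DiscreteSeries.isTopNil_aug σ R)) :=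
  let h := exists_subst_eq_zero F (constantCoeff_X (R := R) s)
  { val := ⟨DiscreteSeries.X σ R s, DiscreteSeries.aug_X σ R s⟩
    neg := ⟨h.choose, h.choose_spec.1⟩
    val_neg := Subtype.ext h.choose_spec.2
    neg_val := (add_comm _ _).trans (Subtype.ext h.choose_spec.2) }

/-- The homomorphism from `M` to points of `F` that maps the basis of `M` to the variables. -/
def coordPoint : M →+ Point F (DiscreteSeries.isTopNil_aug σ R) :=
  (AddUnits.coeHom _).comp (e.constr ℤ (DiscreteSeries.unitX F)).toAddMonoidHom

/-- The homomorphism `R⟦M⟧_F → R⟦x_σ⟧` attached to a basis of `M`. -/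
def coordHom : FGRing F M →ₐ[R] DiscreteSeries σ R := lift (coordPoint F e)

theorem continuous_coordHom : Continuous (coordHom F e) := continuous_lift _

theorem coordHom_x (μ : M) : coordHom F e (x F μ) = (coordPoint F e μ).1 := lift_x _ μ

theorem coordHom_x_basis (s : σ) : coordHom F e (x F (e s)) = DiscreteSeries.X σ R s := by
  rw [coordHom_x]
  have : e.constr ℤ (DiscreteSeries.unitX F) (e s) = DiscreteSeries.unitX F s :=
    e.constr_basis ℤ _ s
  exact congrArg (fun z => (AddUnits.val z).1) this

theorem hasEval_basis : MvPowerSeries.HasEval fun s => x F (e s) :=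
  (isTopNil_aug F M).hasEval fun s => x_mem F (e s)

/-- The inverse of `coordHom`. -/
def coordInv : DiscreteSeries σ R →ₐ[R] FGRing F M := evalHom (hasEval_basis F e)

open MvPowerSeries.WithPiTopology in
theorem continuous_coordInv : Continuous (coordInv F e) := by
  let _ : UniformSpace R := ⊥
  have : ContinuousSMul R (FGRing F M) := continuousSMul_bot
  exact MvPowerSeries.continuous_aeval (hasEval_basis F e)

theorem coordInv_X (s : σ) : coordInv F e (DiscreteSeries.X σ R s) = x F (e s) :=
  (evalHom_apply _ _).trans (evalPS_X _ s)

/-- The coordinates on `R⟦M⟧_F` attached to a basis of `M`. -/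
def coordEquiv : FGRing F M ≃ₐ[R] DiscreteSeries σ R :=
  AlgEquiv.ofAlgHom (coordHom F e) (coordInv F e)
    (AlgHom.ext fun f => by
      rw [AlgHom.comp_apply]
      refine ((congrArg _ (evalHom_apply _ _)).trans
        (map_evalPS (continuous_coordHom F e) (hasEval_basis F e) _)).trans ?_
      simp only [coordHom_x_basis]
      exact DiscreteSeries.evalPS_X_eq f)
    (hom_ext ((continuous_coordInv F e).comp (continuous_coordHom F e)) continuous_id fun μ => by
      have haug : ∀ f ∈ RingHom.ker (DiscreteSeries.aug σ R),
          coordInv F e f ∈ RingHom.ker (aug F M) := by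
        intro f hf
        have := (isTopNil_aug F M).evalPS_mem (a := fun s => x F (e s)) (fun s => x_mem F (e s))
          (f := f) hf
        exact (evalHom_apply (hasEval_basis F e) f).symm ▸ this
      -- The composite is compared with the identity on all `x_μ` as an equality of homomorphisms
      -- from `M` to points, so it is enough to look at the basis.
      have h : (Point.map (coordInv F e) (continuous_coordInv F e) haug).comp (coordPoint F e) =
          xHom F := AddMonoidHom.basis_ext e fun s => Subtype.ext (by
        change coordInv F e (coordPoint F e (e s)).1 = x F (e s)
        rw [← coordHom_x, coordHom_x_basis, coordInv_X])
      have h1 := congrArg Subtype.val (DFunLike.congr_fun h μ)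
      rw [AlgHom.comp_apply, coordHom_x]
      exact h1)

theorem coordEquiv_apply (u : FGRing F M) : coordEquiv F e u = coordHom F e u := rfl

theorem aug_coordHom (u : FGRing F M) : DiscreteSeries.aug σ R (coordHom F e u) = aug F M u := by
  let _ : UniformSpace R := ⊥
  have h : (DiscreteSeries.aug σ R).comp (coordHom F e) = aug F M := by
    refine hom_ext ?_ (continuous_aug F M) fun μ => ?_
    · have hc : Continuous (DiscreteSeries.aug σ R) :=
        MvPowerSeries.WithPiTopology.continuous_constantCoeff R
      exact hc.comp (continuous_coordHom F e)
    · rw [AlgHom.comp_apply, coordHom_x, aug_x]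
      exact (coordPoint F e μ).2
  exact DFunLike.congr_fun h u

end Coordinates

end

/-! ### Primitive vectors, regular elements and prime elements. -/

noncomputable section

open MvPowerSeries FormalGroupRing

section IntegralLattice

variable {M : Type*} [AddCommGroup M] [Module.Finite ℤ M] [Module.Free ℤ M]

/-- A vector on which some functional is `1` belongs to a basis. -/
theorem exists_basis_apply_eq {ν : M} {c : M →+ ℤ} (h : c ν = 1) :
    ∃ (n : ℕ) (e : Module.Basis (Unit ⊕ Fin n) ℤ M), e (Sum.inl ()) = ν := by
  let K : Submodule ℤ M := LinearMap.ker c.toIntLinearMap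
  let eK : Module.Basis (Fin (Module.finrank ℤ K)) ℤ K := Module.finBasis ℤ K
  let Ψ : (ℤ × K) ≃ₗ[ℤ] M :=
    { toFun := fun p => p.1 • ν + p.2
      map_add' := fun p q => by simp only [Prod.fst_add, Prod.snd_add, add_smul, Submodule.coe_add]; abel
      map_smul' := fun a p => by simp [mul_smul, smul_add]
      invFun := fun m => (c m, ⟨m - c m • ν, by
        change c (m - c m • ν) = 0
        rw [map_sub, map_zsmul, h]; simp⟩)
      left_inv := fun p => by
        have hp : c (p.2 : M) = 0 := p.2.2
        have h1 : c (p.1 • ν + p.2) = p.1 := by rw [map_add, map_zsmul, h, hp]; simp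
        refine Prod.ext h1 (Subtype.ext ?_)
        change p.1 • ν + p.2 - c (p.1 • ν + p.2) • ν = p.2
        rw [h1]; abel
      right_inv := fun m => by
        change c m • ν + (m - c m • ν) = m
        abel }
  refine ⟨_, ((Module.Basis.singleton Unit ℤ).prod eK).map Ψ, ?_⟩
  rw [Module.Basis.map_apply]
  have : ((Module.Basis.singleton Unit ℤ).prod eK) (Sum.inl ()) = ((1 : ℤ), (0 : K)) :=
    Prod.ext (by simp) (by simp)
  rw [this]
  change (1 : ℤ) • ν + ((0 : K) : M) = ν
  simp

/-- A nonzero map of lattices is divisible by an integer `d` and has a value that is `d` times a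
primitive vector. -/
theorem exists_primitive_value {M' : Type*} [AddCommGroup M'] (A : M' →+ M) (hA : A ≠ 0) :
    ∃ (d : ℕ) (μ : M') (ν : M) (c : M →+ ℤ), 0 < d ∧ A μ = d • ν ∧ c ν = 1 ∧
      ∀ μ', ∃ ν', A μ' = d • ν' := by
  classical
  have e : Module.Basis _ ℤ M := Module.finBasis ℤ M
  let co : Fin (Module.finrank ℤ M) → M →+ ℤ := fun i => (e.coord i).toAddMonoidHom
  have hdiv : ∀ (d : ℤ) (m : M), (∀ i, d ∣ co i m) → ∃ ν, m = d • ν := by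
    intro d m h
    choose k hk using h
    refine ⟨∑ i, k i • e i, ?_⟩
    rw [← e.sum_repr m, Finset.smul_sum]
    refine Finset.sum_congr rfl fun i _ => ?_
    rw [smul_smul, ← hk i]; rfl
  -- The number `d` is the least positive value of the pairing `c (A μ)`. Division with remainder in
  -- either argument shows that it divides the values sharing `c` or `μ` with a minimal pair.
  have hex : ∃ n : ℕ, 0 < n ∧ ∃ (c : M →+ ℤ) (μ : M'), c (A μ) = n := by
    obtain ⟨μ, hμ⟩ : ∃ μ, A μ ≠ 0 := by
      by_contra! h
      exact hA (AddMonoidHom.ext h)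
    obtain ⟨i, hi⟩ : ∃ i, co i (A μ) ≠ 0 := by
      by_contra! h
      exact hμ (e.ext_elem fun i => (h i).trans (by simp))
    rcases lt_or_gt_of_ne hi with h | h
    · refine ⟨(co i (A μ)).natAbs, Int.natAbs_pos.2 hi, co i, -μ, ?_⟩
      rw [map_neg, map_neg]; omega
    · refine ⟨(co i (A μ)).natAbs, Int.natAbs_pos.2 hi, co i, μ, ?_⟩
      omega
  obtain ⟨hd, c, μ, hc⟩ := Nat.find_spec hex
  set d := Nat.find hex with hdef
  have hd' : (0 : ℤ) < d := by exact_mod_cast hd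
  have hmin : ∀ (c : M →+ ℤ) (μ : M'), 0 ≤ c (A μ) → c (A μ) < d → c (A μ) = 0 := by
    intro c μ h0 h1
    by_contra hne
    have h2 := Nat.find_min' hex (m := (c (A μ)).toNat) ⟨by omega, c, μ, by omega⟩
    omega
  have hright : ∀ (c : M →+ ℤ) (μ : M'), c (A μ) = d → ∀ μ', (d : ℤ) ∣ c (A μ') := by
    intro c μ hc μ'
    have h1 : c (A (μ' - (c (A μ') / d) • μ)) = c (A μ') % d := by
      rw [map_sub, map_zsmul, map_sub, map_zsmul, hc, smul_eq_mul, Int.emod_def]; ring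
    have h2 := hmin c _ (h1 ▸ Int.emod_nonneg _ hd'.ne') (h1 ▸ Int.emod_lt_of_pos _ hd')
    exact Int.dvd_of_emod_eq_zero (h1 ▸ h2)
  have hleft : ∀ c' : M →+ ℤ, (d : ℤ) ∣ c' (A μ) := by
    intro c'
    have h1 : (c' - (c' (A μ) / d) • c) (A μ) = c' (A μ) % d := by
      rw [AddMonoidHom.sub_apply, AddMonoidHom.smul_apply, hc, smul_eq_mul, Int.emod_def]; ring
    have h2 := hmin (c' - (c' (A μ) / d) • c) μ (h1 ▸ Int.emod_nonneg _ hd'.ne')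
      (h1 ▸ Int.emod_lt_of_pos _ hd')
    exact Int.dvd_of_emod_eq_zero (h1 ▸ h2)
  -- The functional `c' - j • c` vanishes at `A μ`, so adding it to `c` gives another functional
  -- with the minimal value `d` there. Divisibility for both functionals yields it for `c'`.
  have hall : ∀ (c' : M →+ ℤ) (μ' : M'), (d : ℤ) ∣ c' (A μ') := by
    intro c' μ'
    obtain ⟨j, hj⟩ := hleft c'
    have h1 : (c + (c' - j • c)) (A μ) = d := by
      rw [AddMonoidHom.add_apply, AddMonoidHom.sub_apply, AddMonoidHom.smul_apply, hc, hj,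
        smul_eq_mul]; ring
    have h2 := hright _ _ h1 μ'
    have h3 := hright c μ hc μ'
    rw [AddMonoidHom.add_apply, AddMonoidHom.sub_apply, AddMonoidHom.smul_apply, smul_eq_mul] at h2
    have h4 : c' (A μ') = (c (A μ') + (c' (A μ') - j * c (A μ'))) - c (A μ') + j * c (A μ') := by
      ring
    rw [h4]
    exact dvd_add (dvd_sub h2 h3) (Dvd.dvd.mul_left h3 _)
  obtain ⟨ν, hν⟩ := hdiv d (A μ) fun i => hall _ μ
  refine ⟨d, μ, ν, c, hd, by rw [hν]; exact natCast_zsmul _ _, ?_, fun μ' => ?_⟩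
  · rw [hν, map_zsmul, smul_eq_mul] at hc
    exact mul_left_cancel₀ hd'.ne' (hc.trans (mul_one _).symm)
  · obtain ⟨ν', hν'⟩ := hdiv d (A μ') fun i => hall _ μ'
    exact ⟨ν', by rw [hν']; exact natCast_zsmul _ _⟩

end IntegralLattice

section MaximalIdeal

variable {σ R : Type*} [Fintype σ] [CommRing R]

/-- Each nonconstant monomial is assigned to one variable that occurs in it; collecting by variables
writes the series as a finite sum of multiples of the variables. -/
theorem ker_constantCoeff_le : RingHom.ker (constantCoeff : MvPowerSeries σ R →+* R) ≤
    Ideal.span (Set.range (X : σ → MvPowerSeries σ R)) := by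
  classical
  intro f hf
  have hs : ∀ d : σ →₀ ℕ, d ≠ 0 → ∃ s, d s ≠ 0 := fun d hd => Finsupp.ne_iff.1 hd
  let ch : (σ →₀ ℕ) → Option σ := fun d => if h : d ≠ 0 then some (hs d h).choose else none
  have hch : ∀ d s, ch d = some s → d s ≠ 0 := by
    intro d s h
    by_cases h0 : d ≠ 0
    · simp only [ch, dif_pos h0, Option.some.injEq] at h
      exact h ▸ (hs d h0).choose_spec
    · simp [ch, h0] at h
  let g : σ → MvPowerSeries σ R := fun s d =>
    if ch (d + Finsupp.single s 1) = some s then coeff (d + Finsupp.single s 1) f else 0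
  have h1 : f = ∑ s, g s * X s := by
    ext d
    rw [map_sum]
    have h2 : ∀ s, coeff d (g s * X s) = if ch d = some s then coeff d f else 0 := by
      intro s
      rw [X, coeff_mul_monomial, mul_one]
      split_ifs with h3 h4 h4
      · have h5 : d - Finsupp.single s 1 + Finsupp.single s 1 = d := tsub_add_cancel_of_le h3
        change (if ch (d - Finsupp.single s 1 + Finsupp.single s 1) = some s then
          coeff (d - Finsupp.single s 1 + Finsupp.single s 1) f else 0) = _
        rw [h5, if_pos h4]
      · have h5 : d - Finsupp.single s 1 + Finsupp.single s 1 = d := tsub_add_cancel_of_le h3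
        change (if ch (d - Finsupp.single s 1 + Finsupp.single s 1) = some s then
          coeff (d - Finsupp.single s 1 + Finsupp.single s 1) f else 0) = _
        rw [h5, if_neg h4]
      · refine absurd ?_ h3
        rw [Finsupp.single_le_iff]
        exact Nat.one_le_iff_ne_zero.2 (hch d s h4)
      · rfl
    simp only [h2]
    by_cases h0 : d = 0
    · subst h0
      have : coeff 0 f = 0 := hf
      simp [this]
    · have : ch d = some (hs d h0).choose := by simp only [ch, dif_pos (show d ≠ 0 from h0)]
      simp [this]
  rw [h1]
  exact Ideal.sum_mem _ fun s _ => Ideal.mul_mem_left _ _ (Ideal.subset_span ⟨s, rfl⟩)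

end MaximalIdeal

section Regular

variable {R : Type*} [CommRing R] (F : FormalGroup R) [F.IsComm] {M : Type*} [AddCommGroup M]

section

variable [Module.Finite ℤ M] [Module.Free ℤ M]

theorem ker_aug_le : RingHom.ker (aug F M) ≤ Ideal.span (Set.range (x F (M := M))) := by
  intro u hu
  let e := Module.finBasis ℤ M
  have h1 : coordHom F e u ∈ RingHom.ker (constantCoeff : MvPowerSeries _ R →+* R) :=
    (aug_coordHom F e u).trans hu
  have h2 := Ideal.mem_map_of_mem (coordInv F e).toRingHom (ker_constantCoeff_le h1)
  have h3 : coordInv F e (coordHom F e u) = u := (coordEquiv F e).symm_apply_apply u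
  have h4 : u ∈ Ideal.map (coordInv F e).toRingHom
      (Ideal.span (Set.range (DiscreteSeries.X _ R))) := h3 ▸ h2
  rw [Ideal.map_span] at h4
  refine Ideal.span_mono ?_ h4
  rintro _ ⟨_, ⟨s, rfl⟩, rfl⟩
  exact ⟨e s, (coordInv_X F e s).symm⟩

variable {F}

theorem isRegular_of_aug {u : FGRing F M} (h : IsRegular (aug F M u)) : IsRegular u := by
  let e := Module.finBasis ℤ M
  have h1 : (coordHom F e u : MvPowerSeries _ R) ∈ nonZeroDivisors (MvPowerSeries _ R) := by
    refine mem_nonZeroDivisors_of_constantCoeff ?_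
    have : constantCoeff (coordHom F e u : MvPowerSeries _ R) = aug F M u := aug_coordHom F e u
    rw [this]
    exact h.mem_nonZeroDivisors
  have h2 : IsRegular (coordEquiv F e u) :=
    isRegular_iff_mem_nonZeroDivisors.2 h1
  rw [isRegular_iff_mem_nonZeroDivisors] at h2 ⊢
  refine mem_nonZeroDivisors_iff_right.2 fun z hz => ?_
  have h3 := (mem_nonZeroDivisors_iff_right.1 h2) (coordEquiv F e z)
    (by rw [← map_mul, hz, map_zero])
  exact (coordEquiv F e).injective (h3.trans (map_zero _).symm)

/-- In coordinates given by a basis containing `ν`, this element is a variable. -/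
theorem isRegular_x_of_apply_eq_one {ν : M} {c : M →+ ℤ} (h : c ν = 1) : IsRegular (x F ν) := by
  obtain ⟨n, e, he⟩ := exists_basis_apply_eq h
  have h2 : IsRegular (coordEquiv F e (x F ν)) := by
    rw [coordEquiv_apply, ← he, coordHom_x_basis]
    exact isRegular_iff_mem_nonZeroDivisors.2 X_mem_nonzeroDivisors
  rw [isRegular_iff_mem_nonZeroDivisors] at h2 ⊢
  refine mem_nonZeroDivisors_iff_right.2 fun z hz => ?_
  have h3 := (mem_nonZeroDivisors_iff_right.1 h2) (coordEquiv F e z)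
    (by rw [← map_mul, hz, map_zero])
  exact (coordEquiv F e).injective (h3.trans (map_zero _).symm)

instance [IsDomain R] : IsDomain (FGRing F M) :=
  haveI : IsDomain (MvPowerSeries (Fin (Module.finrank ℤ M)) R) := NoZeroDivisors.to_isDomain _
  haveI : IsDomain (DiscreteSeries (Fin (Module.finrank ℤ M)) R) := this
  Function.Injective.isDomain ((coordEquiv F (Module.finBasis ℤ M)).toAlgHom.toRingHom :
    FGRing F M →+* DiscreteSeries (Fin (Module.finrank ℤ M)) R)
    (coordEquiv F (Module.finBasis ℤ M)).injective

end

theorem x_add_eq (μ ν : M) : x F (μ + ν) =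
    x F μ + x F ν - x F μ * x F ν * evalPS ![x F μ, x F ν] (gSeries F) := by
  exact (x_add F μ ν).trans (evalPS_toPowerSeries (Point.hasEval_two (xHom F μ) (xHom F ν)))

theorem exists_x_nsmul (d : ℕ) (ν : M) : ∃ v, aug F M v = d ∧ x F (d • ν) = x F ν * v := by
  induction d with
  | zero => exact ⟨0, by simp, by rw [zero_smul, x_zero, mul_zero]⟩
  | succ d ih =>
    obtain ⟨v, hv, h⟩ := ih
    refine ⟨v + 1 - v * x F ν * evalPS ![x F (d • ν), x F ν] (gSeries F), ?_, ?_⟩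
    · simp [hv, aug_x]
    · rw [succ_nsmul, x_add_eq, h]; ring

variable {F} in
theorem isRegular_x_nsmul [Module.Finite ℤ M] [Module.Free ℤ M] {ν : M} {c : M →+ ℤ}
    (h : c ν = 1) {d : ℕ} (hd : IsRegular (d : R)) : IsRegular (x F (d • ν)) := by
  obtain ⟨v, hv, h1⟩ := exists_x_nsmul F d ν
  rw [h1]
  exact (isRegular_x_of_apply_eq_one h).mul (isRegular_of_aug (hv ▸ hd))

variable {F} in
theorem isRegular_x_add_sub_x [Module.Finite ℤ M] [Module.Free ℤ M] {ν δ : M}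
    (h : IsRegular (x F δ)) : IsRegular (x F (ν + δ) - x F ν) := by
  have h1 : x F (ν + δ) - x F ν = x F δ * (1 - x F ν * evalPS ![x F ν, x F δ] (gSeries F)) := by
    rw [x_add_eq]; ring
  rw [h1]
  refine h.mul (isRegular_of_aug ?_)
  simp [aug_x, isRegular_one]

/-- `ε(Δ_α(x_μ)) = c(μ)`. -/
theorem aug_demazure_x (α : M) (c : M →+ ℤ) (μ : M) : aug F M (demazure F α c (x F μ)) = c μ := by
  -- Modulo the augmentation ideal, the coefficient of `η` is additive on points: the real parts and
  -- `x_α` have augmentation `0`, so products contribute nothing. It is `1` on `η` and `0` on the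
  -- `x_μ`.
  let Λ : Point F ((isTopNil_aug F M).twisted (x_mem F α)) →+ R :=
    { toFun := fun z => aug F M z.1.im
      map_zero' := map_zero (aug F M)
      map_add' := fun z w => by
        have h1 : aug F M z.1.re = 0 := z.2
        have h2 : aug F M w.1.re = 0 := w.2
        rw [Point.add_val, evalPS_toPowerSeries (Point.hasEval_two z w)]
        change aug F M (z.1 + w.1 - z.1 * w.1 * _).im = _
        rw [sub_eq_add_neg, Twisted.im_add, Twisted.im_add, ← neg_mul, Twisted.im_mul, ← neg_mul,
          Twisted.im_mul, Twisted.re_mul]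
        have h3 : ∀ z : Twisted (x F α), (-z).re = -z.re := fun z => rfl
        simp [h1, h2, h3, aug_x] }
  have h1 : Λ (demazurePoint F α c μ) = -c μ := by
    have h2 : demazurePoint F α c μ = Point.map (Twisted.incl R (x F α)) Twisted.continuous_incl
      (fun _ h => h) (xHom F μ) + (((-c μ) • etaUnit F α : AddUnits _) :
        Point F ((isTopNil_aug F M).twisted (x_mem F α))) := rfl
    rw [h2, map_add]
    have h3 : Λ (Point.map (Twisted.incl R (x F α)) Twisted.continuous_incl
      (fun _ h => h) (xHom F μ)) = 0 := map_zero (aug F M)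
    have h4 : Λ (((-c μ) • etaUnit F α : AddUnits _)) =
        ((AddUnits.map Λ ((-c μ) • etaUnit F α) : AddUnits R) : R) := rfl
    have h5 : AddUnits.map Λ (etaUnit F α) = toAddUnits (1 : R) :=
      AddUnits.ext (map_one (aug F M))
    rw [h3, h4, map_zsmul, h5, ← map_zsmul]
    simp
  have h2 : aug F M (demazureHom F α c (x F μ)).im = -c μ := by
    rw [← h1]
    exact congrArg (fun z => aug F M (Twisted.im z)) (lift_x (demazurePoint F α c) μ)
  rw [demazureHom_apply, Twisted.im_mk, map_neg, neg_inj] at h2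
  exact h2

section CharZero

variable [Module.Finite ℤ M] [Module.Free ℤ M] [CharZero R]
variable {F}

/-- The operator for `α = 0` and a coordinate functional `c` returns, after augmentation, the
coordinate `c(μ)` in `R`, which characteristic zero allows to read off. -/
theorem x_eq_zero_iff {μ : M} : x F μ = 0 ↔ μ = 0 := by
  refine ⟨fun h => ?_, fun h => by rw [h, x_zero]⟩
  refine (Module.finBasis ℤ M).ext_elem fun i => ?_
  have h1 := aug_demazure_x F (0 : M) ((Module.finBasis ℤ M).coord i).toAddMonoidHom μ
  rw [h, map_zero, map_zero] at h1
  have h2 : ((Module.finBasis ℤ M).coord i) μ = 0 := by exact_mod_cast h1.symm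
  simpa using h2

variable [IsDomain R] {γ : M} {c : M →+ ℤ}

/-- When `c γ = 1`, the map `μ ↦ μ - c(μ) γ` is a projection that kills `γ`, and the identity `x_γ
Δ(u) = u - s(u)` identifies the kernel of the induced map with the multiples of `x_γ`. -/
theorem x_dvd_iff (h : c γ = 1) (u : FGRing F M) :
    x F γ ∣ u ↔ mapHom F (reflHom γ c) u = 0 := by
  constructor
  · rintro ⟨v, rfl⟩
    rw [map_mul, mapHom_x]
    change x F (γ - c γ • γ) * _ = 0
    rw [h, one_smul, sub_self, x_zero, zero_mul]
  · intro hu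
    exact ⟨demazure F γ c u, by rw [x_mul_demazure, hu, sub_zero]⟩

theorem x_dvd_x_iff (h : c γ = 1) (μ : M) : x F γ ∣ x F μ ↔ μ = c μ • γ := by
  rw [x_dvd_iff h, mapHom_x, x_eq_zero_iff]
  exact sub_eq_zero

/-- The multiples of `x_γ` form the kernel of an endomorphism of a domain. -/
theorem prime_x (h : c γ = 1) : Prime (x F γ) := by
  refine ⟨?_, ?_, ?_⟩
  · rw [Ne, x_eq_zero_iff]
    rintro rfl
    simp at h
  · intro hu
    have := hu.map (aug F M)
    rw [aug_x] at this
    exact not_isUnit_zero this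
  · intro a b hab
    rw [x_dvd_iff h] at hab
    rw [map_mul, mul_eq_zero] at hab
    rwa [x_dvd_iff h, x_dvd_iff h]

end CharZero

end Regular

end

/-! ### Lengths and inversions in the Weyl group. -/

noncomputable section

namespace FormalGroupRing

section Weyl

open RootPairing

variable {ι M N : Type*} [AddCommGroup M] [AddCommGroup N] {P : RootDatum ι M N}

theorem root_smul (w : P.weylGroup) (i : ι) : P.root (w • i) = w • P.root i :=
  (weylGroup_apply_root P w i).symm

theorem ofIdx_smul_root (i : ι) (m : M) :
    weylGroup.ofIdx P i • m = m - P.coroot' i m • P.root i := rfl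

theorem ofIdx_smul_index (i j : ι) : weylGroup.ofIdx P i • j = P.reflectionPerm i j := by
  refine P.root.injective ?_
  rw [root_smul, P.root_reflectionPerm]
  rfl

theorem weylGroup_ext {w v : P.weylGroup} (h : ∀ m : M, w • m = v • m) : w = v :=
  Subtype.ext (RootPairing.Equiv.weightHom_injective P (LinearEquiv.ext h))

theorem ofIdx_mul_self (i : ι) : weylGroup.ofIdx P i * weylGroup.ofIdx P i = 1 := by
  refine weylGroup_ext fun m => ?_
  rw [mul_smul, one_smul]
  exact P.reflection_same i m

theorem ofIdx_inv (i : ι) : (weylGroup.ofIdx P i)⁻¹ = weylGroup.ofIdx P i :=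
  inv_eq_of_mul_eq_one_left (ofIdx_mul_self i)

theorem coroot'_smul [Finite ι] (w : P.weylGroup) (i : ι) (m : M) :
    P.coroot' (w • i) (w • m) = P.coroot' i m := by
  obtain ⟨w, hw⟩ := w
  induction hw using weylGroup.induction generalizing i m with
  | mem j =>
    change P.coroot' (weylGroup.ofIdx P j • i) (weylGroup.ofIdx P j • m) = _
    rw [ofIdx_smul_index]
    exact (P.coroot'_reflection _).symm.trans (congrArg (P.coroot' i) (P.reflection_same j m))
  | one => rfl
  | mul g₁ g₂ h₁ h₂ ih₁ ih₂ =>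
    rw [← Submonoid.mk_mul_mk _ _ _ h₁ h₂]
    rw [show ∀ (a b : P.weylGroup), (a * b) • i = a • b • i from fun a b => mul_smul a b i]
    exact (ih₁ _ _).trans (ih₂ _ _)

theorem ofIdx_smul_eq [Finite ι] (w : P.weylGroup) (i : ι) :
    weylGroup.ofIdx P (w • i) = w * weylGroup.ofIdx P i * w⁻¹ := by
  refine weylGroup_ext fun m => ?_
  have h := coroot'_smul w i (w⁻¹ • m)
  rw [smul_inv_smul] at h
  rw [ofIdx_smul_root, h, mul_smul, mul_smul, ofIdx_smul_root, smul_sub, smul_inv_smul, root_smul]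
  congr 1
  exact (smul_comm _ _ _)


variable [Finite ι] [P.IsReduced] (b : P.Base)

theorem wordProd_nil : wordProd b [] = 1 := rfl

theorem wordProd_cons (i : b.support) (l : List b.support) :
    wordProd b (i :: l) = weylGroup.ofIdx P i * wordProd b l := rfl

theorem wordProd_append (l l' : List b.support) :
    wordProd b (l ++ l') = wordProd b l * wordProd b l' := by
  induction l with
  | nil => rw [wordProd_nil, one_mul, List.nil_append]
  | cons i l ih => rw [List.cons_append, wordProd_cons, ih, wordProd_cons, mul_assoc]

/-- The index `weylGroup.ofIdx P i • i` serves throughout as the negative of `i`. -/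
theorem root_neg_index (i : ι) : P.root (weylGroup.ofIdx P i • i) = -P.root i := by
  rw [ofIdx_smul_index, P.root_reflectionPerm, P.reflection_apply_self]

theorem isPos_neg_index (i : ι) : b.IsPos (weylGroup.ofIdx P i • i) ↔ ¬ b.IsPos i := by
  rw [ofIdx_smul_index]
  exact Base.IsPos.neg_iff_not b i

theorem smul_neg_index (w : P.weylGroup) (i : ι) :
    w • weylGroup.ofIdx P i • i = weylGroup.ofIdx P (w • i) • w • i := by
  rw [ofIdx_smul_eq, ← mul_smul, ← mul_smul, inv_mul_cancel_right]

theorem ofIdx_neg_index (i : ι) :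
    weylGroup.ofIdx P (weylGroup.ofIdx P i • i) = weylGroup.ofIdx P i := by
  rw [ofIdx_smul_eq, mul_inv_cancel_right]

variable {b}

theorem isPos_simple_smul {i : ι} (hi : b.IsPos i) {j : b.support} (hij : i ≠ j) :
    b.IsPos (weylGroup.ofIdx P (j : ι) • i) := by
  rw [ofIdx_smul_index]
  exact hi.reflectionPerm j.2 hij

variable (b)

theorem exists_wordProd_smul_eq (i : ι) : ∃ (l : List b.support) (j : b.support),
    i = wordProd b l • (j : ι) := by
  refine Base.induction_reflect (b := b) i (p := fun i => ∃ (l : List b.support) (j : b.support),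
    i = wordProd b l • (j : ι)) ?_ ?_ ?_
  · rintro i ⟨l, j, rfl⟩
    refine ⟨l ++ [j], j, ?_⟩
    rw [wordProd_append, wordProd_cons, wordProd_nil, mul_one, mul_smul, smul_neg_index,
      ofIdx_smul_index]
  · intro i hi
    exact ⟨[], ⟨i, hi⟩, (one_smul _ _).symm⟩
  · rintro i k ⟨l, j, rfl⟩ hk
    refine ⟨⟨k, hk⟩ :: l, j, ?_⟩
    rw [wordProd_cons, mul_smul, ofIdx_smul_index]

theorem exists_wordProd_inv (l : List b.support) : ∃ l', wordProd b l' = (wordProd b l)⁻¹ := by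
  refine ⟨l.reverse, ?_⟩
  induction l with
  | nil => simp [wordProd_nil]
  | cons i l ih =>
    rw [List.reverse_cons, wordProd_append, ih, wordProd_cons, wordProd_cons, wordProd_nil, mul_one,
      mul_inv_rev, ofIdx_inv]

theorem exists_wordProd_eq (w : P.weylGroup) : ∃ l, wordProd b l = w := by
  obtain ⟨w, hw⟩ := w
  induction hw using weylGroup.induction with
  | mem i =>
    obtain ⟨l, j, rfl⟩ := exists_wordProd_smul_eq b i
    obtain ⟨l', hl'⟩ := exists_wordProd_inv b l
    refine ⟨l ++ ([j] ++ l'), ?_⟩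
    rw [wordProd_append, wordProd_append, hl', wordProd_cons, wordProd_nil, mul_one, ← mul_assoc]
    exact (ofIdx_smul_eq _ _).symm
  | one => exact ⟨[], rfl⟩
  | mul g₁ g₂ h₁ h₂ ih₁ ih₂ =>
    obtain ⟨l₁, h1⟩ := ih₁
    obtain ⟨l₂, h2⟩ := ih₂
    refine ⟨l₁ ++ l₂, ?_⟩
    rw [wordProd_append, h1, h2]; rfl

/-- The length of an element of the Weyl group. -/
def weylLength (w : P.weylGroup) : ℕ := sInf {n | ∃ l, wordProd b l = w ∧ l.length = n}

theorem weylLength_le (l : List b.support) : weylLength b (wordProd b l) ≤ l.length :=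
  Nat.sInf_le ⟨l, rfl, rfl⟩

theorem exists_length_eq (w : P.weylGroup) : ∃ l, wordProd b l = w ∧ l.length = weylLength b w := by
  obtain ⟨l, hl⟩ := exists_wordProd_eq b w
  exact Nat.sInf_mem (s := {n | ∃ l, wordProd b l = w ∧ l.length = n}) ⟨_, l, hl, rfl⟩

variable {b}

theorem isReducedWord_iff {l : List b.support} {w : P.weylGroup} :
    IsReducedWord b l w ↔ wordProd b l = w ∧ l.length = weylLength b w := by
  constructor
  · rintro ⟨rfl, h⟩
    obtain ⟨l', h1, h2⟩ := exists_length_eq b (wordProd b l)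
    exact ⟨rfl, le_antisymm (h2 ▸ h l' h1) (weylLength_le b l)⟩
  · rintro ⟨rfl, h⟩
    exact ⟨rfl, fun l' hl' => h.trans_le (hl' ▸ weylLength_le b l')⟩

/-- If `β` is positive and `w⁻¹ β` is negative, then a letter can be deleted from a word for `w`,
giving a word for `s_β w`. -/
theorem exists_wordProd_eq_reflection_mul (l : List b.support) {β : ι} (hβ : b.IsPos β)
    (h : ¬ b.IsPos ((wordProd b l)⁻¹ • β)) :
    ∃ l', l'.length + 1 = l.length ∧ wordProd b l' = weylGroup.ofIdx P β * wordProd b l := by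
  induction l generalizing β with
  | nil => exact absurd (by rwa [wordProd_nil, inv_one, one_smul]) h
  | cons i l ih =>
    by_cases hi : β = i
    · subst hi
      exact ⟨l, rfl, by rw [wordProd_cons, ← mul_assoc, ofIdx_mul_self, one_mul]⟩
    · rw [wordProd_cons, mul_inv_rev, ofIdx_inv, mul_smul] at h
      obtain ⟨l', h1, h2⟩ := ih (isPos_simple_smul hβ hi) h
      refine ⟨i :: l', by simp [h1], ?_⟩
      rw [wordProd_cons, h2, ofIdx_smul_eq, ofIdx_inv, wordProd_cons]
      simp only [← mul_assoc]
      rw [ofIdx_mul_self, one_mul]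

theorem weylLength_reflection_mul_lt {w : P.weylGroup} {β : ι} (hβ : b.IsPos β)
    (h : ¬ b.IsPos (w⁻¹ • β)) : weylLength b (weylGroup.ofIdx P β * w) < weylLength b w := by
  obtain ⟨l, rfl, hl⟩ := exists_length_eq b w
  obtain ⟨l', h1, h2⟩ := exists_wordProd_eq_reflection_mul l hβ h
  rw [← h2, ← hl]
  have := weylLength_le b l'
  omega

theorem lt_weylLength_reflection_mul {w : P.weylGroup} {β : ι} (hβ : b.IsPos β)
    (h : b.IsPos (w⁻¹ • β)) : weylLength b w < weylLength b (weylGroup.ofIdx P β * w) := by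
  have h1 : ¬ b.IsPos ((weylGroup.ofIdx P β * w)⁻¹ • β) := by
    rw [mul_inv_rev, ofIdx_inv, mul_smul, smul_neg_index, isPos_neg_index]
    exact not_not_intro h
  have h2 := weylLength_reflection_mul_lt hβ h1
  rwa [← mul_assoc, ofIdx_mul_self, one_mul] at h2

theorem isPos_of_lt {w : P.weylGroup} {β : ι} (hβ : b.IsPos β)
    (h : weylLength b w < weylLength b (weylGroup.ofIdx P β * w)) : b.IsPos (w⁻¹ • β) := by
  by_contra h1
  exact absurd (weylLength_reflection_mul_lt hβ h1) (not_lt.2 h.le)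

theorem weylLength_simple_mul_le (i : b.support) (w : P.weylGroup) :
    weylLength b (weylGroup.ofIdx P (i : ι) * w) ≤ weylLength b w + 1 := by
  obtain ⟨l, rfl, hl⟩ := exists_length_eq b w
  exact (weylLength_le b (i :: l)).trans (by simp [hl])

variable (b) in
/-- The positive roots `β` such that `w⁻¹ β` is negative. -/
def inversions (w : P.weylGroup) : Set ι := {β | b.IsPos β ∧ ¬ b.IsPos (w⁻¹ • β)}

theorem inversions_one : inversions b (1 : P.weylGroup) = ∅ := by
  ext β
  simp only [inversions, inv_one, one_smul]
  simp

/-- A simple reflection permutes the positive roots other than its own root. When the length goes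
up, that root is the one new inversion. -/
theorem inversions_simple_mul {i : b.support} {w : P.weylGroup}
    (h : weylLength b w < weylLength b (weylGroup.ofIdx P (i : ι) * w)) :
    inversions b (weylGroup.ofIdx P (i : ι) * w) =
      insert (i : ι) ((weylGroup.ofIdx P (i : ι) • ·) '' inversions b w) := by
  have hi : b.IsPos i := Base.isPos_of_mem_support i.2
  have hw := isPos_of_lt hi h
  have key : ∀ β : ι, weylGroup.ofIdx P (i : ι) • weylGroup.ofIdx P (i : ι) • β = β := fun β => by
    rw [← mul_smul, ofIdx_mul_self, one_smul]
  ext β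
  simp only [inversions, Set.mem_ofPred_eq, mul_inv_rev, ofIdx_inv, mul_smul, Set.mem_insert_iff,
    Set.mem_image]
  constructor
  · rintro ⟨h1, h2⟩
    by_cases hβ : β = i
    · exact Or.inl hβ
    · exact Or.inr ⟨_, ⟨isPos_simple_smul h1 hβ, h2⟩, key β⟩
  · rintro (rfl | ⟨γ, ⟨h1, h2⟩, rfl⟩)
    · refine ⟨hi, ?_⟩
      rw [smul_neg_index, isPos_neg_index]
      exact not_not_intro hw
    · have hγ : γ ≠ i := by rintro rfl; exact h2 hw
      exact ⟨isPos_simple_smul h1 hγ, by rwa [key]⟩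

theorem simple_notMem_image {i : b.support} {w : P.weylGroup} :
    (i : ι) ∉ (weylGroup.ofIdx P (i : ι) • ·) '' inversions b w := by
  rintro ⟨γ, ⟨h1, -⟩, h⟩
  have hi : b.IsPos i := Base.isPos_of_mem_support i.2
  have h2 : γ = weylGroup.ofIdx P (i : ι) • (i : ι) := by
    refine Eq.trans ?_ (congrArg (weylGroup.ofIdx P (i : ι) • ·) h)
    change γ = weylGroup.ofIdx P (i : ι) • weylGroup.ofIdx P (i : ι) • γ
    rw [← mul_smul, ofIdx_mul_self, one_smul]
  rw [h2, isPos_neg_index] at h1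
  exact h1 hi

/-- In a reduced word the length increases at each letter. -/
theorem weylLength_lt_of_cons {i : b.support} {l : List b.support}
    (h : (i :: l).length = weylLength b (wordProd b (i :: l))) :
    l.length = weylLength b (wordProd b l) ∧
      weylLength b (wordProd b l) < weylLength b (weylGroup.ofIdx P (i : ι) * wordProd b l) := by
  have h1 := weylLength_le b l
  have h2 := weylLength_simple_mul_le i (wordProd b l)
  rw [wordProd_cons, List.length_cons] at h
  omega

theorem ncard_inversions (w : P.weylGroup) : (inversions b w).ncard = weylLength b w := by
  obtain ⟨l, rfl, hl⟩ := exists_length_eq b w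
  induction l with
  | nil =>
    rw [← hl, wordProd_nil, inversions_one]; simp
  | cons i l ih =>
    obtain ⟨h1, h2⟩ := weylLength_lt_of_cons hl
    rw [← hl, wordProd_cons, inversions_simple_mul h2, Set.ncard_insert_of_notMem
      simple_notMem_image (Set.toFinite _), Set.ncard_image_of_injective _ (MulAction.injective _),
      ih h1, ← h1, List.length_cons]

theorem eq_one_of_isPos {w : P.weylGroup} (h : ∀ β, b.IsPos β → b.IsPos (w⁻¹ • β)) : w = 1 := by
  have h1 : inversions b w = ∅ := by
    ext β
    simp only [inversions, Set.mem_ofPred_eq, Set.mem_empty_iff_false, iff_false, not_and, not_not]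
    exact h β
  have h2 := ncard_inversions (b := b) w
  rw [h1, Set.ncard_empty] at h2
  obtain ⟨l, rfl, hl⟩ := exists_length_eq b w
  rw [← h2, List.length_eq_zero_iff] at hl
  rw [hl, wordProd_nil]

-- An element fixing every root has no inversions, hence is `1`; so the action on the finite set of
-- roots is faithful.
variable (b) in
include b in
theorem finite_weylGroup : Finite P.weylGroup := by
  refine Finite.of_injective (fun w : P.weylGroup => fun i : ι => w • i) fun w v h => ?_
  have h1 : v⁻¹ * w = 1 := by
    refine eq_one_of_isPos (b := b) fun β hβ => ?_
    have h2 : w • (w⁻¹ • v • β) = v • (w⁻¹ • v • β) := congrFun h _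
    rw [smul_inv_smul] at h2
    rw [mul_inv_rev, inv_inv, mul_smul, ← smul_left_cancel v h2]
    exact hβ
  rwa [inv_mul_eq_one, eq_comm] at h1

/-- An element that maps the simple roots to negative roots maps all positive roots to negative
roots. -/
theorem not_isPos_smul {u : P.weylGroup} (h : ∀ i : b.support, ¬ b.IsPos (u • (i : ι))) {β : ι}
    (hβ : b.IsPos β) : ¬ b.IsPos (u • β) := by
  refine hβ.induction_on_add (p := fun β => ¬ b.IsPos (u • β)) (fun i hi => h ⟨i, hi⟩)
    fun i j k hk hi hj => ?_
  have hj' := h ⟨j, hj⟩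
  rw [← isPos_neg_index] at hi hj' ⊢
  refine hi.add hj' ?_
  rw [root_neg_index, root_neg_index, root_neg_index, root_smul, root_smul, root_smul, hk, smul_add,
    neg_add]

/-- Every reduced word extends to a reduced word of an element for which all positive roots are
inversions. -/
theorem exists_append_inversions_eq {l : List b.support}
    (hl : l.length = weylLength b (wordProd b l)) :
    ∃ l', (l ++ l').length = weylLength b (wordProd b (l ++ l')) ∧
      inversions b (wordProd b (l ++ l')) = {β | b.IsPos β} := by
  classical
  have hbound : ∀ l : List b.support, l.length = weylLength b (wordProd b l) →
      l.length ≤ (Set.univ : Set ι).ncard := fun l hl => by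
    rw [hl, ← ncard_inversions]
    exact Set.ncard_le_ncard (Set.subset_univ _) (Set.toFinite _)
  obtain ⟨n, hn⟩ : ∃ n, n + l.length = (Set.univ : Set ι).ncard :=
    ⟨_, Nat.sub_add_cancel (hbound l hl)⟩
  -- The induction is on the number of letters still possible: a reduced word is no longer than the
  -- number of roots.
  induction n using Nat.strong_induction_on generalizing l with
  | _ n ih =>
    by_cases hex : ∃ i : b.support, (l ++ [i]).length = weylLength b (wordProd b (l ++ [i]))
    · obtain ⟨i, hi⟩ := hex
      have h1 := hbound _ hi
      rw [List.length_append, List.length_singleton] at h1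
      obtain ⟨l', hl'⟩ := ih (n - 1) (by omega) hi
        (by rw [List.length_append, List.length_singleton]; omega)
      exact ⟨[i] ++ l', by rwa [← List.append_assoc]⟩
    · push Not at hex
      refine ⟨[], ?_⟩
      rw [List.append_nil]
      refine ⟨hl, ?_⟩
      -- If `w α_i` were positive, appending the letter `i` would lengthen the element and extend
      -- the reduced word.
      have hneg : ∀ i : b.support, ¬ b.IsPos (wordProd b l • (i : ι)) := by
        intro i hi
        have h1 : b.IsPos ((wordProd b l)⁻¹ • wordProd b l • (i : ι)) := by
          rw [inv_smul_smul]; exact Base.isPos_of_mem_support i.2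
        have h2 := lt_weylLength_reflection_mul hi h1
        rw [ofIdx_smul_eq, inv_mul_cancel_right] at h2
        refine hex i ?_
        have h3 := weylLength_le b (l ++ [i])
        have h4 : wordProd b (l ++ [i]) = wordProd b l * weylGroup.ofIdx P (i : ι) := by
          rw [wordProd_append, wordProd_cons, wordProd_nil, mul_one]
        rw [List.length_append, List.length_singleton, h4] at h3 ⊢
        omega
      ext β
      simp only [inversions, Set.mem_ofPred_eq, and_iff_left_iff_imp]
      intro hβ h1
      have h2 := not_isPos_smul hneg h1
      rw [smul_inv_smul] at h2
      exact h2 hβ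

theorem inversions_eq_of_isLongestWord {l : List b.support} (hl : IsLongestWord b l) :
    inversions b (wordProd b l) = {β | b.IsPos β} := by
  obtain ⟨l', h1, h2⟩ := exists_append_inversions_eq (b := b) (l := [])
    (Nat.le_zero.1 (weylLength_le b [])).symm
  have h3 := hl.2 _ (isReducedWord_iff.2 ⟨rfl, h1⟩)
  refine Set.eq_of_subset_of_ncard_le (fun β hβ => hβ.1) ?_ (Set.toFinite _)
  rw [← h2, ncard_inversions, ncard_inversions, ← h1, ← (isReducedWord_iff.1 hl.1).2]
  exact h3

theorem exists_append_isLongestWord {l : List b.support}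
    (hl : l.length = weylLength b (wordProd b l)) : ∃ l', IsLongestWord b (l ++ l') := by
  obtain ⟨l', h1, h2⟩ := exists_append_inversions_eq hl
  refine ⟨l', isReducedWord_iff.2 ⟨rfl, h1⟩, fun l'' hl'' => ?_⟩
  rw [h1, (isReducedWord_iff.1 hl'').2, ← ncard_inversions, ← ncard_inversions, h2]
  exact Set.ncard_le_ncard (fun β hβ => hβ.1) (Set.toFinite _)

theorem IsLongestWord.length_eq {l l' : List b.support} (h : IsLongestWord b l)
    (h' : IsLongestWord b l') : l.length = l'.length :=
  le_antisymm (h'.2 _ h.1) (h.2 _ h'.1)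

/-- Uniqueness of the longest element: two elements with all positive roots as inversions differ by
one that preserves the positive roots. -/
theorem IsLongestWord.wordProd_eq {l l' : List b.support} (h : IsLongestWord b l)
    (h' : IsLongestWord b l') : wordProd b l = wordProd b l' := by
  have h1 := inversions_eq_of_isLongestWord h
  have h2 := inversions_eq_of_isLongestWord h'
  rw [← inv_mul_eq_one]
  refine eq_one_of_isPos (b := b) fun β hβ => ?_
  by_contra h3
  rw [mul_inv_rev, inv_inv, mul_smul] at h3
  have h4 : β ∈ inversions b (wordProd b l) := h1 ▸ hβ
  have h5 : weylGroup.ofIdx P (wordProd b l • β) • wordProd b l • β ∈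
      inversions b (wordProd b l') := by
    rw [h2]
    change b.IsPos _
    rw [isPos_neg_index]
    intro h6
    have h7 : wordProd b l • β ∈ inversions b (wordProd b l) := h1 ▸ h6
    refine h7.2 ?_
    rw [inv_smul_smul]
    exact hβ
  have h6 := h5.2
  rw [smul_neg_index, isPos_neg_index, not_not] at h6
  exact h3 h6

end Weyl

end FormalGroupRing

end

/-! ### Divided differences as twisted combinations of Weyl group elements. -/

noncomputable section

namespace FormalGroupRing

open RootPairing

variable {ι M N : Type*} [AddCommGroup M] [AddCommGroup N]

/-- A commutative ring with an action of the Weyl group, regular elements `x_i` that are permuted by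
the Weyl group, and divided difference operators. -/
structure ReflectionFrame (P : RootDatum ι M N) (S : Type*) [CommRing S] where
  /-- The action of the Weyl group. -/
  act : P.weylGroup →* (S →+* S)
  /-- The elements attached to the roots. -/
  x : ι → S
  act_x : ∀ w i, act w (x i) = x (w • i)
  regular_x : ∀ i, IsRegular (x i)
  /-- The divided difference operators. -/
  del : ι → S → S
  x_mul_del : ∀ i u, x i * del i u = u - act (weylGroup.ofIdx P i) u

namespace ReflectionFrame

variable {P : RootDatum ι M N} {S : Type*} [CommRing S] (D : ReflectionFrame P S)

theorem act_inv_act (w : P.weylGroup) (u : S) : D.act w⁻¹ (D.act w u) = u := by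
  have h : (D.act w⁻¹ * D.act w) u = u := by rw [← map_mul, inv_mul_cancel, map_one]; rfl
  exact h

theorem act_act_inv (w : P.weylGroup) (u : S) : D.act w (D.act w⁻¹ u) = u := by
  have h : (D.act w * D.act w⁻¹) u = u := by rw [← map_mul, mul_inv_cancel, map_one]; rfl
  exact h

theorem act_mul_apply (w v : P.weylGroup) (u : S) : D.act (w * v) u = D.act w (D.act v u) := by
  rw [map_mul]; rfl

theorem act_mem_nonZeroDivisors (w : P.weylGroup) :
    nonZeroDivisors S ≤ (nonZeroDivisors S).comap (D.act w) := by
  intro u hu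
  refine mem_nonZeroDivisors_iff_right.2 fun z hz => ?_
  have h1 := congrArg (D.act w⁻¹) hz
  rw [map_mul, act_inv_act, map_zero] at h1
  have h2 := mem_nonZeroDivisors_iff_right.1 hu _ h1
  rw [← D.act_act_inv w z, h2, map_zero]

/-- The action of the Weyl group on the total ring of fractions. -/
def qact (w : P.weylGroup) : FractionRing S →+* FractionRing S :=
  IsLocalization.map (FractionRing S) (D.act w) (D.act_mem_nonZeroDivisors w)

theorem qact_algebraMap (w : P.weylGroup) (u : S) :
    D.qact w (algebraMap S (FractionRing S) u) = algebraMap S (FractionRing S) (D.act w u) :=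
  IsLocalization.map_eq _ u

/-- The inverse of `x_i` in the total ring of fractions. -/
def xInv (i : ι) : FractionRing S :=
  ↑(IsLocalization.map_units (FractionRing S)
    (⟨D.x i, (D.regular_x i).mem_nonZeroDivisors⟩ : nonZeroDivisors S)).unit⁻¹

theorem x_mul_xInv (i : ι) : algebraMap S (FractionRing S) (D.x i) * D.xInv i = 1 :=
  (IsLocalization.map_units (FractionRing S)
    (⟨D.x i, (D.regular_x i).mem_nonZeroDivisors⟩ : nonZeroDivisors S)).mul_val_inv

/-- The operator `u ↦ (u - s_i(u)) / x_i`, on twisted combinations of elements of the Weyl group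
with coefficients in the total ring of fractions. -/
def twist (i : ι) (T : P.weylGroup → FractionRing S) (v : P.weylGroup) : FractionRing S :=
  (T v - D.qact (weylGroup.ofIdx P i) (T (weylGroup.ofIdx P i * v))) * D.xInv i

theorem x_mul_twist (i : ι) (T : P.weylGroup → FractionRing S) (v : P.weylGroup) :
    algebraMap S (FractionRing S) (D.x i) * D.twist i T v =
      T v - D.qact (weylGroup.ofIdx P i) (T (weylGroup.ofIdx P i * v)) := by
  rw [twist, mul_comm, mul_assoc, mul_comm (D.xInv i), x_mul_xInv, mul_one]

/-- The operator on `S` with values in the total ring of fractions defined by a twisted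
combination. -/
def evalTwist [Fintype P.weylGroup] (T : P.weylGroup → FractionRing S) (u : S) : FractionRing S :=
  ∑ v, T v * algebraMap S (FractionRing S) (D.act v u)

variable [Finite ι]

/-- Once multiplied by `x_i`, both sides are the difference of a value and its reflection; the
reindexing `v ↦ s_i v` accounts for the argument of `T` in the twist. -/
theorem evalTwist_twist [Fintype P.weylGroup] (i : ι) (T : P.weylGroup → FractionRing S) {u u' : S}
    (h : D.evalTwist T u = algebraMap S _ u') :
    D.evalTwist (D.twist i T) u = algebraMap S _ (D.del i u') := by
  have h1 : algebraMap S (FractionRing S) (D.x i) * D.evalTwist (D.twist i T) u =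
      algebraMap S _ (D.x i) * algebraMap S _ (D.del i u') := by
    rw [← map_mul, x_mul_del, map_sub, ← qact_algebraMap, ← h, evalTwist, evalTwist, map_sum,
      Finset.mul_sum]
    have h2 : ∀ v, D.qact (weylGroup.ofIdx P i) (T v * algebraMap S _ (D.act v u)) =
        D.qact (weylGroup.ofIdx P i) (T v) *
          algebraMap S _ (D.act (weylGroup.ofIdx P i * v) u) := fun v => by
      rw [map_mul, qact_algebraMap, act_mul_apply]
    simp only [h2]
    rw [← Equiv.sum_comp (Equiv.mulLeft (weylGroup.ofIdx P i)) (fun v =>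
        D.qact (weylGroup.ofIdx P i) (T v) *
          algebraMap S _ (D.act (weylGroup.ofIdx P i * v) u)), ← Finset.sum_sub_distrib]
    refine Finset.sum_congr rfl fun v _ => ?_
    rw [Equiv.coe_mulLeft, ← mul_assoc, x_mul_twist, ← mul_assoc (weylGroup.ofIdx P i),
      ofIdx_mul_self, one_mul, sub_mul]
  have h2 := congrArg (D.xInv i * ·) h1
  simp only [← mul_assoc] at h2
  rwa [mul_comm (D.xInv i), x_mul_xInv, one_mul, one_mul] at h2

variable [P.IsReduced] (b : P.Base)

/-- The composition of the divided difference operators along a word. -/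
def delWord (l : List b.support) (u : S) : S := l.foldr (fun i => D.del i) u

theorem delWord_cons (i : b.support) (l : List b.support) (u : S) :
    D.delWord b (i :: l) u = D.del i (D.delWord b l u) := rfl

open Classical in
/-- The coefficients of the composition of the divided difference operators along a word. -/
def wordCoeff : List b.support → P.weylGroup → FractionRing S
  | [] => Pi.single 1 1
  | i :: l => D.twist i (wordCoeff l)

theorem evalTwist_wordCoeff [Fintype P.weylGroup] (l : List b.support) (u : S) :
    D.evalTwist (D.wordCoeff b l) u = algebraMap S _ (D.delWord b l u) := by
  classical
  induction l with
  | nil =>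
    rw [evalTwist, Finset.sum_eq_single 1]
    · rw [map_one, wordCoeff, Pi.single_eq_same, one_mul]; rfl
    · intro v _ hv
      rw [wordCoeff, Pi.single_eq_of_ne hv, zero_mul]
    · simp
  | cons i l ih => exact D.evalTwist_twist _ _ ih

variable {b} {D}

/-- Each letter either keeps a group element or multiplies it by the simple reflection. Hence only
the full product can have as large a length as the word. -/
theorem wordCoeff_ne_zero {l : List b.support} {v : P.weylGroup} (h : D.wordCoeff b l v ≠ 0) :
    weylLength b v ≤ l.length ∧ (weylLength b v = l.length → v = wordProd b l) := by
  classical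
  induction l generalizing v with
  | nil =>
    have hv : v = 1 := by
      by_contra hv
      exact h (by rw [wordCoeff, Pi.single_eq_of_ne hv])
    subst hv
    exact ⟨weylLength_le b [], fun _ => rfl⟩
  | cons i l ih =>
    have h1 : D.wordCoeff b l v ≠ 0 ∨ D.wordCoeff b l (weylGroup.ofIdx P (i : ι) * v) ≠ 0 := by
      by_contra! h1
      refine h ?_
      rw [wordCoeff, twist, h1.1, h1.2, map_zero, sub_zero, zero_mul]
    rw [List.length_cons]
    rcases h1 with h1 | h1
    · have := (ih h1).1
      exact ⟨by omega, fun _ => by omega⟩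
    · obtain ⟨h2, h3⟩ := ih h1
      have h4 := weylLength_simple_mul_le i (weylGroup.ofIdx P (i : ι) * v)
      rw [← mul_assoc, ofIdx_mul_self, one_mul] at h4
      refine ⟨by omega, fun h5 => ?_⟩
      rw [wordProd_cons, ← h3 (by omega), ← mul_assoc, ofIdx_mul_self, one_mul]

variable (D) in
/-- The product of the `x_β`, over the inversions of `w`. -/
def inversionProd (w : P.weylGroup) : S := ∏ᶠ β ∈ inversions b w, D.x β

/-- For the leading coefficient only the reflection branch of each letter counts. That branch
applies `s_i` and divides by `-x_i`, which matches the recursion for inversions. -/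
theorem wordCoeff_mul_inversionProd {l : List b.support}
    (h : l.length = weylLength b (wordProd b l)) :
    D.wordCoeff b l (wordProd b l) * algebraMap S _ (D.inversionProd (b := b) (wordProd b l)) =
      (-1) ^ l.length := by
  classical
  induction l with
  | nil =>
    rw [wordProd_nil, inversionProd, inversions_one, finprod_mem_empty, wordCoeff,
      Pi.single_eq_same]
    simp
  | cons i l ih =>
    obtain ⟨h1, h2⟩ := weylLength_lt_of_cons h
    have h3 : D.wordCoeff b l (weylGroup.ofIdx P (i : ι) * wordProd b l) = 0 := by
      by_contra h3
      have := (wordCoeff_ne_zero h3).1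
      omega
    have h4 : D.inversionProd (b := b) (weylGroup.ofIdx P (i : ι) * wordProd b l) =
        D.x i * D.act (weylGroup.ofIdx P (i : ι)) (D.inversionProd (b := b) (wordProd b l)) := by
      rw [inversionProd, inversions_simple_mul h2, finprod_mem_insert _ simple_notMem_image
        (Set.toFinite _), finprod_mem_image (MulAction.injective _).injOn, inversionProd]
      congr 1
      have h5 := MonoidHom.map_finprod_mem D.x
        ((D.act (weylGroup.ofIdx P (i : ι)) : S →+* S) : S →* S)
        (Set.toFinite (inversions b (wordProd b l)))
      refine Eq.trans ?_ h5.symm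
      refine finprod_mem_congr rfl fun β _ => ?_
      exact (D.act_x _ β).symm
    have h5 := ih h1
    rw [wordProd_cons, h4, map_mul, ← mul_assoc, mul_comm (D.wordCoeff b (i :: l) _), wordCoeff,
      x_mul_twist, h3, zero_sub, ← mul_assoc, ofIdx_mul_self, one_mul, ← qact_algebraMap, neg_mul,
      ← map_mul, h5, map_pow, map_neg, map_one, List.length_cons, pow_succ]
    ring

end ReflectionFrame

end FormalGroupRing

end

/-! ### Tame combinations, and relations between words over a good ring. -/

noncomputable section

namespace FormalGroupRing

open RootPairing

variable {ι M N : Type*} [AddCommGroup M] [AddCommGroup N]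

/-- A frame over a domain in which the `x_i` of the positive roots are primes that do not divide
each other. -/
structure PrimeFrame {P : RootDatum ι M N} (b : P.Base) (S : Type*) [CommRing S] extends
    ReflectionFrame P S where
  prime_x : ∀ i, Prime (x i)
  eq_of_dvd : ∀ i j, b.IsPos i → b.IsPos j → x i ∣ x j → i = j
  exists_kappa : ∀ i, ∃ κ, x i * x (weylGroup.ofIdx P i • i) * κ =
    x i + x (weylGroup.ofIdx P i • i)

namespace PrimeFrame

variable {P : RootDatum ι M N} {b : P.Base} {S : Type*} [CommRing S] [IsDomain S]
  (D : PrimeFrame b S)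

/-- The elements of the field of fractions that have no pole along `x_i`. -/
def regularAt (i : ι) : Subring (FractionRing S) where
  carrier := {a | ∃ m s, ¬ D.x i ∣ m ∧ algebraMap S (FractionRing S) m * a = algebraMap S _ s}
  zero_mem' := ⟨1, 0, (D.prime_x i).not_dvd_one, by simp⟩
  one_mem' := ⟨1, 1, (D.prime_x i).not_dvd_one, by simp⟩
  add_mem' := by
    rintro a c ⟨m, s, hm, h⟩ ⟨m', s', hm', h'⟩
    refine ⟨m * m', m' * s + m * s', (D.prime_x i).not_dvd_mul hm hm', ?_⟩
    rw [map_add, map_mul, map_mul, map_mul, ← h, ← h']; ring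
  mul_mem' := by
    rintro a c ⟨m, s, hm, h⟩ ⟨m', s', hm', h'⟩
    refine ⟨m * m', s * s', (D.prime_x i).not_dvd_mul hm hm', ?_⟩
    rw [map_mul, map_mul, ← h, ← h']; ring
  neg_mem' := by
    rintro a ⟨m, s, hm, h⟩
    exact ⟨m, -s, hm, by rw [map_neg, ← h]; ring⟩

theorem algebraMap_mem_regularAt (i : ι) (s : S) : algebraMap S _ s ∈ D.regularAt i :=
  ⟨1, s, (D.prime_x i).not_dvd_one, by simp⟩

theorem xInv_mem_regularAt {i j : ι} (h : ¬ D.x i ∣ D.x j) : D.xInv j ∈ D.regularAt i :=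
  ⟨D.x j, 1, h, by rw [D.x_mul_xInv, map_one]⟩

theorem act_dvd {w : P.weylGroup} {i : ι} {m : S} (h : D.x i ∣ m) : D.x (w • i) ∣ D.act w m := by
  rw [← D.act_x]; exact map_dvd (D.act w) h

theorem qact_mem_regularAt (w : P.weylGroup) {i : ι} {a : FractionRing S} (h : a ∈ D.regularAt i) :
    D.qact w a ∈ D.regularAt (w • i) := by
  obtain ⟨m, s, hm, h⟩ := h
  refine ⟨D.act w m, D.act w s, fun h1 => hm ?_, ?_⟩
  · have h2 := D.act_dvd (w := w⁻¹) h1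
    rwa [inv_smul_smul, D.act_inv_act] at h2
  · rw [← D.qact_algebraMap, ← map_mul, h, D.qact_algebraMap]

theorem xInv_eq_of_mul {i : ι} {z t : FractionRing S}
    (h : algebraMap S (FractionRing S) (D.x i) * t = z) : z * D.xInv i = t := by
  rw [← h, mul_comm, ← mul_assoc, mul_comm (D.xInv i), D.x_mul_xInv, one_mul]

/-- Applied to both signs, this makes `x_i` and `x_{-i}` associates, so poles along them are the
same thing. -/
theorem x_dvd_neg (i : ι) : D.x (weylGroup.ofIdx P i • i) ∣ D.x i := by
  obtain ⟨κ, h⟩ := D.exists_kappa i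
  exact ⟨D.x i * κ - 1, by linear_combination -h⟩

/-- `(q - s_i(q)) / x_i` has no pole along `x_i`, when `q` has none. -/
theorem sub_qact_mem_regularAt [Finite ι] [P.IsReduced] {i : ι} {q : FractionRing S} (h : q ∈ D.regularAt i) :
    (q - D.qact (weylGroup.ofIdx P i) q) * D.xInv i ∈ D.regularAt i := by
  have hs := D.qact_mem_regularAt (weylGroup.ofIdx P i) h
  obtain ⟨m, s, hm, h⟩ := h
  have hm' : ¬ D.x i ∣ D.act (weylGroup.ofIdx P i) m := by
    intro h1
    have h2 := D.act_dvd (w := weylGroup.ofIdx P i) h1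
    have h3 := D.act_inv_act (weylGroup.ofIdx P i) m
    rw [ofIdx_inv] at h3
    rw [h3] at h2
    refine hm ((dvd_trans ?_ h2))
    have h4 := D.x_dvd_neg (weylGroup.ofIdx P i • i)
    rwa [ofIdx_neg_index, ← mul_smul, ofIdx_mul_self, one_smul] at h4
  have hq : algebraMap S _ (D.act (weylGroup.ofIdx P i) m) * D.qact (weylGroup.ofIdx P i) q =
      algebraMap S _ (D.act (weylGroup.ofIdx P i) s) := by
    rw [← D.qact_algebraMap, ← map_mul, h, D.qact_algebraMap]
  -- For `q = s / m`, the denominator `m * s_i(m)` is invariant under the reflection and prime to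
  -- `x_i`. Over it, the difference of numerators is `u - s_i(u)` for `u = s * s_i(m)`, which `x_i`
  -- divides.
  have h5 := D.x_mul_del i (s * D.act (weylGroup.ofIdx P i) m)
  have h6 : D.act (weylGroup.ofIdx P i) (s * D.act (weylGroup.ofIdx P i) m) =
      D.act (weylGroup.ofIdx P i) s * m := by
    have h3 := D.act_inv_act (weylGroup.ofIdx P i) m
    rw [ofIdx_inv] at h3
    rw [map_mul, h3]
  rw [h6] at h5
  refine ⟨m * D.act (weylGroup.ofIdx P i) m, D.del i (s * D.act (weylGroup.ofIdx P i) m),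
    (D.prime_x i).not_dvd_mul hm hm', ?_⟩
  rw [← mul_assoc]
  refine D.xInv_eq_of_mul ?_
  rw [← map_mul, h5, map_sub, map_mul, map_mul, map_mul, ← h, ← hq]
  ring

/-- The twisted combinations that have at most simple poles, along the `x_i`, with compatible
residues. -/
structure IsTame (T : P.weylGroup → FractionRing S) : Prop where
  exists_den : ∀ v, ∃ m ∈ Submonoid.closure (Set.range D.x), ∃ s,
    algebraMap S (FractionRing S) m * T v = algebraMap S _ s
  x_mul_mem : ∀ i, b.IsPos i → ∀ v, algebraMap S _ (D.x i) * T v ∈ D.regularAt i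
  residue_mem : ∀ i, b.IsPos i → ∀ v, T v + T (weylGroup.ofIdx P i * v) ∈ D.regularAt i

variable {D}

theorem IsTame.add {T T' : P.weylGroup → FractionRing S} (h : D.IsTame T) (h' : D.IsTame T') :
    D.IsTame (T + T') where
  exists_den v := by
    obtain ⟨m, hm, s, hs⟩ := h.exists_den v
    obtain ⟨m', hm', s', hs'⟩ := h'.exists_den v
    refine ⟨m * m', mul_mem hm hm', m' * s + m * s', ?_⟩
    rw [map_add, map_mul, map_mul, map_mul, ← hs, ← hs', Pi.add_apply]; ring
  x_mul_mem i hi v := by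
    rw [Pi.add_apply, mul_add]; exact add_mem (h.x_mul_mem i hi v) (h'.x_mul_mem i hi v)
  residue_mem i hi v := by
    rw [Pi.add_apply, Pi.add_apply, add_add_add_comm]
    exact add_mem (h.residue_mem i hi v) (h'.residue_mem i hi v)

theorem IsTame.const_mul {T : P.weylGroup → FractionRing S} (h : D.IsTame T) (u : S) :
    D.IsTame (fun v => algebraMap S _ u * T v) where
  exists_den v := by
    obtain ⟨m, hm, s, hs⟩ := h.exists_den v
    exact ⟨m, hm, u * s, by rw [map_mul, ← hs]; ring⟩
  x_mul_mem i hi v := by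
    rw [mul_left_comm]; exact mul_mem (D.algebraMap_mem_regularAt i u) (h.x_mul_mem i hi v)
  residue_mem i hi v := by
    rw [← mul_add]; exact mul_mem (D.algebraMap_mem_regularAt i u) (h.residue_mem i hi v)

variable (D) in
theorem isTame_zero : D.IsTame 0 where
  exists_den _ := ⟨1, one_mem _, 0, by simp⟩
  x_mul_mem i _ v := by simp [zero_mem]
  residue_mem i _ v := by simp [zero_mem]

theorem IsTame.sum {α : Type*} (s : Finset α) {T : α → P.weylGroup → FractionRing S}
    (h : ∀ a ∈ s, D.IsTame (T a)) : D.IsTame (∑ a ∈ s, T a) :=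
  Finset.sum_induction _ D.IsTame (fun _ _ => IsTame.add) D.isTame_zero h

variable [Finite ι] [P.IsReduced]

/-- Along `x_i` with `i ≠ j`, division by `x_j` is harmless and the conditions at the positive root
`s_j i` are carried over by the reflection. Along `x_j`, the old residue condition prevents a double
pole, and the new residue sum is `(q - s_j(q)) / x_j` for the regular `q = T_v + T_{s_j v}`. -/
theorem IsTame.twist {T : P.weylGroup → FractionRing S} (h : D.IsTame T) (j : b.support) :
    D.IsTame (D.twist (j : ι) T) where
  exists_den v := by
    obtain ⟨m, hm, s, hs⟩ := h.exists_den v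
    obtain ⟨m', hm', s', hs'⟩ := h.exists_den (weylGroup.ofIdx P (j : ι) * v)
    have h1 : D.act (weylGroup.ofIdx P (j : ι)) m' ∈ Submonoid.closure (Set.range D.x) := by
      have h2 : Submonoid.closure (Set.range D.x) ≤ (Submonoid.closure (Set.range D.x)).comap
          (D.act (weylGroup.ofIdx P (j : ι))) := by
        rw [Submonoid.closure_le]
        rintro _ ⟨i, rfl⟩
        exact Submonoid.subset_closure ⟨_, (D.act_x _ i).symm⟩
      exact h2 hm'
    refine ⟨D.x j * (m * D.act (weylGroup.ofIdx P (j : ι)) m'),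
      mul_mem (Submonoid.subset_closure ⟨_, rfl⟩) (mul_mem hm h1),
      D.act (weylGroup.ofIdx P (j : ι)) m' * s - m * D.act (weylGroup.ofIdx P (j : ι)) s', ?_⟩
    rw [map_mul, mul_comm (algebraMap S _ (D.x j)), mul_assoc, D.x_mul_twist, map_sub, map_mul,
      map_mul, map_mul, ← hs, ← D.qact_algebraMap _ s', ← hs', map_mul, D.qact_algebraMap]
    ring
  x_mul_mem i hi v := by
    by_cases hij : i = j
    · subst hij
      rw [D.x_mul_twist]
      have h1 := h.residue_mem j (Base.isPos_of_mem_support j.2) v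
      have h2 := D.qact_mem_regularAt (weylGroup.ofIdx P (j : ι)) h1
      set σ := D.qact (weylGroup.ofIdx P (j : ι))
      have hneg : ∀ a ∈ D.regularAt (weylGroup.ofIdx P (j : ι) • (j : ι)), a ∈ D.regularAt j := by
        rintro a ⟨m, s, hm, ha⟩
        refine ⟨m, s, fun hd => hm ((D.x_dvd_neg _).trans hd), ha⟩
      have h3 := D.sub_qact_mem_regularAt (h.x_mul_mem j (Base.isPos_of_mem_support j.2) v)
      obtain ⟨κ, hκ⟩ := D.exists_kappa j
      -- Everything on the right is expressed by the regular function `x_j T_v`. The coefficients of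
      -- `σ(T_v)` agree because the relation for `κ` says `κ x_{-j} - x_{-j} / x_j = 1`.
      have h4 : T v + σ (T v) = (algebraMap S _ (D.x j) * T v -
          σ (algebraMap S _ (D.x j) * T v)) * D.xInv j +
          algebraMap S _ κ * σ (algebraMap S _ (D.x j) * T v) := by
        have h5 : σ (algebraMap S _ (D.x j)) = algebraMap S _
            (D.x (weylGroup.ofIdx P (j : ι) • (j : ι))) := by
          rw [← D.act_x]; exact D.qact_algebraMap _ _
        have h6 := congrArg (algebraMap S (FractionRing S)) hκ
        rw [map_mul, map_mul, map_add, ← h5] at h6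
        have h7 := D.x_mul_xInv j
        rw [map_mul]
        linear_combination (-T v + σ (algebraMap S _ (D.x j)) * σ (T v) * algebraMap S _ κ - σ (T v)) * h7 -
          (D.xInv j * σ (T v)) * h6
      have h5 : T v + σ (T v) ∈ D.regularAt j := by
        rw [h4]
        refine add_mem h3 (mul_mem (D.algebraMap_mem_regularAt _ _) (hneg _ ?_))
        exact D.qact_mem_regularAt _ (h.x_mul_mem j (Base.isPos_of_mem_support j.2) v)
      have h6 : T v - σ (T (weylGroup.ofIdx P (j : ι) * v)) = T v + σ (T v) -
          σ (T v + T (weylGroup.ofIdx P (j : ι) * v)) := by rw [map_add]; ring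
      rw [h6]
      exact sub_mem h5 (hneg _ h2)
    · have hd : ¬ D.x i ∣ D.x j :=
        fun hd => hij (D.eq_of_dvd _ _ hi (Base.isPos_of_mem_support j.2) hd)
      rw [ReflectionFrame.twist, ← mul_assoc, mul_sub]
      refine mul_mem (sub_mem (h.x_mul_mem i hi v) ?_) (D.xInv_mem_regularAt hd)
      have h1 := D.qact_mem_regularAt (weylGroup.ofIdx P (j : ι))
        (h.x_mul_mem _ (isPos_simple_smul hi hij) (weylGroup.ofIdx P (j : ι) * v))
      rw [map_mul, D.qact_algebraMap, D.act_x, ← mul_smul, ofIdx_mul_self, one_smul] at h1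
      exact h1
  residue_mem i hi v := by
    by_cases hij : i = j
    · subst hij
      have h1 := D.sub_qact_mem_regularAt (h.residue_mem j (Base.isPos_of_mem_support j.2) v)
      rw [map_add] at h1
      have h2 : D.twist (j : ι) T v + D.twist (j : ι) T (weylGroup.ofIdx P (j : ι) * v) =
          (T v + T (weylGroup.ofIdx P (j : ι) * v) - (D.qact (weylGroup.ofIdx P (j : ι)) (T v) +
            D.qact (weylGroup.ofIdx P (j : ι)) (T (weylGroup.ofIdx P (j : ι) * v)))) *
            D.xInv j := by
        rw [ReflectionFrame.twist, ReflectionFrame.twist, ← mul_assoc (weylGroup.ofIdx P (j : ι)),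
          ofIdx_mul_self, one_mul]
        ring
      rw [h2]
      exact h1
    · have hd : ¬ D.x i ∣ D.x j :=
        fun hd => hij (D.eq_of_dvd _ _ hi (Base.isPos_of_mem_support j.2) hd)
      have h1 := D.qact_mem_regularAt (weylGroup.ofIdx P (j : ι))
        (h.residue_mem _ (isPos_simple_smul hi hij) (weylGroup.ofIdx P (j : ι) * v))
      -- The reflection in `s_j i` is `s_j s_i s_j`, so at `s_j v` it gives `s_j s_i v`, the index
      -- that occurs in the twist at `s_i v`.
      rw [← mul_smul, ofIdx_mul_self, one_smul, map_add, ofIdx_smul_eq, ofIdx_inv, ← mul_assoc,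
        mul_assoc (weylGroup.ofIdx P (j : ι) * weylGroup.ofIdx P i), ofIdx_mul_self, mul_one,
        mul_assoc] at h1
      have h2 : D.twist (j : ι) T v + D.twist (j : ι) T (weylGroup.ofIdx P i * v) =
          (T v + T (weylGroup.ofIdx P i * v) - (D.qact (weylGroup.ofIdx P (j : ι))
            (T (weylGroup.ofIdx P (j : ι) * v)) + D.qact (weylGroup.ofIdx P (j : ι))
            (T (weylGroup.ofIdx P (j : ι) * (weylGroup.ofIdx P i * v))))) * D.xInv j := by
        rw [ReflectionFrame.twist, ReflectionFrame.twist]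
        ring
      rw [h2]
      exact mul_mem (sub_mem (h.residue_mem i hi v) h1) (D.xInv_mem_regularAt hd)

theorem isTame_wordCoeff (l : List b.support) : D.IsTame (D.wordCoeff b l) := by
  classical
  induction l with
  | nil =>
    have h : ∀ v, ∃ s, D.wordCoeff b [] v = algebraMap S (FractionRing S) s := fun v => by
      rw [ReflectionFrame.wordCoeff, Pi.single_apply]
      split_ifs
      exacts [⟨1, (map_one _).symm⟩, ⟨0, (map_zero _).symm⟩]
    choose s hs using h
    refine ⟨fun v => ⟨1, one_mem _, s v, by rw [map_one, one_mul, hs]⟩, fun i _ v => ?_,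
      fun i _ v => ?_⟩
    · rw [hs, ← map_mul]; exact D.algebraMap_mem_regularAt _ _
    · rw [hs, hs, ← map_add]; exact D.algebraMap_mem_regularAt _ _
  | cons i l ih => exact ih.twist i

/-- An element of the field of fractions whose poles are along the `x_i`, for all positive roots,
and that has no pole along `x_i`, belongs to `S`. -/
theorem exists_algebraMap_eq {m : S} (hm : m ∈ Submonoid.closure (Set.range D.x))
    {a : FractionRing S} (ha : ∀ i, b.IsPos i → a ∈ D.regularAt i)
    (h : ∃ s, algebraMap S (FractionRing S) m * a = algebraMap S _ s) :
    ∃ s, a = algebraMap S _ s := by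
  have hreg : ∀ i, a ∈ D.regularAt i := by
    intro i
    by_cases hi : b.IsPos i
    · exact ha i hi
    · rw [← isPos_neg_index] at hi
      obtain ⟨m, s, hm, h⟩ := ha _ hi
      exact ⟨m, s, fun hd => hm ((D.x_dvd_neg _).trans hd), h⟩
  induction hm using Submonoid.closure_induction_left with
  | one =>
    obtain ⟨s, hs⟩ := h
    exact ⟨s, by rwa [map_one, one_mul] at hs⟩
  | mul_left y hy m hm ih =>
    obtain ⟨i, rfl⟩ := hy
    obtain ⟨s, hs⟩ := h
    obtain ⟨n, t, hn, ht⟩ := hreg i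
    have h1 : n * s = D.x i * (m * t) := by
      apply IsFractionRing.injective S (FractionRing S)
      rw [map_mul, map_mul, map_mul, ← hs, ← ht, map_mul]; ring
    obtain ⟨r, rfl⟩ := ((D.prime_x i).dvd_or_dvd ⟨m * t, h1⟩).resolve_left hn
    refine ih ⟨r, ?_⟩
    rw [map_mul, map_mul, mul_assoc] at hs
    exact mul_left_cancel₀ ((map_ne_zero_iff _ (IsFractionRing.injective S (FractionRing S))).2
      (D.prime_x i).ne_zero) hs

/-- The coefficients are cleared from the greatest length down. At such a `w`, the pole along an
inversion is simple and is cancelled by `inversionProd`. Along another positive root `β` the element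
`s_β w` is longer, so its coefficient is zero and the residue condition leaves no pole at `w`. Thus
the multiplier needed for the word of `w` lies in `S`. -/
theorem exists_eq_sum_wordCoeff [Fintype P.weylGroup] {I : P.weylGroup → List b.support}
    (hI : ∀ w, wordProd b (I w) = w ∧ (I w).length = weylLength b w) (k : ℕ)
    {T : P.weylGroup → FractionRing S} (hT : D.IsTame T)
    (hk : ∀ v, T v ≠ 0 → weylLength b v < k) :
    ∃ c : P.weylGroup → S, (∀ w, c w ≠ 0 → weylLength b w < k) ∧
      ∀ v, T v = ∑ w, algebraMap S _ (c w) * D.wordCoeff b (I w) v := by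
  classical
  induction k generalizing T with
  | zero =>
    refine ⟨0, by simp, fun v => ?_⟩
    by_contra h
    exact absurd (hk v (by simpa using h)) (Nat.not_lt_zero _)
  | succ k ih =>
    have h1 : ∀ w, weylLength b w = k → ∃ s : S, T w * algebraMap S _
        (D.inversionProd (b := b) w) = algebraMap S _ s := by
      intro w hw
      obtain ⟨m, hm, s, hs⟩ := hT.exists_den w
      refine D.exists_algebraMap_eq hm (fun i hi => ?_) ⟨s * D.inversionProd (b := b) w, by
        rw [map_mul, ← hs, mul_assoc]⟩
      by_cases hiw : i ∈ inversions b w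
      · have h2 : D.inversionProd (b := b) w =
            D.x i * ∏ᶠ β ∈ inversions b w \ {i}, D.x β := by
          have h3 := finprod_mem_insert (a := i) D.x (s := inversions b w \ {i}) (by simp)
            (Set.toFinite _)
          rwa [Set.insert_sdiff_singleton, Set.insert_eq_of_mem hiw] at h3
        rw [h2, map_mul, ← mul_assoc, mul_comm (T w)]
        exact mul_mem (hT.x_mul_mem i hi w) (D.algebraMap_mem_regularAt _ _)
      · refine mul_mem ?_ (D.algebraMap_mem_regularAt _ _)
        have h2 : b.IsPos (w⁻¹ • i) := by
          by_contra h3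
          exact hiw ⟨hi, h3⟩
        have h3 := lt_weylLength_reflection_mul hi h2
        have h4 : T (weylGroup.ofIdx P i * w) = 0 := by
          by_contra h4
          have := hk _ h4
          omega
        have h5 := hT.residue_mem i hi w
        rwa [h4, add_zero] at h5
    choose! c hc using h1
    -- The sign compensates the leading coefficient `(-1) ^ k / inversionProd` of a reduced word of
    -- length `k`.
    let c' : P.weylGroup → S := fun w => if weylLength b w = k then (-1) ^ k * c w else 0
    have hc' : D.IsTame (T - ∑ w, fun v => algebraMap S _ (c' w) * D.wordCoeff b (I w) v) := by
      have h2 : T - ∑ w, (fun v => algebraMap S _ (c' w) * D.wordCoeff b (I w) v) =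
          T + ∑ w, (fun v => algebraMap S _ (-c' w) * D.wordCoeff b (I w) v) := by
        rw [sub_eq_add_neg, ← Finset.sum_neg_distrib]
        congr 2
        funext w v
        simp
      rw [h2]
      exact hT.add (IsTame.sum _ fun w _ => (isTame_wordCoeff (I w)).const_mul _)
    have hz : ∀ v w, c' w ≠ 0 → D.wordCoeff b (I w) v ≠ 0 → k ≤ weylLength b v → v = w := by
      intro v w h2 h3 h4
      obtain ⟨h5, h6⟩ := D.wordCoeff_ne_zero h3
      have h7 : weylLength b w = k := by
        by_contra h7
        exact h2 (if_neg h7)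
      rw [(hI w).2, h7] at h5 h6
      rw [h6 (le_antisymm h5 h4), (hI w).1]
    obtain ⟨d, hd, hd'⟩ := ih hc' (fun v hv => by
      by_contra h2
      rw [not_lt] at h2
      refine hv ?_
      rw [Pi.sub_apply, Finset.sum_apply, Finset.sum_eq_single v]
      · rcases h2.eq_or_lt with h3 | h3
        · have h4 := D.wordCoeff_mul_inversionProd (b := b) (l := I v)
            (by rw [(hI v).1]; exact (hI v).2)
          rw [(hI v).1, (hI v).2, ← h3] at h4
          have h5 := hc v h3.symm
          have h6 : algebraMap S (FractionRing S) (D.inversionProd (b := b) v) ≠ 0 := by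
            intro h6
            rw [h6, mul_zero] at h4
            exact pow_ne_zero k (neg_ne_zero.2 one_ne_zero) h4.symm
          refine mul_right_cancel₀ h6 ?_
          simp only [c', if_pos h3.symm]
          rw [zero_mul, sub_mul, mul_assoc, h4, h5, map_mul, map_pow, map_neg, map_one]
          have h7 : ((-1 : FractionRing S) ^ k) * (-1) ^ k = 1 := by
            rw [← mul_pow]; simp
          linear_combination (-algebraMap S (FractionRing S) (c v)) * h7
        · have h4 : T v = 0 := by
            by_contra h4
            have := hk v h4
            omega
          simp only [c', if_neg h3.ne']
          rw [h4, map_zero, zero_mul, sub_zero]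
      · intro w _ hw
        by_contra h3
        obtain ⟨h4, h5⟩ := mul_ne_zero_iff.1 h3
        exact hw (hz v w (fun h6 => h4 (by rw [h6, map_zero])) h5 h2).symm
      · intro h; exact absurd (Finset.mem_univ _) h)
    refine ⟨fun w => c' w + d w, fun w hw => ?_, fun v => ?_⟩
    · by_cases h2 : weylLength b w = k
      · omega
      · have h3 : c' w = 0 := if_neg h2
        have := hd w (by simpa [h3] using hw)
        omega
    · have h2 := hd' v
      rw [Pi.sub_apply, Finset.sum_apply, sub_eq_iff_eq_add] at h2
      rw [h2, ← Finset.sum_add_distrib]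
      refine Finset.sum_congr rfl fun w _ => ?_
      rw [map_add]; ring

/-- Both reduced words have the same leading coefficient, so their difference is tame and supported
in smaller lengths. -/
theorem exists_delWord_eq [Fintype P.weylGroup] {I : P.weylGroup → List b.support}
    (hI : ∀ w, wordProd b (I w) = w ∧ (I w).length = weylLength b w) {l : List b.support}
    (hl : l.length = weylLength b (wordProd b l)) :
    ∃ c : P.weylGroup → S, (∀ w, c w ≠ 0 → weylLength b w < l.length) ∧
      ∀ u, D.delWord b l u = D.delWord b (I (wordProd b l)) u +
        ∑ w, c w * D.delWord b (I w) u := by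
  set w₀ := wordProd b l
  have h0 : (I w₀).length = l.length := by rw [(hI w₀).2, hl]
  have hT : D.IsTame (D.wordCoeff b l + fun v => algebraMap S _ (-1) * D.wordCoeff b (I w₀) v) :=
    (isTame_wordCoeff l).add ((isTame_wordCoeff _).const_mul _)
  obtain ⟨c, hc, h⟩ := exists_eq_sum_wordCoeff hI l.length hT (fun v hv => by
    have h1 : weylLength b v ≤ l.length := by
      by_contra h1
      refine hv ?_
      have h2 : D.wordCoeff b l v = 0 := by
        by_contra h2; exact h1 (D.wordCoeff_ne_zero h2).1
      have h3 : D.wordCoeff b (I w₀) v = 0 := by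
        by_contra h3; exact h1 (h0 ▸ (D.wordCoeff_ne_zero h3).1)
      rw [Pi.add_apply, h2, h3, mul_zero, add_zero]
    refine lt_of_le_of_ne h1 fun h1 => hv ?_
    by_cases hvw : v = w₀
    · subst hvw
      have h2 := D.wordCoeff_mul_inversionProd hl
      have h3 := D.wordCoeff_mul_inversionProd (b := b) (l := I w₀)
        (by rw [(hI w₀).1]; exact (hI w₀).2)
      rw [(hI w₀).1, h0] at h3
      have h6 : algebraMap S (FractionRing S) (D.inversionProd (b := b) w₀) ≠ 0 := by
        intro h6
        rw [h6, mul_zero] at h3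
        exact pow_ne_zero _ (neg_ne_zero.2 one_ne_zero) h3.symm
      have h7 := mul_right_cancel₀ h6 (h2.trans h3.symm)
      rw [Pi.add_apply, h7, map_neg, map_one]; ring
    · have h2 : D.wordCoeff b l v = 0 := by
        by_contra h2; exact hvw ((D.wordCoeff_ne_zero h2).2 h1)
      have h3 : D.wordCoeff b (I w₀) v = 0 := by
        by_contra h3
        exact hvw (((D.wordCoeff_ne_zero h3).2 (h1.trans h0.symm)).trans (hI w₀).1)
      rw [Pi.add_apply, h2, h3, mul_zero, add_zero])
  refine ⟨c, hc, fun u => ?_⟩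
  apply IsFractionRing.injective S (FractionRing S)
  rw [map_add, map_sum, ← D.evalTwist_wordCoeff, ← D.evalTwist_wordCoeff]
  simp only [map_mul, ← D.evalTwist_wordCoeff]
  simp only [ReflectionFrame.evalTwist, Finset.mul_sum]
  rw [Finset.sum_comm, ← Finset.sum_add_distrib]
  refine Finset.sum_congr rfl fun v _ => ?_
  have h1 := h v
  rw [Pi.add_apply, map_neg, map_one, neg_one_mul, ← sub_eq_add_neg, sub_eq_iff_eq_add] at h1
  rw [h1, add_mul, Finset.sum_mul, add_comm]
  simp only [mul_assoc]

/-- A word that is not reduced has no coefficient at an element as long as the word, so it is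
already tame with support in smaller lengths. -/
theorem exists_delWord_eq_of_lt [Fintype P.weylGroup] {I : P.weylGroup → List b.support}
    (hI : ∀ w, wordProd b (I w) = w ∧ (I w).length = weylLength b w) {l : List b.support}
    (hl : weylLength b (wordProd b l) < l.length) :
    ∃ c : P.weylGroup → S, (∀ w, c w ≠ 0 → weylLength b w < l.length) ∧
      ∀ u, D.delWord b l u = ∑ w, c w * D.delWord b (I w) u := by
  obtain ⟨c, hc, h⟩ := exists_eq_sum_wordCoeff hI l.length (D.isTame_wordCoeff l) (fun v hv => by
    obtain ⟨h1, h2⟩ := D.wordCoeff_ne_zero hv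
    refine lt_of_le_of_ne h1 fun h3 => ?_
    rw [← h2 h3] at hl
    omega)
  refine ⟨c, hc, fun u => ?_⟩
  apply IsFractionRing.injective S (FractionRing S)
  rw [map_sum, ← D.evalTwist_wordCoeff]
  simp only [map_mul, ← D.evalTwist_wordCoeff]
  simp only [ReflectionFrame.evalTwist, Finset.mul_sum]
  rw [Finset.sum_comm]
  refine Finset.sum_congr rfl fun v _ => ?_
  rw [h v, Finset.sum_mul]
  simp only [mul_assoc]

end PrimeFrame

end FormalGroupRing

end

/-! ### The extended lattice, in which roots are primitive. -/

noncomputable section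

namespace FormalGroupRing

open RootPairing

section Functoriality

variable {R : Type*} [CommRing R] (F : FormalGroup R) [F.IsComm] {M M' M'' : Type*}
  [AddCommGroup M] [AddCommGroup M'] [AddCommGroup M'']

theorem continuous_mapHom (f : M →+ M') : Continuous (mapHom F f) := continuous_lift _

theorem mapHom_comp_apply (g : M' →+ M'') (f : M →+ M') (u : FGRing F M) :
    mapHom F (g.comp f) u = mapHom F g (mapHom F f u) := by
  have h : mapHom F (g.comp f) = (mapHom F g).comp (mapHom F f) :=
    hom_ext (continuous_mapHom F _) ((continuous_mapHom F g).comp (continuous_mapHom F f))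
      fun μ => by
        rw [AlgHom.comp_apply, mapHom_x, mapHom_x, mapHom_x]; rfl
  exact DFunLike.congr_fun h u

theorem mapHom_id_apply (u : FGRing F M) : mapHom F (AddMonoidHom.id M) u = u := by
  have h : mapHom F (AddMonoidHom.id M) = AlgHom.id R (FGRing F M) :=
    hom_ext (continuous_mapHom F _) continuous_id fun μ => mapHom_x F _ μ
  exact DFunLike.congr_fun h u

end Functoriality

variable {ι M N : Type*} [AddCommGroup M] [AddCommGroup N]

/-- An action of the Weyl group on a lattice such that the reflections act by
`μ ↦ μ - c_i(μ) r_i`. -/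
structure ReflectionLattice (P : RootDatum ι M N) (L : Type*) [AddCommGroup L] where
  /-- The action of the Weyl group. -/
  act : P.weylGroup →* (AddMonoid.End L)
  /-- The roots. -/
  root : ι → L
  /-- The coroots. -/
  coroot : ι → L →+ ℤ
  act_root : ∀ w i, act w (root i) = root (w • i)
  act_ofIdx : ∀ i μ, act (weylGroup.ofIdx P i) μ = μ - coroot i μ • root i

namespace ReflectionLattice

variable {P : RootDatum ι M N} {L : Type*} [AddCommGroup L] (Λ : ReflectionLattice P L)
  {R : Type*} [CommRing R] (F : FormalGroup R) [F.IsComm]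

/-- The action of the Weyl group on the formal group ring. -/
def ringAct : P.weylGroup →* (FGRing F L →+* FGRing F L) where
  toFun w := (mapHom F (Λ.act w) : FGRing F L →+* FGRing F L)
  map_one' := RingHom.ext fun u => by
    change mapHom F (Λ.act 1) u = u
    rw [map_one]
    exact mapHom_id_apply F u
  map_mul' w v := RingHom.ext fun u => by
    change mapHom F (Λ.act (w * v)) u = mapHom F (Λ.act w) (mapHom F (Λ.act v) u)
    rw [map_mul]
    exact mapHom_comp_apply F (Λ.act w) (Λ.act v) u

theorem ringAct_apply (w : P.weylGroup) (u : FGRing F L) :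
    Λ.ringAct F w u = mapHom F (Λ.act w) u := rfl

theorem act_ofIdx_eq (i : ι) :
    Λ.act (weylGroup.ofIdx P i) = reflHom (Λ.root i) (Λ.coroot i) :=
  AddMonoidHom.ext fun μ => Λ.act_ofIdx i μ

/-- The frame attached to the formal group ring of the lattice, when the `x_i` are regular. -/
def frame (h : ∀ i, IsRegular (x F (Λ.root i))) : ReflectionFrame P (FGRing F L) where
  act := Λ.ringAct F
  x i := x F (Λ.root i)
  act_x w i := (mapHom_x F (Λ.act w) (Λ.root i)).trans (congrArg (x F) (Λ.act_root w i))
  regular_x := h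
  del i := demazure F (Λ.root i) (Λ.coroot i)
  x_mul_del i u := by rw [x_mul_demazure, ringAct_apply, act_ofIdx_eq]

variable (P) in
/-- The character lattice itself. -/
def self [Finite ι] : ReflectionLattice P M where
  act := DistribMulAction.toAddMonoidEnd P.weylGroup M
  root := P.root
  coroot i := (P.coroot' i).toAddMonoidHom
  act_root w i := (root_smul w i).symm
  act_ofIdx i μ := ofIdx_smul_root i μ

theorem smul_sub_mem_rootSpan (w : P.weylGroup) (m : M) : w • m - m ∈ P.rootSpan ℤ := by
  obtain ⟨w, hw⟩ := w
  induction hw using weylGroup.induction generalizing m with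
  | mem j =>
    change weylGroup.ofIdx P j • m - m ∈ _
    rw [ofIdx_smul_root, sub_sub_cancel_left]
    exact neg_mem (Submodule.smul_mem _ _ (Submodule.subset_span ⟨j, rfl⟩))
  | one =>
    change (1 : P.weylGroup) • m - m ∈ _
    rw [one_smul, sub_self]; exact zero_mem _
  | mul g₁ g₂ h₁ h₂ ih₁ ih₂ =>
    rw [← Submonoid.mk_mul_mk _ _ _ h₁ h₂, mul_smul]
    have h := add_mem (ih₁ ((⟨g₂, h₂⟩ : P.weylGroup) • m)) (ih₂ m)
    rwa [sub_add_sub_cancel] at h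

variable (P) in
/-- The map `m ↦ w(m) - m`. -/
def displacement (w : P.weylGroup) : M →+ P.rootSpan ℤ where
  toFun m := ⟨w • m - m, smul_sub_mem_rootSpan w m⟩
  map_zero' := Subtype.ext (by simp)
  map_add' m m' := Subtype.ext (by
    change w • (m + m') - (m + m') = (w • m - m) + (w • m' - m')
    rw [smul_add]; abel)

variable (P) in
/-- The sum of the character lattice and of the root lattice, in which the roots `(α, α)` are
primitive. -/
def extended [Finite ι] : ReflectionLattice P (M × P.rootSpan ℤ) where
  act :=
    { toFun := fun w =>
        { toFun := fun p => (w • p.1, p.2 + displacement P w p.1)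
          map_zero' := by simp
          map_add' := fun p q => by
            refine Prod.ext (smul_add _ _ _) ?_
            simp only [Prod.fst_add, Prod.snd_add, map_add]
            abel }
      map_one' := by
        refine AddMonoidHom.ext fun p => Prod.ext (one_smul _ _) (Subtype.ext ?_)
        change (p.2 : M) + ((1 : P.weylGroup) • p.1 - p.1) = p.2
        rw [one_smul, sub_self, add_zero]
      map_mul' := fun w v => by
        refine AddMonoidHom.ext fun p => Prod.ext (mul_smul _ _ _) (Subtype.ext ?_)
        change (p.2 : M) + ((w * v) • p.1 - p.1) = p.2 + (v • p.1 - p.1) + (w • v • p.1 - v • p.1)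
        rw [mul_smul]; abel }
  root i := (P.root i, P.rootSpanMem ℤ i)
  coroot i := (P.coroot' i).toAddMonoidHom.comp (AddMonoidHom.fst _ _)
  act_root w i := by
    refine Prod.ext (root_smul w i).symm (Subtype.ext ?_)
    change P.root i + (w • P.root i - P.root i) = P.root (w • i)
    rw [root_smul]; abel
  act_ofIdx i p := by
    refine Prod.ext (ofIdx_smul_root i p.1) (Subtype.ext ?_)
    change (p.2 : M) + (weylGroup.ofIdx P i • p.1 - p.1) =
      p.2 - P.coroot' i p.1 • P.root i
    rw [ofIdx_smul_root]; abel

variable [Finite ι] [P.IsReduced] [Module.Finite ℤ M] [Module.Free ℤ M] (b : P.Base)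

include b in
-- The second component of the root is taken in the root lattice, where it belongs to the basis `w`
-- (simple roots) for a suitable `w`; the functional is the corresponding coordinate.
theorem exists_apply_root_eq_one (i : ι) :
    ∃ c : M × P.rootSpan ℤ →+ ℤ, c ((extended P).root i) = 1 := by
  obtain ⟨l, j, rfl⟩ := exists_wordProd_smul_eq b i
  set w := wordProd b l
  let κ : P.rootSpan ℤ →+ ℤ := (b.toWeightBasisInt.coord j).toAddMonoidHom
  -- This is the action of `w⁻¹` on the root lattice, written as the identity plus the displacement.
  let τ : P.rootSpan ℤ →+ P.rootSpan ℤ := AddMonoidHom.id _ +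
    (displacement P w⁻¹).comp (P.rootSpan ℤ).subtype.toAddMonoidHom
  refine ⟨(κ.comp τ).comp (AddMonoidHom.snd _ _), ?_⟩
  have h : τ (P.rootSpanMem ℤ (w • (j : ι))) = b.toWeightBasisInt j := by
    refine Subtype.ext ?_
    rw [b.coe_toWeightBasisInt_apply]
    change P.root (w • (j : ι)) + (w⁻¹ • P.root (w • (j : ι)) - P.root (w • (j : ι))) = P.root j
    rw [root_smul, inv_smul_smul]; abel
  change κ (τ (P.rootSpanMem ℤ (w • (j : ι)))) = 1
  rw [h]
  change b.toWeightBasisInt.coord j (b.toWeightBasisInt j) = 1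
  simp

theorem eq_of_root_eq_zsmul {i j : ι} (hi : b.IsPos i) (hj : b.IsPos j) {k : ℤ}
    (h : P.root j = k • P.root i) : i = j := by
  by_contra hij
  have h1 : ¬ LinearIndependent ℤ ![P.root i, P.root j] := by
    rw [LinearIndependent.pair_iff]
    push Not
    exact ⟨k, -1, by rw [h]; simp, fun _ => by simp⟩
  rcases IsReduced.eq_or_eq_neg i j h1 with h2 | h2
  · exact hij (P.root.injective h2)
  · rw [← root_neg_index] at h2
    have h3 := P.root.injective h2
    rw [h3, isPos_neg_index] at hi
    exact hi hj

/-- The frame of the extended lattice over a domain of characteristic zero. -/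
def primeFrame [IsDomain R] [CharZero R] : PrimeFrame b (FGRing F (M × P.rootSpan ℤ)) where
  toReflectionFrame := (extended P).frame F fun i =>
    isRegular_x_of_apply_eq_one (exists_apply_root_eq_one b i).choose_spec
  prime_x i := prime_x (exists_apply_root_eq_one b i).choose_spec
  eq_of_dvd i j hi hj h := by
    obtain ⟨c, hc⟩ := exists_apply_root_eq_one b i
    exact eq_of_root_eq_zsmul b hi hj (congrArg Prod.fst ((x_dvd_x_iff hc _).1 h))
  exists_kappa i := by
    refine ⟨kappa F ((extended P).root i), ?_⟩
    have h : (extended P).root (weylGroup.ofIdx P i • i) = -(extended P).root i :=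
      Prod.ext (root_neg_index i) (Subtype.ext (root_neg_index i))
    change x F _ * x F ((extended P).root (weylGroup.ofIdx P i • i)) * _ =
      x F _ + x F ((extended P).root (weylGroup.ofIdx P i • i))
    rw [h]
    exact kappa_spec F _

end ReflectionLattice

end FormalGroupRing

end

/-! ### Change of the base ring and of the lattice. -/

noncomputable section

namespace FormalGroupRing

open RootPairing Topology

section BaseHom

variable {A R : Type*} [CommRing A] [CommRing R] (G : FormalGroup A) [G.IsComm] (φ : A →+* R)
  (M : Type*) [AddCommGroup M]

/-- The points of `F` over an algebra obtained by restriction of scalars. -/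
def mapPoint (μ : M) : letI : Algebra A (FGRing (G.map φ) M) := Algebra.compHom _ φ
    Point G (isTopNil_aug (G.map φ) M) :=
  ⟨x (G.map φ) μ, x_mem (G.map φ) μ⟩

/-- The change of the base ring of a formal group ring. -/
def baseHom : FGRing G M →+* FGRing (G.map φ) M :=
  letI : Algebra A (FGRing (G.map φ) M) := Algebra.compHom _ φ
  let f : M →+ Point G (isTopNil_aug (G.map φ) M) :=
    { toFun := mapPoint G φ M
      map_zero' := Subtype.ext (x_zero (G.map φ))
      map_add' := fun μ ν => Subtype.ext ((x_add (G.map φ) μ ν).trans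
        (evalPS_map φ (Point.hasEval_two (xHom (G.map φ) μ) (xHom (G.map φ) ν))
          G.toPowerSeries).symm) }
  (lift f : FGRing G M →ₐ[A] FGRing (G.map φ) M)

theorem continuous_baseHom : Continuous (baseHom G φ M) :=
  letI : Algebra A (FGRing (G.map φ) M) := Algebra.compHom _ φ
  continuous_lift _

theorem baseHom_algebraMap (a : A) : baseHom G φ M (algebraMap A _ a) = algebraMap R _ (φ a) :=
  letI : Algebra A (FGRing (G.map φ) M) := Algebra.compHom _ φ
  AlgHom.commutes (lift (F := G) _) a

variable {M} in
theorem baseHom_x (μ : M) : baseHom G φ M (x G μ) = x (G.map φ) μ :=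
  letI : Algebra A (FGRing (G.map φ) M) := Algebra.compHom _ φ
  lift_x (F := G) _ μ

variable {M} in
theorem baseHom_demazure (α : M) (c : M →+ ℤ) (u : FGRing G M) :
    baseHom G φ M (demazure G α c u) = demazure (G.map φ) α c (baseHom G φ M u) :=
  map_demazure G φ α c (baseHom G φ M) (continuous_baseHom G φ M) (baseHom_algebraMap G φ M)
    (baseHom_x G φ) u

/-- A ring homomorphism whose image contains `R` and the `x_μ` has a dense image. -/
theorem denseRange_of_x {B : Type*} [CommRing B] (F : FormalGroup R) (f : B →+* FGRing F M)
    (hR : ∀ r, algebraMap R _ r ∈ f.range) (hx : ∀ μ, x F μ ∈ f.range) : DenseRange f := by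
  have h1 : DenseRange fun p : PolyRing R M =>
      toFGRing F M (UniformSpace.Completion.coeRingHom p) :=
    (toFGRing_surjective F M).denseRange.comp UniformSpace.Completion.denseRange_coe
      (continuous_toFGRing F M)
  refine h1.mono ?_
  rintro _ ⟨p, rfl⟩
  change _ ∈ f.range
  let c : PolyRing R M →ₐ[R] PowerRing R M :=
      { (UniformSpace.Completion.coeRingHom : PolyRing R M →+* PowerRing R M) with
        commutes' := fun _ => rfl }
  let g : MvPolynomial M R →ₐ[R] FGRing F M := (toFGRing F M).comp c
  change g p ∈ f.range
  induction p using MvPolynomial.induction_on with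
  | C r => exact (g.commutes r).symm ▸ hR r
  | add p q hp hq => rw [map_add]; exact add_mem hp hq
  | mul_X p μ hp => rw [map_mul]; exact mul_mem hp (hx μ)

variable {M} in
/-- Continuous ring homomorphisms that agree on `R` and on the `x_μ` are equal. -/
theorem ringHom_eq {B : Type*} [CommRing B] [TopologicalSpace B] [T2Space B] {F : FormalGroup R}
    {f g : FGRing F M →+* B} (hf : Continuous f) (hg : Continuous g)
    (hR : ∀ r, f (algebraMap R _ r) = g (algebraMap R _ r)) (hx : ∀ μ, f (x F μ) = g (x F μ)) :
    f = g := by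
  have h : DenseRange (f.eqLocus g).subtype :=
    denseRange_of_x M F _ (fun r => ⟨⟨_, hR r⟩, rfl⟩) fun μ => ⟨⟨_, hx μ⟩, rfl⟩
  exact DFunLike.coe_injective (h.equalizer hf hg (funext fun u => u.2))

variable {M} in
-- Over a domain the operator is determined by its product with `x_{f α}`, which is nonzero as `f α
-- ≠ 0`; the two reflections correspond under `f`.
theorem mapHom_demazure [IsDomain A] [CharZero A] [Module.Finite ℤ M] [Module.Free ℤ M]
    {L : Type*} [AddCommGroup L] (f : L →+ M) {α : L} (hα : f α ≠ 0) {c : L →+ ℤ} {c' : M →+ ℤ}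
    (hc : ∀ μ, c' (f μ) = c μ) (u : FGRing G L) :
    mapHom G f (demazure G α c u) = demazure G (f α) c' (mapHom G f u) := by
  refine mul_left_cancel₀ (a := x G (f α)) (fun h => hα (x_eq_zero_iff.1 h)) ?_
  rw [x_mul_demazure, ← mapHom_x, ← map_mul, x_mul_demazure, map_sub, ← mapHom_comp_apply,
    ← mapHom_comp_apply]
  congr 3
  ext μ
  change f (μ - c μ • α) = f μ - c' (f μ) • f α
  rw [map_sub, map_zsmul, hc]

end BaseHom

/-! ### Relations between words over an arbitrary base ring. -/

section Words

variable {ι M N : Type*} [AddCommGroup M] [AddCommGroup N] {P : RootDatum ι M N} [Finite ι]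
  [P.IsReduced] (b : P.Base) {R : Type*} [CommRing R] (F : FormalGroup R) [F.IsComm]

theorem deltaWord_nil : deltaWord F b [] = 1 := rfl

theorem deltaWord_cons (i : b.support) (l : List b.support) :
    deltaWord F b (i :: l) = rootDelta P F i * deltaWord F b l := rfl

theorem cWord_nil : cWord F b [] = 1 := rfl

theorem continuous_deltaWord (l : List b.support) : Continuous (deltaWord F b l) := by
  induction l with
  | nil => exact continuous_id
  | cons i l ih => exact (continuous_demazure F _ _).comp ih

theorem continuous_ringAct {L : Type*} [AddCommGroup L] (Λ : ReflectionLattice P L)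
    (w : P.weylGroup) : Continuous (Λ.ringAct F w) := continuous_mapHom F (Λ.act w)

variable [Module.Finite ℤ M] [Module.Free ℤ M]

open ReflectionLattice

section Transport

variable {A : Type*} [CommRing A] [IsDomain A] [CharZero A] (G : FormalGroup A) [G.IsComm]
  (φ : A →+* R)

variable (P) in
/-- The homomorphism from the formal group ring of the extended lattice over `A` to the formal
group ring of the character lattice over `R`. -/
def transfer : FGRing G (M × P.rootSpan ℤ) →+* FGRing (G.map φ) M :=
  (baseHom G φ M).comp (mapHom G (AddMonoidHom.fst M (P.rootSpan ℤ)) :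
    FGRing G (M × P.rootSpan ℤ) →+* FGRing G M)

theorem transfer_apply (u : FGRing G (M × P.rootSpan ℤ)) : transfer P G φ u =
    baseHom G φ M (mapHom G (AddMonoidHom.fst M (P.rootSpan ℤ)) u) := rfl

theorem denseRange_transfer (hφ : Function.Surjective φ) : DenseRange (transfer P G φ) := by
  refine denseRange_of_x M (G.map φ) _ (fun r => ?_) fun μ => ?_
  · obtain ⟨a, rfl⟩ := hφ r
    refine ⟨algebraMap A _ a, ?_⟩
    rw [transfer_apply, AlgHom.commutes, baseHom_algebraMap]
  · refine ⟨x G (μ, 0), ?_⟩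
    rw [transfer_apply, mapHom_x, baseHom_x]; rfl

theorem transfer_delWord (l : List b.support) (u : FGRing G (M × P.rootSpan ℤ)) :
    transfer P G φ ((primeFrame G b).delWord b l u) =
      deltaWord (G.map φ) b l (transfer P G φ u) := by
  induction l with
  | nil => rfl
  | cons i l ih =>
    rw [ReflectionFrame.delWord_cons, deltaWord_cons, Module.End.mul_apply, ← ih, transfer_apply]
    have h : mapHom G (AddMonoidHom.fst M (P.rootSpan ℤ)) ((primeFrame G b).del (i : ι)
        ((primeFrame G b).delWord b l u)) = demazure G (P.root i) (P.coroot' i).toAddMonoidHom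
        (mapHom G (AddMonoidHom.fst M (P.rootSpan ℤ)) ((primeFrame G b).delWord b l u)) :=
      mapHom_demazure G _ (P.ne_zero i) (fun _ => rfl) _
    rw [h, baseHom_demazure]
    rfl

/-- Relations between the compositions of operators over the extended lattice give relations over
the character lattice. -/
theorem deltaWord_eq_of_delWord_eq [Fintype P.weylGroup] (hφ : Function.Surjective φ)
    {I : P.weylGroup → List b.support} {l : List b.support}
    {c : P.weylGroup → FGRing G (M × P.rootSpan ℤ)}
    (h : ∀ u, (primeFrame G b).delWord b l u = ∑ w, c w * (primeFrame G b).delWord b (I w) u) :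
    deltaWord (G.map φ) b l = ∑ w, transfer P G φ (c w) • deltaWord (G.map φ) b (I w) := by
  refine DFunLike.coe_injective ?_
  refine (denseRange_transfer (P := P) G φ hφ).equalizer (continuous_deltaWord b _ l) ?_ ?_
  · have h1 : ((∑ w, transfer P G φ (c w) • deltaWord (G.map φ) b (I w) :
        Module.End R (FGRing (G.map φ) M)) : FGRing (G.map φ) M → FGRing (G.map φ) M) =
        fun u => ∑ w, transfer P G φ (c w) * deltaWord (G.map φ) b (I w) u := by
      funext u
      rw [LinearMap.sum_apply]; rfl
    rw [h1]
    exact continuous_finsetSum _ fun w _ => continuous_const.mul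
      (continuous_deltaWord b (G.map φ) (I w))
  · funext u
    rw [Function.comp_apply, Function.comp_apply, ← transfer_delWord, h, map_sum,
      LinearMap.sum_apply]
    refine Finset.sum_congr rfl fun w _ => ?_
    rw [map_mul, transfer_delWord]; rfl

end Transport

variable {b} {I : P.weylGroup → List b.support}

/-- The composition of the operators along a reduced word, up to shorter words, depends only on the
product of the word. -/
theorem exists_deltaWord_eq [Fintype P.weylGroup]
    (hI : ∀ w, wordProd b (I w) = w ∧ (I w).length = weylLength b w) {l : List b.support}
    (hl : l.length = weylLength b (wordProd b l)) :
    ∃ c : P.weylGroup → FGRing F M, (∀ w, c w ≠ 0 → weylLength b w < l.length) ∧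
      deltaWord F b l = deltaWord F b (I (wordProd b l)) + ∑ w, c w • deltaWord F b (I w) := by
  classical
  -- From here on `F` is the reduction of a law over a domain of characteristic zero, where the
  -- prime frame exists.
  obtain ⟨G, φ, hG, hφ, rfl⟩ := exists_formalGroup_map_eq F
  obtain ⟨c, hc, h⟩ := PrimeFrame.exists_delWord_eq (D := primeFrame G b) hI hl
  refine ⟨fun w => transfer P G φ (c w), fun w hw => hc w fun h0 => hw (by simp only [h0, map_zero]), ?_⟩
  -- The leading term is absorbed into the sum as a coefficient `1`, so that the transfer of linear
  -- relations applies.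
  have h1 : ∀ u, (primeFrame G b).delWord b l u =
      ∑ w, ((if w = wordProd b l then 1 else 0) + c w) * (primeFrame G b).delWord b (I w) u := fun u => by
    simp only [add_mul, ite_mul, one_mul, zero_mul, Finset.sum_add_distrib, Finset.sum_ite_eq',
      Finset.mem_univ, if_true]
    exact h u
  rw [deltaWord_eq_of_delWord_eq b G φ hφ h1]
  simp only [map_add, add_smul, Finset.sum_add_distrib]
  congr 1
  rw [Finset.sum_eq_single (wordProd b l), if_pos rfl, map_one, one_smul]
  · intro w _ hw
    rw [if_neg hw, map_zero, zero_smul]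
  · intro h; exact absurd (Finset.mem_univ _) h

/-- The composition of the operators along a word that is not reduced is a combination of shorter
words. -/
theorem exists_deltaWord_eq_of_lt [Fintype P.weylGroup]
    (hI : ∀ w, wordProd b (I w) = w ∧ (I w).length = weylLength b w) {l : List b.support}
    (hl : weylLength b (wordProd b l) < l.length) :
    ∃ c : P.weylGroup → FGRing F M, (∀ w, c w ≠ 0 → weylLength b w < l.length) ∧
      deltaWord F b l = ∑ w, c w • deltaWord F b (I w) := by
  obtain ⟨G, φ, hG, hφ, rfl⟩ := exists_formalGroup_map_eq F
  obtain ⟨c, hc, h⟩ := PrimeFrame.exists_delWord_eq_of_lt (D := primeFrame G b) hI hl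
  exact ⟨fun w => transfer P G φ (c w), fun w hw => hc w fun h0 => hw (by simp only [h0, map_zero]),
    deltaWord_eq_of_delWord_eq b G φ hφ h⟩

/-- The operators `Δ_α` are equivariant under the Weyl group. -/
theorem rootDelta_smul (w : P.weylGroup) (i : ι) (u : FGRing F M) :
    rootDelta P F (w • i) ((ReflectionLattice.self P).ringAct F w u) =
      (ReflectionLattice.self P).ringAct F w (rootDelta P F i u) := by
  obtain ⟨G, φ, hG, hφ, rfl⟩ := exists_formalGroup_map_eq F
  have hact : ∀ u, (ReflectionLattice.self P).ringAct (G.map φ) w (baseHom G φ M u) =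
      baseHom G φ M ((ReflectionLattice.self P).ringAct G w u) := by
    refine fun u => DFunLike.congr_fun (ringHom_eq
      (f := ((ReflectionLattice.self P).ringAct (G.map φ) w).comp (baseHom G φ M))
      (g := (baseHom G φ M).comp ((ReflectionLattice.self P).ringAct G w))
      ((continuous_ringAct (G.map φ) (ReflectionLattice.self P) w).comp (continuous_baseHom G φ M))
      ((continuous_baseHom G φ M).comp (continuous_ringAct G (ReflectionLattice.self P) w)) (fun r => ?_) fun μ => ?_) u
    · rw [RingHom.comp_apply, RingHom.comp_apply, baseHom_algebraMap, ringAct_apply, ringAct_apply,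
        AlgHom.commutes, AlgHom.commutes, baseHom_algebraMap]
    · rw [RingHom.comp_apply, RingHom.comp_apply, baseHom_x, ringAct_apply, ringAct_apply]
      refine (mapHom_x _ ((ReflectionLattice.self P).act w) μ).trans ?_
      refine Eq.trans ?_ (congrArg (baseHom G φ M)
        (mapHom_x G ((ReflectionLattice.self P).act w) μ).symm)
      exact (baseHom_x G φ _).symm
  have hdense : DenseRange (baseHom G φ M) := by
    refine denseRange_of_x M (G.map φ) _ (fun r => ?_) fun μ => ?_
    · obtain ⟨a, rfl⟩ := hφ r
      exact ⟨algebraMap _ _ a, baseHom_algebraMap G φ M a⟩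
    · exact ⟨x G μ, baseHom_x G φ μ⟩
  refine congrFun (hdense.equalizer (g := fun u => rootDelta P (G.map φ) (w • i)
    ((ReflectionLattice.self P).ringAct (G.map φ) w u)) (h := fun u =>
    (ReflectionLattice.self P).ringAct (G.map φ) w (rootDelta P (G.map φ) i u)) ?_ ?_ ?_) u
  · exact (continuous_demazure _ _ _).comp (continuous_ringAct (G.map φ) (ReflectionLattice.self P) w)
  · exact (continuous_ringAct (G.map φ) (ReflectionLattice.self P) w).comp (continuous_demazure _ _ _)
  · funext u
    simp only [Function.comp_apply]
    rw [hact, rootDelta, rootDelta, ← baseHom_demazure, ← baseHom_demazure, hact]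
    congr 1
    have h2 : (ReflectionLattice.self P).act w (P.root i) = P.root (w • i) :=
      (ReflectionLattice.self P).act_root w i
    have h := mapHom_demazure G ((ReflectionLattice.self P).act w) (α := P.root i)
      (c := (P.coroot' i).toAddMonoidHom) (c' := (P.coroot' (w • i)).toAddMonoidHom)
      (fun h0 => P.ne_zero (w • i) (h2.symm.trans h0)) (coroot'_smul w i) u
    exact (h.trans (congrArg (fun α => demazure G α (P.coroot' (w • i)).toAddMonoidHom
      (mapHom G ((ReflectionLattice.self P).act w) u)) h2)).symm

end Words

end FormalGroupRing

end

/-! ### Generation of the operator algebra. -/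

noncomputable section

namespace FormalGroupRing

open RootPairing

variable {ι M N : Type*} [AddCommGroup M] [AddCommGroup N] {P : RootDatum ι M N} [Finite ι]
  [P.IsReduced] (b : P.Base) {R : Type*} [CommRing R] (F : FormalGroup R) [F.IsComm]

theorem mulLeft_mul_eq_smul (u : FGRing F M) (T : Module.End R (FGRing F M)) :
    LinearMap.mulLeft R u * T = u • T := LinearMap.ext fun _ => rfl

/-- The Leibniz rule as a commutation rule: it moves a multiplication to the left of `Δ` at the cost
of a term without `Δ`. -/
theorem rootDelta_mul_smul (i : ι) (u : FGRing F M) (T : Module.End R (FGRing F M)) :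
    rootDelta P F i * (u • T) = rootDelta P F i u • T +
      (u - x F (P.root i) * rootDelta P F i u) • (rootDelta P F i * T) := by
  refine LinearMap.ext fun v => ?_
  change demazure F _ _ (u * T v) = demazure F _ _ u * T v +
    (u - x F (P.root i) * demazure F _ _ u) * demazure F _ _ (T v)
  rw [demazure_mul]; ring

variable (P) in
/-- The action of an element of the Weyl group on the formal group ring, as a linear map. -/
def weylEnd (w : P.weylGroup) : Module.End R (FGRing F M) :=
  (mapHom F ((ReflectionLattice.self P).act w)).toLinearMap

theorem weylEnd_apply (w : P.weylGroup) (u : FGRing F M) :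
    weylEnd P F w u = (ReflectionLattice.self P).ringAct F w u := rfl

theorem weylEnd_one : weylEnd P F 1 = 1 := LinearMap.ext fun u => by
  rw [weylEnd_apply, map_one]; rfl

theorem weylEnd_mul (w v : P.weylGroup) : weylEnd P F (w * v) = weylEnd P F w * weylEnd P F v :=
  LinearMap.ext fun u => by
    rw [Module.End.mul_apply, weylEnd_apply, weylEnd_apply, weylEnd_apply, map_mul]; rfl

theorem weylEnd_ofIdx (i : ι) : weylEnd P F (weylGroup.ofIdx P i) =
    1 - x F (P.root i) • rootDelta P F i := by
  refine LinearMap.ext fun u => ?_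
  have h := x_mul_demazure F (P.root i) (P.coroot' i).toAddMonoidHom u
  change mapHom F ((ReflectionLattice.self P).act (weylGroup.ofIdx P i)) u =
    u - x F (P.root i) * demazure F (P.root i) (P.coroot' i).toAddMonoidHom u
  rw [h, sub_sub_cancel, ReflectionLattice.act_ofIdx_eq]
  rfl

section Span

variable (I : P.weylGroup → List b.support)

/-- The span of the operators attached to the elements of length less than `k`. -/
def deltaSpan (k : ℕ) : Submodule (FGRing F M) (Module.End R (FGRing F M)) :=
  Submodule.span _ ((fun w => deltaWord F b (I w)) '' {w | weylLength b w < k})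

theorem deltaSpan_mono {k k' : ℕ} (h : k ≤ k') : deltaSpan b F I k ≤ deltaSpan b F I k' :=
  Submodule.span_mono (Set.image_mono fun _ hw => lt_of_lt_of_le hw h)

theorem deltaSpan_le (k : ℕ) : deltaSpan b F I k ≤
    Submodule.span _ (Set.range fun w => deltaWord F b (I w)) :=
  Submodule.span_mono (Set.image_subset_range _ _)

variable {b I} [Module.Finite ℤ M] [Module.Free ℤ M]

/-- The filtration by length thus contains all words, reduced or not, and does not depend on the
chosen decompositions. -/
theorem deltaWord_mem_deltaSpan
    (hI : ∀ w, wordProd b (I w) = w ∧ (I w).length = weylLength b w) (l : List b.support) {k : ℕ}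
    (hk : l.length < k) : deltaWord F b l ∈ deltaSpan b F I k := by
  have := finite_weylGroup b
  let _ : Fintype P.weylGroup := Fintype.ofFinite _
  have key : ∀ c : P.weylGroup → FGRing F M, (∀ w, c w ≠ 0 → weylLength b w < l.length) →
      ∑ w, c w • deltaWord F b (I w) ∈ deltaSpan b F I k := by
    intro c hc
    refine Submodule.sum_mem _ fun w _ => ?_
    by_cases h : c w = 0
    · rw [h, zero_smul]; exact Submodule.zero_mem _
    · exact Submodule.smul_mem _ _ (Submodule.subset_span ⟨w, (hc w h).trans hk, rfl⟩)
  rcases (weylLength_le b l).eq_or_lt with h | h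
  · obtain ⟨c, hc, h1⟩ := exists_deltaWord_eq F hI h.symm
    rw [h1]
    refine Submodule.add_mem _ (Submodule.subset_span ⟨_, ?_, rfl⟩) (key c hc)
    exact h.trans_lt hk
  · obtain ⟨c, hc, h1⟩ := exists_deltaWord_eq_of_lt F hI h
    rw [h1]
    exact key c hc

theorem rootDelta_mul_mem_deltaSpan
    (hI : ∀ w, wordProd b (I w) = w ∧ (I w).length = weylLength b w) (i : b.support) {k : ℕ}
    {T : Module.End R (FGRing F M)} (hT : T ∈ deltaSpan b F I k) :
    rootDelta P F i * T ∈ deltaSpan b F I (k + 1) := by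
  induction hT using Submodule.span_induction with
  | mem T hT =>
    obtain ⟨w, hw, rfl⟩ := hT
    have hw' : weylLength b w < k := hw
    refine deltaWord_mem_deltaSpan F hI (i :: I w) ?_
    rw [List.length_cons, (hI w).2]; omega
  | zero => rw [mul_zero]; exact Submodule.zero_mem _
  | add T T' _ _ h h' => rw [mul_add]; exact Submodule.add_mem _ h h'
  | smul u T hT h =>
    rw [rootDelta_mul_smul]
    exact Submodule.add_mem _ (Submodule.smul_mem _ _ (deltaSpan_mono b F I (Nat.le_succ k) hT))
      (Submodule.smul_mem _ _ h)

variable (b I) in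
theorem deltaSpan_eq_span_range :
    ∃ k, ∀ k', k ≤ k' → deltaSpan b F I k' =
      Submodule.span _ (Set.range fun w => deltaWord F b (I w)) := by
  have := finite_weylGroup b
  obtain ⟨k, hk⟩ := (Set.finite_range (weylLength b)).bddAbove
  refine ⟨k + 1, fun k' hk' => le_antisymm (deltaSpan_le b F I _) (Submodule.span_le.2 ?_)⟩
  rintro _ ⟨w, rfl⟩
  refine Submodule.subset_span ⟨w, ?_, rfl⟩
  have : weylLength b w ≤ k := hk ⟨w, rfl⟩
  exact lt_of_lt_of_le (Nat.lt_succ_of_le this) hk'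

/-- The span is stable under simple operators, since a letter raises the filtration by one and the
filtration is eventually constant. As `s_i = 1 - x_i Δ_i`, it is stable under the Weyl group, and by
`Δ_{wα} = w Δ_α w⁻¹` under all generators of the algebra. It contains the empty word `1`. -/
theorem span_deltaWord_eq
    (hI : ∀ w, wordProd b (I w) = w ∧ (I w).length = weylLength b w) :
    Submodule.span (FGRing F M) (Set.range fun w => deltaWord F b (I w)) = operatorModule P F := by
  obtain ⟨k, hk⟩ := deltaSpan_eq_span_range b F I
  set V := Submodule.span (FGRing F M) (Set.range fun w => deltaWord F b (I w)) with hV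
  have hsimple : ∀ (i : b.support) (T), T ∈ V → rootDelta P F i * T ∈ V := by
    intro i T hT
    rw [← hk k le_rfl] at hT
    rw [← hk (k + 1) (Nat.le_succ k)]
    exact rootDelta_mul_mem_deltaSpan F hI i hT
  have hweyl : ∀ (w : P.weylGroup) (T), T ∈ V → weylEnd P F w * T ∈ V := by
    intro w
    obtain ⟨l, rfl⟩ := exists_wordProd_eq b w
    induction l with
    | nil => intro T hT; rwa [wordProd_nil, weylEnd_one, one_mul]
    | cons i l ih =>
      intro T hT
      rw [wordProd_cons, weylEnd_mul, mul_assoc, weylEnd_ofIdx, sub_mul, one_mul, smul_mul_assoc]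
      exact V.sub_mem (ih T hT) (V.smul_mem _ (hsimple i _ (ih T hT)))
  have hroot : ∀ (i : ι) (T), T ∈ V → rootDelta P F i * T ∈ V := by
    intro i T hT
    obtain ⟨l, j, rfl⟩ := exists_wordProd_smul_eq b i
    have h : rootDelta P F (wordProd b l • (j : ι)) = weylEnd P F (wordProd b l) *
        (rootDelta P F j * weylEnd P F (wordProd b l)⁻¹) := by
      have h1 : rootDelta P F (wordProd b l • (j : ι)) * weylEnd P F (wordProd b l) =
          weylEnd P F (wordProd b l) * rootDelta P F j :=
        LinearMap.ext fun u => rootDelta_smul F (wordProd b l) j u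
      rw [← mul_assoc, ← h1, mul_assoc, ← weylEnd_mul, mul_inv_cancel, weylEnd_one, mul_one]
    rw [h, mul_assoc, mul_assoc]
    exact hweyl _ _ (hsimple _ _ (hweyl _ _ hT))
  have hone : (1 : Module.End R (FGRing F M)) ∈ V :=
    deltaSpan_le b F I 1 (deltaWord_mem_deltaSpan F hI [] Nat.one_pos)
  refine le_antisymm (Submodule.span_le.2 ?_) fun T hT => ?_
  · rintro _ ⟨w, rfl⟩
    change deltaWord F b (I w) ∈ operatorAlgebra P F
    induction I w with
    | nil => exact one_mem _
    | cons i l ih =>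
      exact mul_mem (Algebra.subset_adjoin (Or.inl ⟨(i : ι), rfl⟩)) ih
  · have hT' : T ∈ operatorAlgebra P F := hT
    -- Stability of `V` under left composition is proved for all operators of the algebra; it is
    -- then applied to `1`.
    have h : ∀ T' ∈ V, T * T' ∈ V := by
      clear hT
      induction hT' using Algebra.adjoin_induction with
      | mem T hT =>
        intro T' hT'
        rcases hT with ⟨i, rfl⟩ | ⟨u, rfl⟩
        · exact hroot i T' hT'
        · rw [mulLeft_mul_eq_smul]; exact V.smul_mem _ hT'
      | algebraMap r =>
        intro T' hT'
        have h1 : algebraMap R (Module.End R (FGRing F M)) r * T' =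
            algebraMap R (FGRing F M) r • T' :=
          LinearMap.ext fun v => Algebra.smul_def r (T' v)
        rw [h1]; exact V.smul_mem _ hT'
      | add S T _ _ hS hT =>
        intro T' hT'
        rw [add_mul]; exact V.add_mem (hS T' hT') (hT T' hT')
      | mul S T _ _ hS hT =>
        intro T' hT'
        rw [mul_assoc]; exact hS _ (hT T' hT')
    simpa using h 1 hone

/-- In `C_i = κ_i - Δ_i` the multiplication by `κ_i` does not raise the length, so the leading part
of a `C`-word is the `Δ`-word up to sign. -/
theorem cWord_sub_mem_deltaSpan
    (hI : ∀ w, wordProd b (I w) = w ∧ (I w).length = weylLength b w) (l : List b.support) :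
    cWord F b l - (-1 : FGRing F M) ^ l.length • deltaWord F b l ∈ deltaSpan b F I l.length := by
  induction l with
  | nil =>
    rw [cWord_nil, deltaWord_nil, List.length_nil, pow_zero, one_smul, sub_self]
    exact Submodule.zero_mem _
  | cons i l ih =>
    have h1 : cWord F b l ∈ deltaSpan b F I (l.length + 1) := by
      rw [← sub_add_cancel (cWord F b l) ((-1 : FGRing F M) ^ l.length • deltaWord F b l)]
      exact Submodule.add_mem _ (deltaSpan_mono b F I (Nat.le_succ _) ih)
        (Submodule.smul_mem _ _ (deltaWord_mem_deltaSpan F hI l (Nat.lt_succ_self _)))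
    have h2 := rootDelta_mul_mem_deltaSpan F hI i ih
    have h3 : rootDelta P F (i : ι) * ((-1 : FGRing F M) ^ l.length • deltaWord F b l) =
        (-1 : FGRing F M) ^ l.length • deltaWord F b (i :: l) := by
      rw [deltaWord_cons]
      refine LinearMap.ext fun v => ?_
      change rootDelta P F (i : ι) ((-1 : FGRing F M) ^ l.length * deltaWord F b l v) =
        (-1 : FGRing F M) ^ l.length * rootDelta P F i (deltaWord F b l v)
      rcases neg_one_pow_eq_or (FGRing F M) l.length with h | h <;> rw [h]
      · rw [one_mul, one_mul]
      · rw [neg_one_mul, neg_one_mul, map_neg]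
    have h4 : cWord F b (i :: l) - (-1 : FGRing F M) ^ (i :: l).length • deltaWord F b (i :: l) =
        kappa F (P.root i) • cWord F b l - rootDelta P F i *
          (cWord F b l - (-1 : FGRing F M) ^ l.length • deltaWord F b l) := by
      rw [mul_sub, h3]
      refine LinearMap.ext fun v => ?_
      change kappa F (P.root i) * cWord F b l v - rootDelta P F i (cWord F b l v) -
        (-1) ^ (l.length + 1) * deltaWord F b (i :: l) v = kappa F (P.root i) * cWord F b l v -
        (rootDelta P F i (cWord F b l v) - (-1) ^ l.length * deltaWord F b (i :: l) v)
      ring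
    rw [h4]
    exact Submodule.sub_mem _ (Submodule.smul_mem _ _ h1) h2

theorem span_cWord_eq
    (hI : ∀ w, wordProd b (I w) = w ∧ (I w).length = weylLength b w) :
    Submodule.span (FGRing F M) (Set.range fun w => cWord F b (I w)) = operatorModule P F := by
  rw [← span_deltaWord_eq F hI]
  obtain ⟨k, hk⟩ := deltaSpan_eq_span_range b F I
  refine le_antisymm (Submodule.span_le.2 ?_) ?_
  · rintro _ ⟨w, rfl⟩
    have h := deltaSpan_le b F I _ (cWord_sub_mem_deltaSpan F hI (I w))
    have h2 : (-1 : FGRing F M) ^ (I w).length • deltaWord F b (I w) ∈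
        Submodule.span (FGRing F M) (Set.range fun w => deltaWord F b (I w)) :=
      Submodule.smul_mem _ _ (Submodule.subset_span ⟨w, rfl⟩)
    simpa using Submodule.add_mem _ h h2
  · rw [← hk k le_rfl]
    clear hk
    induction k with
    | zero =>
      refine Submodule.span_le.2 ?_
      rintro _ ⟨w, hw, rfl⟩
      exact absurd hw (Nat.not_lt_zero _)
    | succ k ih =>
      refine Submodule.span_le.2 ?_
      rintro _ ⟨w, hw, rfl⟩
      have hw' : weylLength b w < k + 1 := hw
      have h1 := ih (deltaSpan_mono b F I (by rw [(hI w).2]; omega)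
        (cWord_sub_mem_deltaSpan F hI (I w)))
      have h2 : cWord F b (I w) ∈
          Submodule.span (FGRing F M) (Set.range fun w => cWord F b (I w)) :=
        Submodule.subset_span ⟨w, rfl⟩
      have h3 := Submodule.smul_mem _ ((-1 : FGRing F M) ^ (I w).length)
        (Submodule.sub_mem _ h2 h1)
      rw [sub_sub_cancel, smul_smul, ← mul_pow, neg_one_mul, neg_neg, one_pow, one_smul] at h3
      exact h3

/-- A spanning family indexed by the same finite type as a basis is a basis. -/
theorem exists_basis_of_span {S V W : Type*} [CommRing S] [AddCommGroup V] [Module S V] [Finite W]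
    (B : Module.Basis W S V) {v : W → V} (hv : Submodule.span S (Set.range v) = ⊤) :
    ∃ C : Module.Basis W S V, ∀ w, C w = v w := by
  -- Read in the basis, the spanning family gives a surjective endomorphism of a finite module over
  -- a commutative ring, which is injective.
  have h1 : Function.Surjective (B.repr.toLinearMap ∘ₗ Finsupp.linearCombination S v) := by
    refine B.repr.surjective.comp ?_
    rw [← LinearMap.range_eq_top, Finsupp.range_linearCombination, hv]
  have h2 := OrzechProperty.injective_of_surjective_endomorphism _ h1
  have h3 : LinearIndependent S v := by
    intro f g hfg
    exact h2 (congrArg B.repr hfg)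
  exact ⟨Module.Basis.mk h3 hv.ge, fun w => Module.Basis.mk_apply h3 hv.ge w⟩

theorem exists_basis_of_linearIndependent
    (hI : ∀ w, wordProd b (I w) = w ∧ (I w).length = weylLength b w)
    (h : LinearIndependent (FGRing F M) fun w => deltaWord F b (I w)) :
    (∃ B : Module.Basis P.weylGroup (FGRing F M) (operatorModule P F),
        ∀ w, (B w : Module.End R (FGRing F M)) = deltaWord F b (I w)) ∧
      (∃ B : Module.Basis P.weylGroup (FGRing F M) (operatorModule P F),
        ∀ w, (B w : Module.End R (FGRing F M)) = cWord F b (I w)) := by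
  have := finite_weylGroup b
  let B : Module.Basis P.weylGroup (FGRing F M) (operatorModule P F) :=
    (Module.Basis.span h).map (LinearEquiv.ofEq _ _ (span_deltaWord_eq F hI))
  have hB : ∀ w, (B w : Module.End R (FGRing F M)) = deltaWord F b (I w) := fun w => by
    rw [Module.Basis.map_apply, LinearEquiv.coe_ofEq_apply, Module.Basis.span_apply]
  refine ⟨⟨B, hB⟩, ?_⟩
  have hc : ∀ w, cWord F b (I w) ∈ operatorModule P F := fun w => by
    rw [← span_cWord_eq F hI]; exact Submodule.subset_span ⟨w, rfl⟩
  obtain ⟨C, hC⟩ := exists_basis_of_span (S := FGRing F M) (V := operatorModule P F)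
    (W := P.weylGroup) B (v := fun w => ⟨cWord F b (I w), hc w⟩) (by
    refine Submodule.map_injective_of_injective (operatorModule P F).injective_subtype ?_
    rw [Submodule.map_span, Submodule.map_top, Submodule.range_subtype, ← Set.range_comp]
    exact span_cWord_eq F hI)
  exact ⟨C, fun w => by rw [hC]⟩

end Span

end FormalGroupRing

end

/-! ### Leading forms: comparison with the additive law. -/

noncomputable section

namespace FormalGroupRing

open RootPairing

section Graded

variable {R : Type*} [CommRing R] (F : FormalGroup R) [F.IsComm] {M : Type*} [AddCommGroup M]

theorem demazure_one (α : M) (c : M →+ ℤ) : demazure F α c 1 = 0 := by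
  have h := congrArg Twisted.im (map_one (demazureHom F α c))
  rw [demazureHom_apply] at h
  exact neg_eq_zero.1 h

/-- The quadratic term of the Leibniz rule is hidden in the reflected variable, which suits an
induction on monomials. -/
theorem demazure_x_mul (α : M) (c : M →+ ℤ) (μ : M) (u : FGRing F M) :
    demazure F α c (x F μ * u) =
      demazure F α c (x F μ) * u + x F (reflHom α c μ) * demazure F α c u := by
  have h := x_mul_demazure F α c (x F μ)
  rw [mapHom_x] at h
  rw [demazure_mul]
  linear_combination (-demazure F α c u) * h

theorem demazure_mem_pow_ker_aug (α : M) (c : M →+ ℤ) {k : ℕ} {u : FGRing F M}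
    (hu : u ∈ RingHom.ker (aug F M) ^ (k + 1)) :
    demazure F α c u ∈ RingHom.ker (aug F M) ^ k := by
  induction k generalizing u with
  | zero => rw [pow_zero, Ideal.one_eq_top]; trivial
  | succ k ih =>
    rw [pow_succ'] at hu
    refine Submodule.mul_induction_on hu (fun v hv w hw => ?_) fun v w hv hw => ?_
    · have h : demazure F α c (v * w) = demazure F α c v * w +
          (v - x F α * demazure F α c v) * demazure F α c w := by rw [demazure_mul]; ring
      rw [h]
      refine Ideal.add_mem _ (Ideal.mul_mem_left _ _ hw) ?_
      rw [pow_succ']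
      exact Ideal.mul_mem_mul (Ideal.sub_mem _ hv (Ideal.mul_mem_right _ _ (x_mem F α))) (ih hw)
    · rw [map_add]; exact Ideal.add_mem _ hv hw

variable [Module.Finite ℤ M] [Module.Free ℤ M]

theorem x_additive_add (μ ν : M) : x (FormalGroup.𝔾ₐ : FormalGroup ℤ) (μ + ν) =
    x FormalGroup.𝔾ₐ μ + x FormalGroup.𝔾ₐ ν := by
  rw [x_add]
  have h := Point.hasEval_two (xHom (FormalGroup.𝔾ₐ : FormalGroup ℤ) μ) (xHom FormalGroup.𝔾ₐ ν)
  change evalPS _ (MvPowerSeries.X 0 + MvPowerSeries.X 1) = _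
  refine (evalHom_apply h _).symm.trans ?_
  rw [map_add, evalHom_apply, evalHom_apply, evalPS_X, evalPS_X]
  rfl

/-- For the additive law `x` is additive, so `x_μ - x_{sμ}` is exactly `c(μ) x_α`; for other laws
this holds only after augmentation. -/
theorem demazure_additive_x {α : M} (hα : α ≠ 0) (c : M →+ ℤ) (μ : M) :
    demazure (FormalGroup.𝔾ₐ : FormalGroup ℤ) α c (x FormalGroup.𝔾ₐ μ) = (c μ : FGRing _ M) := by
  let xa : M →+ FGRing (FormalGroup.𝔾ₐ : FormalGroup ℤ) M :=
    AddMonoidHom.mk' (x FormalGroup.𝔾ₐ) x_additive_add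
  have h := x_mul_demazure FormalGroup.𝔾ₐ α c (x (FormalGroup.𝔾ₐ : FormalGroup ℤ) μ)
  rw [mapHom_x] at h
  have h1 : xa μ - xa (μ - c μ • α) = c μ • xa α := by
    rw [← map_sub, sub_sub_cancel, map_zsmul]
  refine mul_left_cancel₀ (mt x_eq_zero_iff.1 hα) (h.trans (h1.trans ?_))
  rw [zsmul_eq_mul, mul_comm]
  rfl

/-- The pairs of an element of `ℤ⟦M⟧` for the additive formal group law and an element of
`R⟦M⟧_F` which are given by the same homogeneous polynomial of degree `k` in the `x_μ`, the
second one up to terms of degree greater than `k`. -/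
def gradedPairs (k : ℕ) :
    AddSubgroup (FGRing (FormalGroup.𝔾ₐ : FormalGroup ℤ) M × FGRing F M) :=
  AddSubgroup.closure
    ({p | ∃ l : List M, l.length = k ∧
      p = ((l.map (x FormalGroup.𝔾ₐ)).prod, (l.map (x F)).prod)} ∪
    {p | p.1 = 0 ∧ p.2 ∈ RingHom.ker (aug F M) ^ (k + 1)})

variable {F}

theorem mem_pow_of_mem_gradedPairs {k : ℕ}
    {p : FGRing (FormalGroup.𝔾ₐ : FormalGroup ℤ) M × FGRing F M} (hp : p ∈ gradedPairs F k) :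
    p.2 ∈ RingHom.ker (aug F M) ^ k := by
  induction hp using AddSubgroup.closure_induction with
  | mem p hp =>
    rcases hp with ⟨l, rfl, rfl⟩ | ⟨-, h⟩
    · change (l.map (x F)).prod ∈ _
      induction l with
      | nil => rw [List.length_nil, pow_zero, Ideal.one_eq_top]; trivial
      | cons μ l ih =>
        rw [List.map_cons, List.prod_cons, List.length_cons, pow_succ']
        exact Ideal.mul_mem_mul (x_mem F μ) ih
    · exact Ideal.pow_le_pow_right (Nat.le_succ k) h
  | zero => exact Ideal.zero_mem _
  | add p q _ _ hp hq => exact Ideal.add_mem _ hp hq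
  | neg p _ hp => exact (Ideal.neg_mem_iff _).2 hp

theorem x_mul_mem_gradedPairs (μ : M) {k : ℕ}
    {p : FGRing (FormalGroup.𝔾ₐ : FormalGroup ℤ) M × FGRing F M} (hp : p ∈ gradedPairs F k) :
    (x FormalGroup.𝔾ₐ μ * p.1, x F μ * p.2) ∈ gradedPairs F (k + 1) := by
  induction hp using AddSubgroup.closure_induction with
  | mem p hp =>
    refine AddSubgroup.subset_closure ?_
    rcases hp with ⟨l, rfl, rfl⟩ | ⟨h1, h2⟩
    · exact Or.inl ⟨μ :: l, rfl, rfl⟩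
    · refine Or.inr ⟨?_, ?_⟩
      · change _ * p.1 = 0
        rw [h1, mul_zero]
      · rw [pow_succ']; exact Ideal.mul_mem_mul (x_mem F μ) h2
  | zero =>
    rw [Prod.fst_zero, Prod.snd_zero, mul_zero, mul_zero]
    exact AddSubgroup.zero_mem _
  | add p q _ _ hp hq => simpa [mul_add] using AddSubgroup.add_mem _ hp hq
  | neg p _ hp => simpa [mul_neg] using AddSubgroup.neg_mem _ hp

/-- The product rule has the same shape for both laws, and the operators agree on the `x_μ` up to
the augmentation ideal. Hence they act in the same way on leading forms, lowering the degree by one.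
-/
theorem demazure_mem_gradedPairs {α : M} (hα : α ≠ 0) (c : M →+ ℤ) {k : ℕ}
    {p : FGRing (FormalGroup.𝔾ₐ : FormalGroup ℤ) M × FGRing F M} (hp : p ∈ gradedPairs F (k + 1)) :
    (demazure FormalGroup.𝔾ₐ α c p.1, demazure F α c p.2) ∈ gradedPairs F k := by
  induction hp using AddSubgroup.closure_induction with
  | mem p hp =>
    rcases hp with ⟨l, hl, rfl⟩ | ⟨h1, h2⟩
    · induction l generalizing k with
      | nil => exact absurd hl (Nat.succ_ne_zero k).symm
      | cons μ l ih =>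
        obtain rfl : l.length = k := Nat.succ.inj hl
        have h1 : (x FormalGroup.𝔾ₐ (reflHom α c μ) *
              demazure FormalGroup.𝔾ₐ α c (l.map (x FormalGroup.𝔾ₐ)).prod,
            x F (reflHom α c μ) * demazure F α c (l.map (x F)).prod) ∈ gradedPairs F l.length := by
          -- An empty product is killed by the operators; the induction hypothesis applies only to
          -- monomials of positive degree.
          cases l with
          | nil =>
            simp only [List.map_nil, List.prod_nil, demazure_one, mul_zero]
            exact AddSubgroup.zero_mem _
          | cons ν l => exact x_mul_mem_gradedPairs _ (ih rfl)
        have h2 : ((l.map (x FormalGroup.𝔾ₐ)).prod, (l.map (x F)).prod) ∈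
            gradedPairs F l.length :=
          AddSubgroup.subset_closure (Or.inl ⟨l, rfl, rfl⟩)
        -- The error `Δ(x_μ) - c(μ)` has augmentation zero, so its product with the remaining
        -- monomial is of higher degree and pairs with `0`.
        have h3 : ((0 : FGRing (FormalGroup.𝔾ₐ : FormalGroup ℤ) M),
            (demazure F α c (x F μ) - c μ) * (l.map (x F)).prod) ∈ gradedPairs F l.length := by
          refine AddSubgroup.subset_closure (Or.inr ⟨rfl, ?_⟩)
          rw [pow_succ']
          refine Ideal.mul_mem_mul ?_ (mem_pow_of_mem_gradedPairs h2)
          rw [RingHom.mem_ker, map_sub, aug_demazure_x, map_intCast, sub_self]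
        have h4 := AddSubgroup.add_mem _ (AddSubgroup.add_mem _
          (AddSubgroup.zsmul_mem _ h2 (c μ)) h3) h1
        convert h4 using 1
        refine Prod.ext ?_ ?_
        · change demazure FormalGroup.𝔾ₐ α c (x FormalGroup.𝔾ₐ μ * (l.map (x FormalGroup.𝔾ₐ)).prod) =
            c μ • (l.map (x FormalGroup.𝔾ₐ)).prod + 0 + x FormalGroup.𝔾ₐ (reflHom α c μ) *
              demazure FormalGroup.𝔾ₐ α c (l.map (x FormalGroup.𝔾ₐ)).prod
          rw [demazure_x_mul, demazure_additive_x hα, zsmul_eq_mul, add_zero]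
        · change demazure F α c (x F μ * (l.map (x F)).prod) = c μ • (l.map (x F)).prod +
            (demazure F α c (x F μ) - c μ) * (l.map (x F)).prod +
              x F (reflHom α c μ) * demazure F α c (l.map (x F)).prod
          rw [demazure_x_mul, zsmul_eq_mul]
          ring
    · refine AddSubgroup.subset_closure (Or.inr ⟨?_, demazure_mem_pow_ker_aug F α c h2⟩)
      change demazure _ α c p.1 = 0
      rw [h1, map_zero]
  | zero =>
    rw [Prod.fst_zero, Prod.snd_zero, map_zero, map_zero]
    exact AddSubgroup.zero_mem _
  | add p q _ _ hp hq => simpa [map_add] using AddSubgroup.add_mem _ hp hq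
  | neg p _ hp => simpa [map_neg] using AddSubgroup.neg_mem _ hp

theorem aug_of_mem_gradedPairs_zero
    {p : FGRing (FormalGroup.𝔾ₐ : FormalGroup ℤ) M × FGRing F M} (hp : p ∈ gradedPairs F 0) :
    aug F M p.2 = (aug FormalGroup.𝔾ₐ M p.1 : ℤ) ∧
      ∀ (α : M) (c : M →+ ℤ), demazure FormalGroup.𝔾ₐ α c p.1 = 0 := by
  induction hp using AddSubgroup.closure_induction with
  | mem p hp =>
    rcases hp with ⟨l, hl, rfl⟩ | ⟨h1, h2⟩
    · obtain rfl : l = [] := List.length_eq_zero_iff.1 hl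
      simp [demazure_one]
    · rw [h1]
      rw [zero_add, pow_one] at h2
      exact ⟨by rw [map_zero, Int.cast_zero]; exact h2, fun α c => map_zero _⟩
  | zero => simp
  | add p q _ _ hp hq => simp [hp, hq]
  | neg p _ hp => simp [hp]

variable (F) in
-- The augmentation ideal is generated by the `x_μ`, and the coefficients of monomials matter only
-- through their augmentation. This extracts a leading form of `u` together with a counterpart for
-- `F`.
theorem exists_mem_gradedPairs {k : ℕ} {u : FGRing (FormalGroup.𝔾ₐ : FormalGroup ℤ) M}
    (hu : u ∈ RingHom.ker (aug FormalGroup.𝔾ₐ M) ^ k) :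
    ∃ p ∈ gradedPairs F k, u - p.1 ∈ RingHom.ker (aug FormalGroup.𝔾ₐ M) ^ (k + 1) := by
  induction k generalizing u with
  | zero =>
    have h1 : (1 : FGRing (FormalGroup.𝔾ₐ : FormalGroup ℤ) M × FGRing F M) ∈ gradedPairs F 0 :=
      AddSubgroup.subset_closure (Or.inl ⟨[], rfl, rfl⟩)
    refine ⟨_, AddSubgroup.zsmul_mem _ h1 (aug FormalGroup.𝔾ₐ M u), ?_⟩
    rw [zero_add, pow_one, RingHom.mem_ker]
    simp
  | succ k ih =>
    rw [pow_succ'] at hu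
    have hadd : ∀ v w : FGRing (FormalGroup.𝔾ₐ : FormalGroup ℤ) M,
        (∃ p ∈ gradedPairs F (k + 1),
          v - p.1 ∈ RingHom.ker (aug FormalGroup.𝔾ₐ M) ^ (k + 1 + 1)) →
        (∃ p ∈ gradedPairs F (k + 1),
          w - p.1 ∈ RingHom.ker (aug FormalGroup.𝔾ₐ M) ^ (k + 1 + 1)) →
        ∃ p ∈ gradedPairs F (k + 1),
          v + w - p.1 ∈ RingHom.ker (aug FormalGroup.𝔾ₐ M) ^ (k + 1 + 1) := by
      rintro v w ⟨p, hp, hp'⟩ ⟨q, hq, hq'⟩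
      refine ⟨p + q, AddSubgroup.add_mem _ hp hq, ?_⟩
      rw [Prod.fst_add, add_sub_add_comm]
      exact Ideal.add_mem _ hp' hq'
    refine Submodule.mul_induction_on hu (fun v hv => ?_) hadd
    have hv' := ker_aug_le _ hv
    clear hv hu
    induction hv' using Submodule.span_induction with
    | mem v hv =>
      obtain ⟨μ, rfl⟩ := hv
      intro w hw
      obtain ⟨p, hp, hp'⟩ := ih hw
      refine ⟨_, x_mul_mem_gradedPairs μ hp, ?_⟩
      rw [← mul_sub, pow_succ']
      exact Ideal.mul_mem_mul (x_mem _ μ) hp'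
    | zero => exact fun w _ => ⟨0, AddSubgroup.zero_mem _, by simp⟩
    | add v v' _ _ h h' =>
      intro w hw
      rw [add_mul]
      exact hadd _ _ (h w hw) (h' w hw)
    | smul a v _ h =>
      intro w hw
      rw [smul_eq_mul, mul_comm a, mul_assoc]
      exact h _ (Ideal.mul_mem_left _ _ hw)

end Graded

/-! ### The torsion index and independence when it is regular. -/

section Torsion

variable {ι M N : Type*} [AddCommGroup M] [AddCommGroup N] {P : RootDatum ι M N} [Finite ι]
  [P.IsReduced] {b : P.Base} {R : Type*} [CommRing R] (F : FormalGroup R) [F.IsComm]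

theorem deltaWord_mem_pow_ker_aug {k : ℕ} (l : List b.support) {u : FGRing F M}
    (hu : u ∈ RingHom.ker (aug F M) ^ (l.length + k)) :
    deltaWord F b l u ∈ RingHom.ker (aug F M) ^ k := by
  induction l generalizing k with
  | nil => rwa [List.length_nil, zero_add] at hu
  | cons i l ih =>
    rw [deltaWord_cons]
    refine demazure_mem_pow_ker_aug F _ _ (ih ?_)
    rwa [List.length_cons, add_assoc, add_comm 1] at hu

theorem aug_deltaWord_eq_zero {n : ℕ} {l : List b.support} (hl : l.length < n) {u : FGRing F M}
    (hu : u ∈ RingHom.ker (aug F M) ^ n) : aug F M (deltaWord F b l u) = 0 := by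
  obtain ⟨k, rfl⟩ := Nat.exists_eq_add_of_lt hl
  have h := deltaWord_mem_pow_ker_aug F l (k := k + 1) hu
  exact Ideal.pow_le_self (Nat.succ_ne_zero k) h

variable [Module.Finite ℤ M] [Module.Free ℤ M]

theorem deltaWord_mem_gradedPairs {k : ℕ} (l : List b.support)
    {p : FGRing (FormalGroup.𝔾ₐ : FormalGroup ℤ) M × FGRing F M}
    (hp : p ∈ gradedPairs F (l.length + k)) :
    (deltaWord FormalGroup.𝔾ₐ b l p.1, deltaWord F b l p.2) ∈ gradedPairs F k := by
  induction l generalizing k with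
  | nil => rwa [List.length_nil, zero_add] at hp
  | cons i l ih =>
    rw [deltaWord_cons, deltaWord_cons]
    refine demazure_mem_gradedPairs (P.ne_zero i) _ (ih ?_)
    rwa [List.length_cons, add_assoc, add_comm 1] at hp

/-- For the additive law a form of degree `k` is reduced to a constant by `k` operators, and one
more operator kills it. -/
theorem deltaWord_eq_zero_of_mem_gradedPairs {k : ℕ} {l : List b.support} (hl : k < l.length)
    {p : FGRing (FormalGroup.𝔾ₐ : FormalGroup ℤ) M × FGRing F M} (hp : p ∈ gradedPairs F k) :
    deltaWord FormalGroup.𝔾ₐ b l p.1 = 0 := by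
  induction l with
  | nil => exact absurd hl (Nat.not_lt_zero k)
  | cons i l ih =>
    rw [deltaWord_cons]
    rcases (Nat.lt_succ_iff.1 hl).eq_or_lt with rfl | h
    · exact (aug_of_mem_gradedPairs_zero (deltaWord_mem_gradedPairs F l (k := 0) hp)).2 _ _
    · rw [Module.End.mul_apply, ih h, map_zero]

/-- The operators of length `n` for `F` take, up to the augmentation, all the values which the
operators for the additive formal group law take. -/
theorem exists_aug_deltaWord_eq (b : P.Base) (u : FGRing (FormalGroup.𝔾ₐ : FormalGroup ℤ) M)
    (n : ℕ) : ∃ v ∈ RingHom.ker (aug F M) ^ n, ∀ l : List b.support, l.length = n →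
      aug F M (deltaWord F b l v) = (aug FormalGroup.𝔾ₐ M (deltaWord FormalGroup.𝔾ₐ b l u) : ℤ) := by
  -- The components of `u` of degree less than `k` are removed one after the other; they do not
  -- affect words of length at least `k`.
  have h1 : ∀ k, ∃ a ∈ RingHom.ker (aug FormalGroup.𝔾ₐ M) ^ k, ∀ l : List b.support,
      k ≤ l.length → deltaWord FormalGroup.𝔾ₐ b l u = deltaWord FormalGroup.𝔾ₐ b l a := by
    intro k
    induction k with
    | zero => exact ⟨u, by rw [pow_zero, Ideal.one_eq_top]; trivial, fun _ _ => rfl⟩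
    | succ k ih =>
      obtain ⟨a, ha, h⟩ := ih
      obtain ⟨p, hp, hp'⟩ := exists_mem_gradedPairs F ha
      refine ⟨_, hp', fun l hl => ?_⟩
      rw [map_sub, deltaWord_eq_zero_of_mem_gradedPairs F hl hp, sub_zero,
        h l (Nat.le_of_succ_le hl)]
  obtain ⟨a, ha, h⟩ := h1 n
  obtain ⟨p, hp, hp'⟩ := exists_mem_gradedPairs F ha
  refine ⟨p.2, mem_pow_of_mem_gradedPairs hp, ?_⟩
  rintro l rfl
  have h2 := aug_deltaWord_eq_zero FormalGroup.𝔾ₐ (Nat.lt_succ_self l.length) hp'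
  rw [map_sub, map_sub, sub_eq_zero] at h2
  rw [h l le_rfl, h2]
  exact (aug_of_mem_gradedPairs_zero (deltaWord_mem_gradedPairs F l (k := 0) hp)).1

variable {I : P.weylGroup → List b.support}

/-- On the `n`-th power of the augmentation ideal, the operator of a word of length `n` depends
only on the product of the word, up to the augmentation. -/
theorem aug_deltaWord_eq_ite (hI : ∀ w, wordProd b (I w) = w ∧ (I w).length = weylLength b w)
    {l : List b.support} {u : FGRing F M} (hu : u ∈ RingHom.ker (aug F M) ^ l.length) :
    aug F M (deltaWord F b l u) = if l.length = weylLength b (wordProd b l) then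
      aug F M (deltaWord F b (I (wordProd b l)) u) else 0 := by
  have := finite_weylGroup b
  let _ : Fintype P.weylGroup := Fintype.ofFinite _
  have key : ∀ c : P.weylGroup → FGRing F M, (∀ w, c w ≠ 0 → weylLength b w < l.length) →
      aug F M ((∑ w, c w • deltaWord F b (I w)) u) = 0 := by
    intro c hc
    rw [LinearMap.sum_apply, map_sum]
    refine Finset.sum_eq_zero fun w _ => ?_
    change aug F M (c w * deltaWord F b (I w) u) = 0
    rw [map_mul]
    by_cases h : c w = 0
    · rw [h, map_zero, zero_mul]
    · rw [aug_deltaWord_eq_zero F (by rw [(hI w).2]; exact hc w h) hu, mul_zero]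
  split_ifs with h
  · obtain ⟨c, hc, h1⟩ := exists_deltaWord_eq F hI h
    rw [h1, LinearMap.add_apply, map_add, key c hc, add_zero]
  · obtain ⟨c, hc, h1⟩ := exists_deltaWord_eq_of_lt F hI
      (lt_of_le_of_ne (weylLength_le b l) (Ne.symm h))
    rw [h1, key c hc]

open scoped Classical in
-- The values for the additive law are realized for `F` on the `N`-th power of the augmentation
-- ideal, where `N` is the greatest length. There the augmentation along a word of length `N`
-- depends only on its product, and vanishes unless the word is longest. So values for different
-- longest words can be added.
theorem exists_aug_deltaWord_eq_torsionIndex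
    (hI : ∀ w, wordProd b (I w) = w ∧ (I w).length = weylLength b w)
    {J : List b.support} (hJ : IsLongestWord b J) :
    ∃ u ∈ RingHom.ker (aug F M) ^ J.length, ∀ l : List b.support, l.length = J.length →
      aug F M (deltaWord F b l u) =
        if wordProd b l = wordProd b J then (torsionIndex b : R) else 0 := by
  -- Among words of the greatest length, being reduced means representing the longest element, which
  -- is unique.
  have hlen : ∀ {l : List b.support}, l.length = J.length →
      (l.length = weylLength b (wordProd b l) ↔ wordProd b l = wordProd b J) := by
    intro l hl
    refine ⟨fun h => IsLongestWord.wordProd_eq ⟨isReducedWord_iff.2 ⟨rfl, h⟩, ?_⟩ hJ, fun h => ?_⟩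
    · rw [hl]; exact hJ.2
    · rw [hl, h]; exact (isReducedWord_iff.1 hJ.1).2
  have key : ∀ k ∈ AddSubgroup.closure {k : ℤ | ∃ l : List b.support, IsLongestWord b l ∧
      ∃ u : FGRing (FormalGroup.𝔾ₐ : FormalGroup ℤ) M,
        k = aug FormalGroup.𝔾ₐ M (deltaWord FormalGroup.𝔾ₐ b l u)},
      ∃ u ∈ RingHom.ker (aug F M) ^ J.length,
        aug F M (deltaWord F b (I (wordProd b J)) u) = (k : R) := by
    intro k hk
    induction hk using AddSubgroup.closure_induction with
    | mem k hk =>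
      obtain ⟨l, hl, u, rfl⟩ := hk
      obtain ⟨v, hv, h⟩ := exists_aug_deltaWord_eq F b u J.length
      refine ⟨v, hv, ?_⟩
      have h1 := h l (hl.length_eq hJ)
      rw [← h1, aug_deltaWord_eq_ite F hI (l := l) (by rwa [hl.length_eq hJ]),
        if_pos ((hlen (hl.length_eq hJ)).2 (hl.wordProd_eq hJ)), hl.wordProd_eq hJ]
    | zero => exact ⟨0, Ideal.zero_mem _, by simp⟩
    | add k k' _ _ hk hk' =>
      obtain ⟨u, hu, h⟩ := hk
      obtain ⟨u', hu', h'⟩ := hk'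
      exact ⟨u + u', Ideal.add_mem _ hu hu', by simp [h, h']⟩
    | neg k _ hk =>
      obtain ⟨u, hu, h⟩ := hk
      exact ⟨-u, (Ideal.neg_mem_iff _).2 hu, by simp [h]⟩
  have ht := key (torsionIndex b) (by
    -- The index of a subgroup of `ℤ` belongs to it, as it annihilates the class of `1`; an infinite
    -- index counts as `0`.
    have h := AddSubgroup.nsmul_index_mem (AddSubgroup.closure {k : ℤ | ∃ l : List b.support,
      IsLongestWord b l ∧ ∃ u : FGRing (FormalGroup.𝔾ₐ : FormalGroup ℤ) M,
        k = aug FormalGroup.𝔾ₐ M (deltaWord FormalGroup.𝔾ₐ b l u)}) 1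
    rwa [nsmul_eq_mul, mul_one] at h)
  obtain ⟨u, hu, h⟩ := ht
  refine ⟨u, hu, fun l hl => ?_⟩
  rw [aug_deltaWord_eq_ite F hI (by rwa [hl])]
  simp only [hlen hl]
  split_ifs with h1
  · rw [h1, h, Int.cast_natCast]
  · rfl

/-- Each reduced word of `v` is completed to a longest word by `K v`. Applying a linear relation to
the elements `Δ_{K v}(u)` gives a square system whose matrix is invertible enough: its determinant
has augmentation a power of the torsion index. -/
theorem linearIndependent_of_isRegular_torsionIndex
    (hI : ∀ w, wordProd b (I w) = w ∧ (I w).length = weylLength b w)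
    (ht : IsRegular (torsionIndex b : R)) :
    LinearIndependent (FGRing F M) fun w => deltaWord F b (I w) := by
  classical
  have := finite_weylGroup b
  let _ : Fintype P.weylGroup := Fintype.ofFinite _
  have hext : ∀ v, ∃ l', IsLongestWord b (I v ++ l') := fun v =>
    exists_append_isLongestWord (by rw [(hI v).1]; exact (hI v).2)
  choose K hK using hext
  obtain ⟨u, hu, h⟩ := exists_aug_deltaWord_eq_torsionIndex F hI (hK 1)
  have happ : ∀ l l' : List b.support, deltaWord F b (l ++ l') =
      deltaWord F b l * deltaWord F b l' := by
    intro l l'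
    induction l with
    | nil => rw [List.nil_append, deltaWord_nil, one_mul]
    | cons i l ih => rw [List.cons_append, deltaWord_cons, deltaWord_cons, ih, mul_assoc]
  let m : Matrix P.weylGroup P.weylGroup (FGRing F M) :=
    Matrix.of fun v w => deltaWord F b (I w) (deltaWord F b (K v) u)
  have hlen : ∀ v, weylLength b v + (K v).length = (I 1 ++ K 1).length := fun v => by
    rw [← (hI v).2, ← List.length_append, (hK v).length_eq (hK 1)]
  have hm : ∀ v w, aug F M (m v w) = aug F M (deltaWord F b (I w ++ K v) u) := fun v w => by
    rw [happ]; rfl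
  have hm0 : ∀ v w, weylLength b w < weylLength b v → aug F M (m v w) = 0 := fun v w hvw => by
    rw [hm]
    refine aug_deltaWord_eq_zero F ?_ hu
    have := hlen v
    rw [List.length_append, (hI w).2]; omega
  -- For equal lengths the word `I w ++ K v` has the greatest length, and its product is the longest
  -- element exactly when `w = v`.
  have hm1 : ∀ v w, weylLength b w = weylLength b v →
      aug F M (m v w) = if v = w then (torsionIndex b : R) else 0 := fun v w hvw => by
    have h1 : (I w ++ K v).length = (I 1 ++ K 1).length := by
      rw [← hlen v, ← hvw, List.length_append, (hI w).2]
    rw [hm, h _ h1]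
    refine if_congr ?_ rfl rfl
    rw [← (hK v).wordProd_eq (hK 1), wordProd_append, wordProd_append, (hI w).1, (hI v).1,
      mul_left_inj, eq_comm]
  have hdet : IsRegular m.det := by
    refine isRegular_of_aug ?_
    have h1 : aug F M m.det = ((aug F M : FGRing F M →+* R).mapMatrix m).det :=
      RingHom.map_det (aug F M : FGRing F M →+* R) m
    have h2 : ((aug F M : FGRing F M →+* R).mapMatrix m).BlockTriangular (weylLength b) :=
      fun v w hvw => hm0 v w hvw
    rw [h1, h2.det]
    refine isRegular_iff_mem_nonZeroDivisors.2 (Submonoid.prod_mem _ fun a _ => ?_)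
    have h3 : ((aug F M : FGRing F M →+* R).mapMatrix m).toSquareBlock (weylLength b) a =
        (torsionIndex b : R) • 1 := by
      ext ⟨v, hv⟩ ⟨w, hw⟩
      refine (hm1 v w (hw.trans hv.symm)).trans ?_
      rw [Matrix.smul_apply, Matrix.one_apply, smul_eq_mul, mul_ite, mul_one, mul_zero]
      simp only [Subtype.mk.injEq]
    rw [h3, Matrix.det_smul, Matrix.det_one, mul_one]
    exact Submonoid.pow_mem _ (isRegular_iff_mem_nonZeroDivisors.1 ht) _
  refine Fintype.linearIndependent_iff.2 fun c hc w => ?_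
  have h1 : m.mulVec c = 0 := by
    funext v
    have h2 := LinearMap.congr_fun hc (deltaWord F b (K v) u)
    rw [LinearMap.sum_apply] at h2
    refine Eq.trans (Finset.sum_congr rfl fun w _ => mul_comm _ _) h2
  -- The adjugate turns the system into `det m * c w = 0` for every `w`.
  have h2 := congrArg (m.adjugate.mulVec) h1
  rw [Matrix.mulVec_mulVec, Matrix.adjugate_mul, Matrix.smul_mulVec, Matrix.one_mulVec,
    Matrix.mulVec_zero] at h2
  refine hdet.left ?_
  have h3 := congrFun h2 w
  simpa using h3

end Torsion

end FormalGroupRing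

end

/-! ### Independence when `2` is regular. -/

noncomputable section

namespace FormalGroupRing

open RootPairing

/-- Independence of pairwise separated homomorphisms. -/
theorem eq_zero_of_sum_ringHom_eq_zero {W S Q : Type*} [CommRing S] [CommRing Q] (φ : W → S →+* Q)
    (hφ : ∀ w v, w ≠ v → ∃ u, IsRegular (φ w u - φ v u)) (s : Finset W) (a : W → Q)
    (h : ∀ u, ∑ v ∈ s, a v * φ v u = 0) : ∀ v ∈ s, a v = 0 := by
  classical
  induction s using Finset.induction_on generalizing a with
  | empty => simp
  | insert w s hw ih =>
    have h1 : ∀ v ∈ s, a v = 0 := by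
      intro v hv
      obtain ⟨u₀, hu₀⟩ := hφ v w fun h => hw (h ▸ hv)
      refine hu₀.right ?_
      change a v * (φ v u₀ - φ w u₀) = 0 * _
      rw [zero_mul]
      -- Subtracting `φ w u₀` times the relation at `u` from the relation at `u₀ * u` eliminates the
      -- term of `w`.
      refine ih (fun v => a v * (φ v u₀ - φ w u₀)) (fun u => ?_) v hv
      have h2 := h (u₀ * u)
      have h3 := congrArg (φ w u₀ * ·) (h u)
      simp only [Finset.sum_insert hw, map_mul, mul_zero] at h2 h3
      have h4 : ∑ v ∈ s, a v * (φ v u₀ - φ w u₀) * φ v u =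
          ∑ v ∈ s, a v * (φ v u₀ * φ v u) - φ w u₀ * ∑ v ∈ s, a v * φ v u := by
        rw [Finset.mul_sum, ← Finset.sum_sub_distrib]
        exact Finset.sum_congr rfl fun v _ => by ring
      rw [h4]
      linear_combination h2 - h3
    intro v hv
    rcases Finset.mem_insert.1 hv with rfl | hv
    · have h2 := h 1
      rw [Finset.sum_insert hw, Finset.sum_eq_zero fun v hv => by rw [h1 v hv, zero_mul]] at h2
      simpa using h2
    · exact h1 v hv

variable {ι M N : Type*} [AddCommGroup M] [AddCommGroup N] {P : RootDatum ι M N} [Finite ι]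
  [P.IsReduced] {b : P.Base}

namespace ReflectionFrame

variable {S : Type*} [CommRing S] (D : ReflectionFrame P S)

/-- The compositions of the divided difference operators along reduced words are independent when
the elements of the Weyl group are separated. -/
theorem eq_zero_of_sum_delWord_eq_zero [Fintype P.weylGroup]
    (hD : ∀ w v, w ≠ v → ∃ u, IsRegular (D.act w u - D.act v u))
    {I : P.weylGroup → List b.support}
    (hI : ∀ w, wordProd b (I w) = w ∧ (I w).length = weylLength b w) (c : P.weylGroup → S)
    (h : ∀ u, ∑ w, c w * D.delWord b (I w) u = 0) : c = 0 := by
  have hinj := IsLocalization.injective (FractionRing S) (le_refl (nonZeroDivisors S))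
  have h1 : ∀ v, ∑ w, algebraMap S (FractionRing S) (c w) * D.wordCoeff b (I w) v = 0 := by
    intro v
    refine eq_zero_of_sum_ringHom_eq_zero
      (fun v => (algebraMap S (FractionRing S)).comp (D.act v)) (fun w v hwv => ?_) Finset.univ
      (fun v => ∑ w, algebraMap S (FractionRing S) (c w) * D.wordCoeff b (I w) v) (fun u => ?_) v
      (Finset.mem_univ v)
    · obtain ⟨u, hu⟩ := hD w v hwv
      refine ⟨u, ?_⟩
      change IsRegular (algebraMap S (FractionRing S) (D.act w u) - algebraMap S _ (D.act v u))
      rw [← map_sub]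
      exact (IsLocalization.map_units (FractionRing S)
        (⟨_, hu.mem_nonZeroDivisors⟩ : nonZeroDivisors S)).isRegular
    · have h2 := congrArg (algebraMap S (FractionRing S)) (h u)
      rw [map_sum, map_zero] at h2
      rw [← h2]
      simp only [map_mul, ← evalTwist_wordCoeff, evalTwist, Finset.sum_mul, Finset.mul_sum]
      rw [Finset.sum_comm]
      simp only [mul_assoc]
      rfl
  by_contra hc
  obtain ⟨w₀, hw₀⟩ := Function.ne_iff.1 hc
  -- At a longest `w` with nonzero coefficient only the word of `w` itself contributes, and its
  -- leading coefficient is invertible.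
  obtain ⟨w, hw, hmax⟩ := Set.exists_max_image {w | c w ≠ 0} (weylLength b) (Set.toFinite _)
    ⟨w₀, hw₀⟩
  have h2 := h1 w
  rw [Finset.sum_eq_single w] at h2
  · have h3 := wordCoeff_mul_inversionProd (D := D) (l := I w) (by rw [(hI w).1]; exact (hI w).2)
    rw [(hI w).1] at h3
    have h4 := congrArg (· * algebraMap S (FractionRing S) (D.inversionProd (b := b) w)) h2
    simp only [mul_assoc, h3, zero_mul] at h4
    have h5 : algebraMap S (FractionRing S) (c w) = 0 := by
      rcases neg_one_pow_eq_or (FractionRing S) (I w).length with h | h <;> simpa [h] using h4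
    exact hw (hinj (h5.trans (map_zero _).symm))
  · intro v _ hvw
    by_contra h3
    have hv : c v ≠ 0 := fun h => h3 (by rw [h, map_zero, zero_mul])
    obtain ⟨h4, h5⟩ := wordCoeff_ne_zero (right_ne_zero_of_mul h3)
    rw [(hI v).2] at h4 h5
    have h6 := h5 (le_antisymm h4 (hmax v hv))
    rw [(hI v).1] at h6
    exact hvw h6.symm
  · exact fun h => absurd (Finset.mem_univ w) h

end ReflectionFrame

section Separation

variable [Module.Finite ℤ M] [Module.Free ℤ M]

/-- If an element of the Weyl group is congruent to the identity modulo `d > 2`, then it is the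
identity. -/
theorem dvd_two_of_smul_sub_eq (b : P.Base) {g : P.weylGroup} (hg : g ≠ 1) {d : ℕ}
    (h : ∀ m : M, ∃ m', g • m - m = d • m') : d = 1 ∨ d = 2 := by
  have h1 : ∃ γ, b.IsPos γ ∧ ¬ b.IsPos (g • γ) := by
    by_contra! h1
    have h2 : g⁻¹ = 1 := eq_one_of_isPos (b := b) fun β hβ => by rw [inv_inv]; exact h1 β hβ
    exact hg (inv_eq_one.1 h2)
  -- A positive root `γ` sent to a negative root `δ = g γ` is in particular moved. The roots `γ`,
  -- `δ` are congruent modulo `d`, and so are their coroots.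
  obtain ⟨γ, hγ, hγ'⟩ := h1
  set δ := g • γ with hδ
  have hne : γ ≠ δ := fun h => hγ' (h ▸ hγ)
  obtain ⟨m, hm⟩ := h (P.root γ)
  rw [← root_smul, ← hδ, sub_eq_iff_eq_add] at hm
  have hco : ∀ μ : M, ∃ k : ℤ, P.coroot' δ μ = P.coroot' γ μ + d * k := by
    intro μ
    obtain ⟨μ', hμ'⟩ := h μ
    have h1 := coroot'_smul g γ μ
    rw [← hδ, sub_eq_iff_eq_add.1 hμ', map_add, map_nsmul, nsmul_eq_mul] at h1
    exact ⟨-P.coroot' δ μ', by linarith⟩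
  obtain ⟨k, hk⟩ := hco m
  obtain ⟨k', hk'⟩ := hco (P.root γ)
  have e1 : P.coroot' γ (P.root γ) = 2 := P.root_coroot_two γ
  have e2 : P.coroot' δ (P.root δ) = 2 := P.root_coroot_two δ
  have e3 : P.coroot' γ (P.root δ) = d * P.coroot' γ m + 2 := by
    rw [hm, map_add, map_nsmul, nsmul_eq_mul, e1]
  have e4 : 2 = d * P.coroot' δ m + P.coroot' δ (P.root γ) := by
    rw [← e2, hm, map_add, map_nsmul, nsmul_eq_mul]
  -- This is the finite list of possible pairs of Cartan integers in a reduced root system; the pair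
  -- `(2, 2)` occurs only for equal roots.
  have hset := P.pairingIn_pairingIn_mem_set_of_isCrystal_of_isRed γ δ
  have h22 := P.pairingIn_two_two_iff ℤ γ δ
  have p1 : P.pairingIn ℤ γ δ = P.coroot' δ (P.root γ) := P.algebraMap_pairingIn ℤ γ δ
  have p2 : P.pairingIn ℤ δ γ = P.coroot' γ (P.root δ) := P.algebraMap_pairingIn ℤ δ γ
  rw [p1, p2] at hset h22
  generalize P.coroot' δ (P.root γ) = p at *
  generalize P.coroot' γ (P.root δ) = q at *
  generalize P.coroot' γ m = s at *
  generalize P.coroot' δ m = t at *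
  rw [e1] at hk'
  have d1 : (d : ℤ) ∣ 2 - p := ⟨t, by linarith⟩
  have d2 : (d : ℤ) ∣ 2 - q := ⟨-s, by linarith⟩
  -- Using both congruences at once gives divisibility by the square of `d`. It excludes, for
  -- example, `d = 3` for the pair `(-1, -1)` and `d = 4` for `(-2, -2)`.
  have d3 : (d : ℤ) * d ∣ 4 - p - q := ⟨k, by rw [hk] at e4; linear_combination e4 - e3⟩
  have hpq : ¬ (p = 2 ∧ q = 2) := fun h => hne (h22.1 h)
  clear h22 hk hk' p1 p2 e1 e2 e3 e4 hco hm h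
  simp only [Set.mem_insert_iff, Set.mem_singleton_iff, Prod.mk.injEq] at hset
  have hle : d ≤ 5 := by
    rcases hset with h | h | h | h | h | h | h | h | h | h | h | h | h <;> obtain ⟨rfl, rfl⟩ := h <;>
      first
        | exact absurd ⟨rfl, rfl⟩ hpq
        | by_contra hd; refine absurd (Int.le_of_dvd ?_ d1) ?_ <;> omega
        | by_contra hd; refine absurd (Int.le_of_dvd ?_ d2) ?_ <;> omega
  interval_cases d <;> push_cast at d1 d2 d3 <;> omega

variable {R : Type*} [CommRing R] (F : FormalGroup R) [F.IsComm]

/-- A root is `d` times a primitive vector, and `d` divides the value `2` of its coroot on it. -/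
theorem isRegular_x_root (h2 : IsRegular (2 : R)) (i : ι) : IsRegular (x F (P.root i)) := by
  have hA : zmultiplesHom M (P.root i) ≠ 0 := fun h => P.ne_zero i (by
    have h1 := DFunLike.congr_fun h 1
    simpa using h1)
  obtain ⟨d, μ, ν, c, hd, h1, h3, h4⟩ := exists_primitive_value _ hA
  obtain ⟨ν', hν'⟩ := h4 1
  rw [zmultiplesHom_apply, one_smul] at hν'
  rw [zmultiplesHom_apply, hν', smul_comm] at h1
  have h5 : μ • ν' = ν := by
    rw [← natCast_zsmul, ← natCast_zsmul] at h1
    exact smul_right_injective M (Nat.cast_ne_zero.2 hd.ne' : (d : ℤ) ≠ 0) h1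
  have h6 : (μ • c) ν' = 1 := by
    rw [← h5, map_zsmul] at h3
    exact h3
  have h7 : d ∣ 2 := by
    have h8 : P.coroot' i (P.root i) = 2 := P.root_coroot_two i
    rw [hν', map_nsmul, nsmul_eq_mul] at h8
    exact Int.natCast_dvd_natCast.1 ⟨_, h8.symm⟩
  rw [hν']
  refine isRegular_x_nsmul h6 ?_
  rcases (Nat.dvd_prime Nat.prime_two).1 h7 with rfl | rfl
  · rw [Nat.cast_one]; exact isRegular_one
  · exact h2

/-- For suitable `μ` the vector `g μ - μ` is `d` times a primitive one, where `d` divides all of `g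
- 1` and is therefore `1` or `2`. The difference of the two `x` is then `x_{dν}` times an element of
augmentation `1`. -/
theorem exists_isRegular_sub (b : P.Base) (h2 : IsRegular (2 : R)) {g : P.weylGroup} (hg : g ≠ 1) :
    ∃ μ : M, IsRegular (x F (g • μ) - x F μ) := by
  let A : M →+ M := DistribSMul.toAddMonoidHom M g - AddMonoidHom.id M
  have hA : A ≠ 0 := fun h => hg (weylGroup_ext fun m => by
    have h1 : g • m - m = 0 := DFunLike.congr_fun h m
    rw [sub_eq_zero.1 h1, one_smul])
  obtain ⟨d, μ, ν, c, hd, h1, h3, h4⟩ := exists_primitive_value A hA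
  have h5 : g • μ - μ = d • ν := h1
  refine ⟨μ, ?_⟩
  rw [sub_eq_iff_eq_add'.1 h5]
  refine isRegular_x_add_sub_x (isRegular_x_nsmul h3 ?_)
  rcases dvd_two_of_smul_sub_eq b hg h4 with rfl | rfl
  · rw [Nat.cast_one]; exact isRegular_one
  · exact h2

/-- As the `x_α` are regular, the character lattice itself carries a frame, and no lift of `F` is
needed. Separation of `w` and `v` comes from that of `v⁻¹ w` and `1`, moved by `v`. -/
theorem linearIndependent_of_isRegular_two (h2 : IsRegular (2 : R))
    {I : P.weylGroup → List b.support}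
    (hI : ∀ w, wordProd b (I w) = w ∧ (I w).length = weylLength b w) :
    LinearIndependent (FGRing F M) fun w => deltaWord F b (I w) := by
  have := finite_weylGroup b
  let _ : Fintype P.weylGroup := Fintype.ofFinite _
  let D := (ReflectionLattice.self P).frame F (isRegular_x_root F h2)
  have hdel : ∀ (l : List b.support) u, deltaWord F b l u = D.delWord b l u := by
    intro l u
    induction l with
    | nil => rfl
    | cons i l ih => rw [deltaWord_cons, ReflectionFrame.delWord_cons, ← ih]; rfl
  refine Fintype.linearIndependent_iff.2 fun c hc w => ?_
  refine congrFun (D.eq_zero_of_sum_delWord_eq_zero (b := b) (fun w v hwv => ?_) hI c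
    fun u => ?_) w
  · obtain ⟨μ, hμ⟩ := exists_isRegular_sub F b h2 (g := v⁻¹ * w) fun h =>
      hwv (inv_mul_eq_one.1 h).symm
    refine ⟨x F μ, ?_⟩
    have h3 := isRegular_iff_mem_nonZeroDivisors.2
      (D.act_mem_nonZeroDivisors v hμ.mem_nonZeroDivisors)
    have h4 : ∀ (v : P.weylGroup) (μ : M), D.act v (x F μ) = x F (v • μ) := fun v μ =>
      mapHom_x F ((ReflectionLattice.self P).act v) μ
    rw [map_sub, h4, h4, mul_smul, smul_inv_smul] at h3
    rw [h4, h4]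
    exact h3
  · have h3 := LinearMap.congr_fun hc u
    rw [LinearMap.sum_apply] at h3
    refine Eq.trans (Finset.sum_congr rfl fun w _ => ?_) h3
    rw [← hdel]
    rfl

end Separation

end FormalGroupRing

end

theorem mainTheorem4 {ι M N R : Type*} [Finite ι] [AddCommGroup M] [AddCommGroup N]
    [Module.Finite ℤ M] [Module.Free ℤ M] (P : RootDatum ι M N) [P.IsReduced] (b : P.Base)
    [CommRing R] (F : FormalGroup R) [F.IsComm]
    (I : P.weylGroup → List b.support) (hI : ∀ w, FormalGroupRing.IsReducedWord b (I w) w) :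
    (Submodule.span (FormalGroupRing.FGRing F M)
        (Set.range fun w => FormalGroupRing.deltaWord F b (I w)) =
      FormalGroupRing.operatorModule P F) ∧
    (Submodule.span (FormalGroupRing.FGRing F M)
        (Set.range fun w => FormalGroupRing.cWord F b (I w)) =
      FormalGroupRing.operatorModule P F) ∧
    (IsRegular (2 : R) ∨ IsRegular (FormalGroupRing.torsionIndex b : R) →
      (∃ B : Module.Basis P.weylGroup (FormalGroupRing.FGRing F M)
          (FormalGroupRing.operatorModule P F),
        ∀ w, (B w : Module.End R (FormalGroupRing.FGRing F M)) =
          FormalGroupRing.deltaWord F b (I w)) ∧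
      (∃ B : Module.Basis P.weylGroup (FormalGroupRing.FGRing F M)
          (FormalGroupRing.operatorModule P F),
        ∀ w, (B w : Module.End R (FormalGroupRing.FGRing F M)) =
          FormalGroupRing.cWord F b (I w))) := by
  have hI' := fun w => FormalGroupRing.isReducedWord_iff.1 (hI w)
  refine ⟨FormalGroupRing.span_deltaWord_eq F hI', FormalGroupRing.span_cWord_eq F hI',
    fun h => FormalGroupRing.exists_basis_of_linearIndependent F hI' ?_⟩
  rcases h with h | h
  · exact FormalGroupRing.linearIndependent_of_isRegular_two F h hI'
  · exact FormalGroupRing.linearIndependent_of_isRegular_torsionIndex F hI' h
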